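/- Let $p>2$. There is a constant $c>0$ depending only on $p$ with the following property. Let $n\ge 2$, let $\delta_1,\dots,\delta_n\ge 0$, let $\Omega\subset\mathbb{R}^n$ be a bounded open set, $I=(T_0,T_1)$ a bounded open interval, $\Omega'$ an open set with $\overline{\Omega'}\subset\Omega$, and $J=(\tau_0,\tau_1)$ with $T_0<\tau_0<\tau_1<T_1$. For $\xi\in\mathbb{R}^n$, $s\in\mathbb{R}$, $\varepsilon>0$ and $\lambda\ge 0$ put $$F_0(\xi)=\sum_{i=1}^n\frac1p(|\xi_i|-\delta_i)_+^p,\qquad F_\varepsilon(\xi)=F_0(\xi)+\frac{\varepsilon}{p}(1+|\xi|^2)^{p/2},\qquad H_\lambda(s)=(|s|-\lambda)_+^{p/2}\,\frac{s}{|s|}\ (s\ne0),\quad H_\lambda(0)=0,$$ and let $\varepsilon_0=\min\{1,\inf\{\delta_i:\delta_i>0\}\}$ with $\inf\emptyset=+\infty$. Let $u\in L^p_{loc}(I;W^{1,p}_{loc}(\Omega))$, with spatial weak gradient $Du$, be a local weak solution of $\partial_t u=\mathrm{div}[D_\xi F_0(Du)]$ in $\Omega\times I$, that is, $$\iint_{\Omega\times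 I}\big(u\,\partial_t\varphi-\langle D_\xi F_0(Du),D\varphi\rangle\big)\,dx\,dt=0\quad\text{for all }\varphi\in C_0^\infty(\Omega\times I).$$ For $0<\varepsilon<\varepsilon_0$, call $u_\varepsilon$ a weak solution of the Cauchy–Dirichlet problem $$\partial_t v=\mathrm{div}[D_\xi F_\varepsilon(Dv)]\ \text{in }\Omega'\times J,\qquad v=u\ \text{on }\partial\Omega'\times J,\qquad v(\cdot,\tau_0)=u(\cdot,\tau_0)\ \text{in }\Omega'$$ if $u_\varepsilon\in L^p(J;W^{1,p}(\Omega'))$ satisfies the equation in $\Omega'\times J$ when tested with all functions of $C_0^\infty(\Omega'\times J)$, $u_\varepsilon-u\in L^p(J;W^{1,p}_0(\Omega'))$, and $u_\varepsilon(\cdot,t)-u(\cdot,t)\to0$ in $L^2(\Omega')$ as $t\downarrow\tau_0$ (outside a null set of times). If $u_\varepsilon$ is such a solution, then $u$ and $u_\varepsilon$ have representatives in $C^0(\overline J;L^2(\Omega'))$, the functions $H_{\delta_i}(\partial_{x_i}u)$ and $H_{\delta_i}(\partial_{x_i}u_\varepsilon)$ belong to $L^2(\Omega'\times J)$ for every $i$,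 and, with the values at time $\tau_1$ taken from these representatives, $$\int_{\Omega'\times\{\tau_1\}}|u_\varepsilon-u|^2dx+\sum_{i=1}^n\iint_{\Omega'\times J}\big|H_{\delta_i}(\partial_{x_i}u_\varepsilon)-H_{\delta_i}(\partial_{x_i}u)\big|^2dx\,dt+\varepsilon\iint_{\Omega'\times J}|Du_\varepsilon|^p\,dx\,dt\le c\,\varepsilon\Big(|\Omega'\times J|+\iint_{\Omega'\times J}|Du|^p\,dx\,dt\Big).$$ In particular, $$\iint_{\Omega'\times J}|Du_\varepsilon|^p\,dx\,dt\le c\Big(|\Omega'\times J|+\iint_{\Omega'\times J}|Du|^p\,dx\,dt\Big).$$ Moreover, if $u_\varepsilon$ is such a solution for every $\varepsilon\in(0,\varepsilon_0)$, then for each $j\in\{1,\dots,n\}$ $$H_{\delta_j}(\partial_{x_j}u_\varepsilon)\to H_{\delta_j}(\partial_{x_j}u)\quad\text{strongly in }L^2(\Omega'\times J)\text{ as }\varepsilon\to0.$$ -/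

import Mathlib

open MeasureTheory Set Filter Topology
open scoped ContDiff

/-- Euclidean space `ℝⁿ`. Points of space-time are pairs `(x, t) : Space n × ℝ`. -/
abbrev Space (n : ℕ) : Type := EuclideanSpace ℝ (Fin n)

noncomputable section

namespace Orthotropic

/-! ### The integrands -/

/-- `g(s) = (|s| - lam)₊ ^ p / p`. -/
def g (p lam s : ℝ) : ℝ := (1 / p) * (max (|s| - lam) 0) ^ p

/-- `F₀(ξ) = ∑ᵢ (|ξᵢ| - δᵢ)₊ ^ p / p`. -/
def F0 {n : ℕ} (p : ℝ) (δ : Fin n → ℝ) (ξ : Space n) : ℝ := ∑ i, g p (δ i) (ξ i)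

/-- `G(ξ) = (1 + |ξ|²) ^ (p / 2) / p`. -/
def G {n : ℕ} (p : ℝ) (ξ : Space n) : ℝ := (1 / p) * (1 + ‖ξ‖ ^ 2) ^ (p / 2)

/-- The regularized integrand `F_ε = F₀ + ε G` (for `p > 2`). -/
def Feps {n : ℕ} (p : ℝ) (δ : Fin n → ℝ) (ε : ℝ) (ξ : Space n) : ℝ := F0 p δ ξ + ε * G p ξ

/-- `H_lam(s) = (|s| - lam)₊ ^ (p / 2) * s / |s|` for `s ≠ 0`, and `H_lam(0) = 0`. -/
def H (p lam s : ℝ) : ℝ := if s = 0 then 0 else (max (|s| - lam) 0) ^ (p / 2) * (s / |s|)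

/-- `0 < ε < min {1, inf {δᵢ : δᵢ > 0}}`, where the infimum of the empty set is `+∞`. -/
def Admissible {n : ℕ} (δ : Fin n → ℝ) (ε : ℝ) : Prop :=
  0 < ε ∧ ε < 1 ∧ ∀ i, 0 < δ i → ε < δ i

/-! ### Function spaces -/

/-- `φ ∈ C₀^∞(A)`: smooth, with compact support contained in `A`. -/
def IsTest {X : Type*} [NormedAddCommGroup X] [NormedSpace ℝ X] (A : Set X) (φ : X → ℝ) : Prop :=
  ContDiff ℝ ∞ φ ∧ HasCompactSupport φ ∧ tsupport φ ⊆ A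

/-- `Df` is the weak (distributional) gradient of `f` in the open set `O`. -/
def HasWeakGrad {n : ℕ} (O : Set (Space n)) (f : Space n → ℝ) (Df : Space n → Space n) : Prop :=
  ∀ φ : Space n → ℝ, IsTest O φ → ∀ i : Fin n,
    ∫ x in O, f x * (gradient φ x) i = - ∫ x in O, (Df x) i * φ x

/-- `f ∈ W₀^{1,p}(O)` with gradient `Df`: `f` is the limit of functions of `C₀^∞(O)` in the norm
of `W^{1,p}(O)`. For bounded `O`, by Poincaré's inequality, this is the completion of `C₀^∞(O)`
with respect to the `L^p` norm of the gradient. -/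
def IsW01p {n : ℕ} (p : ℝ) (O : Set (Space n)) (f : Space n → ℝ) (Df : Space n → Space n) : Prop :=
  ∃ φ : ℕ → Space n → ℝ, (∀ k, IsTest O (φ k)) ∧
    Tendsto (fun k => eLpNorm (fun x => φ k x - f x) (ENNReal.ofReal p) (volume.restrict O))
      atTop (𝓝 0) ∧
    Tendsto (fun k => eLpNorm (fun x => gradient (φ k) x - Df x) (ENNReal.ofReal p)
      (volume.restrict O)) atTop (𝓝 0)

/-- `u ∈ L^p(J; W^{1,p}(O))`, with spatial weak gradient `Du`: almost every time slice of `u` has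
the corresponding slice of `Du` as its weak gradient, and `u`, `Du` belong to `L^p(O × J)`, which is
identified with `L^p(J; L^p(O))`. -/
structure MemLpW1p {n : ℕ} (p : ℝ) (O : Set (Space n)) (J : Set ℝ)
    (u : Space n × ℝ → ℝ) (Du : Space n × ℝ → Space n) : Prop where
  memLp : MemLp u (ENNReal.ofReal p) (volume.restrict (O ×ˢ J))
  memLp_grad : MemLp Du (ENNReal.ofReal p) (volume.restrict (O ×ˢ J))
  weakGrad : ∀ᵐ t ∂(volume.restrict J), HasWeakGrad O (fun x => u (x, t)) (fun x => Du (x, t))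

/-- `u ∈ L^p(J; W₀^{1,p}(O))`, with spatial weak gradient `Du`. -/
structure MemLpW01p {n : ℕ} (p : ℝ) (O : Set (Space n)) (J : Set ℝ)
    (u : Space n × ℝ → ℝ) (Du : Space n × ℝ → Space n) : Prop extends MemLpW1p p O J u Du where
  slice_zero : ∀ᵐ t ∂(volume.restrict J), IsW01p p O (fun x => u (x, t)) (fun x => Du (x, t))

/-- `u ∈ L^p_loc(I; W^{1,p}_loc(Ω))`, with spatial weak gradient `Du`: membership in
`L^p((a,b); W^{1,p}(O))` for all open `O` and intervals `(a,b)` that are compactly contained in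
`Ω` and `I`. -/
def MemLpW1pLoc {n : ℕ} (p : ℝ) (Ω : Set (Space n)) (I : Set ℝ)
    (u : Space n × ℝ → ℝ) (Du : Space n × ℝ → Space n) : Prop :=
  ∀ O : Set (Space n), IsOpen O → IsCompact (closure O) → closure O ⊆ Ω →
    ∀ a b : ℝ, a < b → Icc a b ⊆ I → MemLpW1p p O (Ioo a b) u Du

/-- `U` is the representative of `u` in `C⁰([a,b]; L²(O))`. It is uniquely determined on `[a,b]`
when `a < b`; time traces such as `u(·, b)` are understood as `U b`. -/
structure IsContRep {n : ℕ} (O : Set (Space n)) (a b : ℝ) (u : Space n × ℝ → ℝ)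
    (U : ℝ → Lp ℝ 2 (volume.restrict O)) : Prop where
  continuousOn : ContinuousOn U (Icc a b)
  ae_eq : ∀ᵐ t ∂(volume.restrict (Ioo a b)), ⇑(U t) =ᵐ[volume.restrict O] fun x => u (x, t)

/-! ### Weak solutions -/

/-- The equation `∂ₜ u = div [D_ξ F (Du)]` in `Ω × I`, tested with all `φ ∈ C₀^∞(Ω × I)`. -/
def WeakEq {n : ℕ} (F : Space n → ℝ) (Ω : Set (Space n)) (I : Set ℝ)
    (u : Space n × ℝ → ℝ) (Du : Space n × ℝ → Space n) : Prop :=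
  ∀ φ : Space n × ℝ → ℝ, IsTest (Ω ×ˢ I) φ →
    ∫ z in Ω ×ˢ I, (u z * deriv (fun s => φ (z.1, s)) z.2
      - inner ℝ (gradient F (Du z)) (gradient (fun y => φ (y, z.2)) z.1)) = 0

/-- `u ∈ L^p_loc(I; W^{1,p}_loc(Ω))`, with gradient `Du`, is a local weak solution of
`∂ₜ u = div [D_ξ F₀ (Du)]` in `Ω × I`. -/
structure IsLocalWeakSol {n : ℕ} (p : ℝ) (δ : Fin n → ℝ) (Ω : Set (Space n)) (I : Set ℝ)
    (u : Space n × ℝ → ℝ) (Du : Space n × ℝ → Space n) : Prop where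
  memLoc : MemLpW1pLoc p Ω I u Du
  weakEq : WeakEq (F0 p δ) Ω I u Du

/-- `v ∈ L^p(J; W^{1,p}(O))`, `J = (a,b)`, with gradient `Dv`, is a weak solution of the
Cauchy-Dirichlet problem
`∂ₜ v = div [D_ξ F_ε (Dv)]` in `O × J`, `v = u` on `∂O × J`, `v(·, a) = u(·, a)` in `O`.
The lateral condition means `v - u ∈ L^p(J; W₀^{1,p}(O))`. The initial condition is taken in the
`L²` sense: `v(·, t) - u(·, t) → 0` in `L²(O)` as `t ↓ a`, null sets of times being ignored
because `u` and `v` are only given almost everywhere. For functions that have representatives in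
`C⁰([a,b]; L²(O))` it says that these representatives agree at the time `a`. -/
structure IsCauchyDirichletSol {n : ℕ} (p : ℝ) (δ : Fin n → ℝ) (ε : ℝ) (O : Set (Space n))
    (a b : ℝ) (u : Space n × ℝ → ℝ) (Du : Space n × ℝ → Space n)
    (v : Space n × ℝ → ℝ) (Dv : Space n × ℝ → Space n) : Prop where
  mem : MemLpW1p p O (Ioo a b) v Dv
  weakEq : WeakEq (Feps p δ ε) O (Ioo a b) v Dv
  lateral : MemLpW01p p O (Ioo a b) (fun z => v z - u z) (fun z => Dv z - Du z)
  initial : Tendsto (fun t => eLpNorm (fun x => v (x, t) - u (x, t)) 2 (volume.restrict O))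
    (𝓝[>] a ⊓ ae volume) (𝓝 0)

end Orthotropic

end

/-! Subtracting the equations, `w = v - u` solves `∂ₜ w = div B` with `B = D F_ε(Dv) - D F₀(Du)`,
and it vanishes on the lateral boundary and at the initial time. Testing with `w` itself gives
`‖w(τ₁)‖² + 2 ∬ ⟨B, Dw⟩ = 0`, so the estimate follows from a pointwise lower bound for `⟨B, Dv -
Du⟩` (`structure_inequality`). The `F₀` part of this product is monotone and controls `p⁻² ∑ |H(∂ᵢv)
- H(∂ᵢu)|²` (`sum_sq_H_sub_le`). The `ε` part is coercive: it controls `ε |Dv|^p / 2` up to the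
error `ε 5^p (1 + |Du|^p)` (`half_norm_rpow_le`). The right-hand side is thus `O(ε)`, which also
gives the convergence as `ε → 0`.

The work lies in justifying the test function `w`, whose time derivative is only a distribution.
Testing with products `ψ(x) ζ(t)` and the lemma of du Bois-Reymond give, for almost all times `s <
t`, the identity `∫ (w(t) - w(s)) ψ = -∫ₛᵗ ∫ ⟨B, Dψ⟩`. A countable dense family of `ψ` makes the
exceptional set independent of `ψ`, so `ψ` may be any function of `W₀^{1,p}`, in particular a slice
of `w` (`exists_slice_identity`).

Let `Z = Dw`. Adding the choices `ψ = w(s)` and `ψ = w(t)` yields `‖w(t)‖² - ‖w(s)‖² = -∫ₛᵗ ∫ ⟨B,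
Z(s) + Z(t)⟩`, a trapezoidal rule for `-2 ∫ₛᵗ ∫ ⟨B, Z⟩`. Since translations in time are continuous
in `L^p`, the error for `t = s + h`, integrated over `s`, is `o(h)`. A function whose increments are
that small in the mean is constant almost everywhere. Hence `‖w(t)‖² + 2 ∫ₐᵗ ∫ ⟨B, Z⟩` is constant
(`EnergyData.exists_total_eq`).

The same identities bound `‖w(t) - w(s)‖²` by the integral of `|B| |Z - Z(s)|` near these times.
Choosing `s` so that `Z(s)` does not exceed its mean gives a Cauchy condition in `L²`, hence a
representative continuous up to both ends (`EnergyData.exists_continuous`).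

The function `u` need not vanish on `∂Ω'`. Its continuity in time comes from the same argument with
a cut-off `η`: the equation is tested with `η² u`, and the conclusion concerns `η u`. For this
reason `Z` is, in general, the gradient of the test function `η² w` and not of `w`. -/

noncomputable section

namespace Orthotropic

section

/-! ### The structure functions -/

/-- `(s - lam)₊ ^ r - (-s - lam)₊ ^ r`, which is `(|s| - lam)₊ ^ r * sign s` for `lam ≥ 0`. -/
def oddPow (r lam s : ℝ) : ℝ := max (s - lam) 0 ^ r - max (-s - lam) 0 ^ r

lemma continuous_oddPow {r : ℝ} (hr : 0 ≤ r) (lam : ℝ) : Continuous (oddPow r lam) := by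
  unfold oddPow
  have h1 : Continuous fun s : ℝ => max (s - lam) 0 := by fun_prop
  have h2 : Continuous fun s : ℝ => max (-s - lam) 0 := by fun_prop
  exact (h1.rpow_const fun _ => Or.inr hr).sub (h2.rpow_const fun _ => Or.inr hr)

lemma abs_oddPow_le {r lam : ℝ} (hr : 0 < r) (hl : 0 ≤ lam) (s : ℝ) :
    |oddPow r lam s| ≤ |s| ^ r := by
  unfold oddPow
  rcases le_total 0 s with hs | hs
  · rw [max_eq_right (by linarith : -s - lam ≤ 0), Real.zero_rpow hr.ne', sub_zero,
      abs_of_nonneg (by positivity), abs_of_nonneg hs]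
    exact Real.rpow_le_rpow (by positivity) (max_le (by linarith) hs) hr.le
  · rw [max_eq_right (by linarith : s - lam ≤ 0), Real.zero_rpow hr.ne', zero_sub, abs_neg,
      abs_of_nonneg (by positivity), abs_of_nonpos hs]
    exact Real.rpow_le_rpow (by positivity) (max_le (by linarith) (by linarith)) hr.le

/-- For `lam ≥ 0` at most one of the two one-sided powers is nonzero. This form has no division and
no case at `0`, so that continuity and monotonicity are visible. -/
lemma H_eq_oddPow {p lam : ℝ} (hp : 2 < p) (hl : 0 ≤ lam) (s : ℝ) :
    H p lam s = oddPow (p / 2) lam s := by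
  have hp2 : p / 2 ≠ 0 := by linarith
  unfold H oddPow
  rcases lt_trichotomy s 0 with hs | hs | hs
  · rw [if_neg hs.ne, max_eq_right (by linarith : s - lam ≤ 0), Real.zero_rpow hp2, abs_of_neg hs,
      div_neg, div_self hs.ne]
    ring
  · simp [hs]
  · rw [if_neg hs.ne', max_eq_right (by linarith : -s - lam ≤ 0), Real.zero_rpow hp2,
      abs_of_pos hs, div_self hs.ne']
    ring

lemma hasDerivAt_max_rpow {p : ℝ} (hp : 1 < p) (y : ℝ) :
    HasDerivAt (fun y : ℝ => max y 0 ^ p) (p * max y 0 ^ (p - 1)) y := by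
  rcases lt_trichotomy y 0 with hy | rfl | hy
  · have h : (fun y : ℝ => max y 0 ^ p) =ᶠ[𝓝 y] fun _ => 0 := by
      filter_upwards [Iio_mem_nhds hy] with z hz
      rw [max_eq_right (le_of_lt hz), Real.zero_rpow (by linarith)]
    rw [max_eq_right hy.le, Real.zero_rpow (by linarith), mul_zero]
    exact (hasDerivAt_const y (0 : ℝ)).congr_of_eventuallyEq h
  -- At the kink, `max x 0 ^ p` is dominated by `|x| ^ p`, which is `o(x)` because `p > 1`.
  · have h0 : HasDerivAt (fun x : ℝ => |x| ^ p) 0 0 := by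
      simpa using hasDerivAt_abs_rpow 0 hp
    rw [max_self, Real.zero_rpow (by linarith), mul_zero]
    rw [hasDerivAt_iff_isLittleO] at h0 ⊢
    refine (Asymptotics.IsBigO.of_bound 1 (Eventually.of_forall fun x => ?_)).trans_isLittleO h0
    have h1 : max x 0 ^ p ≤ |x| ^ p := Real.rpow_le_rpow (by positivity)
      (max_le (le_abs_self x) (abs_nonneg x)) (by linarith)
    have h2 : (0 : ℝ) ≤ max x 0 ^ p := by positivity
    simp only [max_self, Real.zero_rpow (by linarith : p ≠ 0), sub_zero, smul_zero, abs_zero,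
      one_mul, Real.norm_eq_abs]
    rw [abs_of_nonneg h2, abs_of_nonneg (by positivity)]
    exact h1
  · have h : (fun y : ℝ => max y 0 ^ p) =ᶠ[𝓝 y] fun y => y ^ p := by
      filter_upwards [Ioi_mem_nhds hy] with z hz
      rw [max_eq_left (le_of_lt hz)]
    rw [max_eq_left hy.le]
    exact (Real.hasDerivAt_rpow_const (Or.inl hy.ne')).congr_of_eventuallyEq h

lemma hasDerivAt_g {p lam : ℝ} (hp : 2 < p) (hl : 0 ≤ lam) (s : ℝ) :
    HasDerivAt (g p lam) (oddPow (p - 1) lam s) s := by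
  have hp0 : p ≠ 0 := by linarith
  have hg : g p lam = fun s => (1 / p) * (max (s - lam) 0 ^ p + max (-s - lam) 0 ^ p) := by
    funext s
    unfold g
    rcases le_total 0 s with hs | hs
    · rw [max_eq_right (by linarith : -s - lam ≤ 0), Real.zero_rpow hp0, abs_of_nonneg hs, add_zero]
    · rw [max_eq_right (by linarith : s - lam ≤ 0), Real.zero_rpow hp0, abs_of_nonpos hs, zero_add]
  rw [hg]
  have h1 := (hasDerivAt_max_rpow (by linarith : 1 < p) (s - lam)).comp s
    ((hasDerivAt_id s).sub_const lam)
  have h2 := (hasDerivAt_max_rpow (by linarith : 1 < p) (-s - lam)).comp s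
    ((hasDerivAt_id s).neg.sub_const lam)
  refine ((h1.add h2).const_mul (1 / p)).congr_deriv ?_
  unfold oddPow
  field_simp
  ring

/-- The gradient of `F0`. -/
def gradF0 {n : ℕ} (p : ℝ) (δ : Fin n → ℝ) (ξ : Space n) : Space n :=
  WithLp.toLp 2 fun i => oddPow (p - 1) (δ i) (ξ i)

/-- The gradient of `G`. -/
def gradG {n : ℕ} (p : ℝ) (ξ : Space n) : Space n := (1 + ‖ξ‖ ^ 2) ^ (p / 2 - 1) • ξ

variable {n : ℕ} {p : ℝ} {δ : Fin n → ℝ}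

lemma hasGradientAt_F0 (hp : 2 < p) (hδ : ∀ i, 0 ≤ δ i) (ξ : Space n) :
    HasGradientAt (F0 p δ) (gradF0 p δ ξ) ξ := by
  rw [hasGradientAt_iff_hasFDerivAt]
  have h : HasFDerivAt (F0 p δ) (∑ i, oddPow (p - 1) (δ i) (ξ i) •
      (EuclideanSpace.proj i : Space n →L[ℝ] ℝ)) ξ := by
    have hi : ∀ i, HasFDerivAt (fun ξ : Space n => g p (δ i) (ξ i))
        (oddPow (p - 1) (δ i) (ξ i) • (EuclideanSpace.proj i : Space n →L[ℝ] ℝ)) ξ := fun i =>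
      HasDerivAt.comp_hasFDerivAt (f := fun ξ : Space n => ξ i) ξ (hasDerivAt_g hp (hδ i) (ξ i))
        ((EuclideanSpace.proj i : Space n →L[ℝ] ℝ).hasFDerivAt)
    exact HasFDerivAt.fun_sum fun i _ => hi i
  refine h.congr_fderiv ?_
  ext x
  simp [gradF0, PiLp.inner_apply, mul_comm]

lemma hasGradientAt_G (hp : 2 < p) (ξ : Space n) :
    HasGradientAt (G p) (gradG p ξ) ξ := by
  rw [hasGradientAt_iff_hasFDerivAt]
  have h0 : HasFDerivAt (fun ξ : Space n => 1 + ‖ξ‖ ^ 2) (2 • innerSL ℝ ξ) ξ :=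
    ((hasStrictFDerivAt_norm_sq ξ).hasFDerivAt).const_add 1
  have h1 := (h0.rpow_const (p := p / 2) (Or.inl (by positivity))).const_mul (1 / p)
  refine h1.congr_fderiv ?_
  ext x
  simp [gradG]
  field_simp

lemma gradient_F0 (hp : 2 < p) (hδ : ∀ i, 0 ≤ δ i) (ξ : Space n) :
    gradient (F0 p δ) ξ = gradF0 p δ ξ := (hasGradientAt_F0 hp hδ ξ).gradient

lemma gradient_Feps (hp : 2 < p) (hδ : ∀ i, 0 ≤ δ i) (ε : ℝ) (ξ : Space n) :
    gradient (Feps p δ ε) ξ = gradF0 p δ ξ + ε • gradG p ξ := by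
  refine HasGradientAt.gradient ?_
  rw [hasGradientAt_iff_hasFDerivAt, map_add, map_smul]
  exact (hasGradientAt_iff_hasFDerivAt.1 (hasGradientAt_F0 hp hδ ξ)).add
    ((hasGradientAt_iff_hasFDerivAt.1 (hasGradientAt_G hp ξ)).const_smul ε)

lemma continuous_gradF0 (hp : 2 < p) : Continuous (gradF0 p δ) := by
  unfold gradF0
  refine (PiLp.continuous_toLp 2 _).comp (continuous_pi fun i => ?_)
  exact (continuous_oddPow (by linarith) _).comp (EuclideanSpace.proj i).continuous

lemma continuous_gradG : Continuous (gradG (n := n) p) := by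
  unfold gradG
  refine Continuous.smul (Continuous.rpow_const (by fun_prop) fun x => Or.inl (by positivity))
    continuous_id

/-- The factor `n` is the triangle inequality over the coordinates. The bound serves integrability
only, so it does not affect the constant of the theorem. -/
lemma norm_gradF0_le (hp : 2 < p) (hδ : ∀ i, 0 ≤ δ i) (ξ : Space n) :
    ‖gradF0 p δ ξ‖ ≤ n * ‖ξ‖ ^ (p - 1) := by
  have h : gradF0 p δ ξ = ∑ i, EuclideanSpace.single i (oddPow (p - 1) (δ i) (ξ i)) := by
    ext j
    simp [gradF0, Finset.sum_apply]
  rw [h]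
  refine (norm_sum_le _ _).trans ?_
  have : ∀ i ∈ Finset.univ, ‖EuclideanSpace.single i (oddPow (p - 1) (δ i) (ξ i))‖
      ≤ ‖ξ‖ ^ (p - 1) := by
    intro i _
    rw [PiLp.norm_single, Real.norm_eq_abs]
    refine (abs_oddPow_le (by linarith) (hδ i) _).trans ?_
    exact Real.rpow_le_rpow (abs_nonneg _) (by simpa using PiLp.norm_apply_le ξ i) (by linarith)
  simpa using Finset.sum_le_sum this

lemma norm_gradG_le (hp : 2 < p) (ξ : Space n) :
    ‖gradG p ξ‖ ≤ (1 + ‖ξ‖) ^ (p - 1) := by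
  unfold gradG
  rw [norm_smul, Real.norm_eq_abs, abs_of_nonneg (by positivity)]
  have h1 : (1 + ‖ξ‖ ^ 2) ^ (p / 2 - 1) ≤ (1 + ‖ξ‖) ^ (p - 2) := by
    calc (1 + ‖ξ‖ ^ 2) ^ (p / 2 - 1) ≤ ((1 + ‖ξ‖) ^ 2) ^ (p / 2 - 1) := by
          refine Real.rpow_le_rpow (by positivity) ?_ (by linarith)
          nlinarith [norm_nonneg ξ]
      _ = (1 + ‖ξ‖) ^ (p - 2) := by
          rw [← Real.rpow_natCast, ← Real.rpow_mul (by positivity)]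
          congr 1
          push_cast
          ring
  calc (1 + ‖ξ‖ ^ 2) ^ (p / 2 - 1) * ‖ξ‖ ≤ (1 + ‖ξ‖) ^ (p - 2) * (1 + ‖ξ‖) := by
        gcongr
        linarith
    _ = (1 + ‖ξ‖) ^ (p - 1) := by
        rw [← Real.rpow_add_one (by positivity)]
        congr 1
        ring

/-- The elementary inequality behind the monotonicity of the operator. -/
lemma sq_rpow_sub_le (hp : 2 < p) {x y : ℝ} (hy : 0 ≤ y) (hxy : y ≤ x) :
    (x ^ (p / 2) - y ^ (p / 2)) ^ 2 ≤ p ^ 2 / 4 * ((x ^ (p - 1) - y ^ (p - 1)) * (x - y)) := by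
  have hx : 0 ≤ x := hy.trans hxy
  rcases hx.eq_or_lt with h0 | h0
  · have : y = x := le_antisymm hxy (by linarith)
    simp [this]
  -- Tangent line inequality for the convex function `x ^ (p / 2)`: Bernoulli at `y / x`. Its square
  -- and `h2` combine through `(x ^ (p / 2 - 1)) ^ 2 = x ^ (p - 2)`.
  have h1 : x ^ (p / 2) - y ^ (p / 2) ≤ p / 2 * x ^ (p / 2 - 1) * (x - y) := by
    have hB := one_add_mul_self_le_rpow_one_add (s := y / x - 1) (p := p / 2)
      (by linarith [div_nonneg hy hx]) (by linarith)
    have e : 1 + (y / x - 1) = y / x := by ring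
    rw [e, Real.div_rpow hy hx, le_div_iff₀ (by positivity)] at hB
    have e2 : x ^ (p / 2) = x ^ (p / 2 - 1) * x := by
      rw [← Real.rpow_add_one h0.ne']
      congr 1
      ring
    have e3 : (1 + p / 2 * (y / x - 1)) * x ^ (p / 2)
        = x ^ (p / 2) - p / 2 * x ^ (p / 2 - 1) * (x - y) := by
      rw [e2]
      field_simp
      ring
    linarith
  have h2 : x ^ (p - 2) * (x - y) ≤ x ^ (p - 1) - y ^ (p - 1) := by
    have e2 : x ^ (p - 1) = x ^ (p - 2) * x := by
      rw [← Real.rpow_add_one h0.ne']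
      congr 1
      ring
    have e3 : y ^ (p - 1) ≤ x ^ (p - 2) * y := by
      rcases hy.eq_or_lt with h | h
      · rw [← h, Real.zero_rpow (by linarith), mul_zero]
      · have : y ^ (p - 1) = y ^ (p - 2) * y := by
          rw [← Real.rpow_add_one h.ne']
          congr 1
          ring
        rw [this]
        exact mul_le_mul_of_nonneg_right (Real.rpow_le_rpow hy hxy (by linarith)) hy
    rw [e2, mul_sub]
    linarith
  have h3 : 0 ≤ x ^ (p / 2) - y ^ (p / 2) :=
    sub_nonneg.2 (Real.rpow_le_rpow hy hxy (by linarith))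
  have h4 : (x ^ (p / 2 - 1)) ^ 2 = x ^ (p - 2) := by
    rw [← Real.rpow_natCast, ← Real.rpow_mul hx]
    congr 1
    push_cast
    ring
  calc (x ^ (p / 2) - y ^ (p / 2)) ^ 2 ≤ (p / 2 * x ^ (p / 2 - 1) * (x - y)) ^ 2 :=
        pow_le_pow_left₀ h3 h1 2
    _ = p ^ 2 / 4 * ((x ^ (p - 2) * (x - y)) * (x - y)) := by
        rw [← h4]
        ring
    _ ≤ _ := by gcongr

/-- The truncations `(s - lam)₊` and `(-s - lam)₊` are monotone in opposite directions, and for `b ≤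
a` their variations add up to at most `a - b`. The scalar inequality `sq_rpow_sub_le` applies to
each one. The mixed products are nonnegative and can be added on the right. -/
lemma sq_H_sub_le {lam : ℝ} (hp : 2 < p) (hl : 0 ≤ lam) (a b : ℝ) :
    |H p lam a - H p lam b| ^ 2
      ≤ p ^ 2 * ((oddPow (p - 1) lam a - oddPow (p - 1) lam b) * (a - b)) := by
  wlog hab : b ≤ a generalizing a b
  · have := this b a (le_of_not_ge hab)
    rw [abs_sub_comm]
    linarith
  rw [H_eq_oddPow hp hl, H_eq_oddPow hp hl, sq_abs]
  unfold oddPow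
  have hP : max (b - lam) 0 ≤ max (a - lam) 0 := max_le_max (by linarith) le_rfl
  have hQ : max (-a - lam) 0 ≤ max (-b - lam) 0 := max_le_max (by linarith) le_rfl
  have hsum : (max (a - lam) 0 - max (b - lam) 0) + (max (-b - lam) 0 - max (-a - lam) 0)
      ≤ a - b := by
    rcases max_cases (a - lam) 0 with h1 | h1 <;> rcases max_cases (b - lam) 0 with h2 | h2 <;>
    rcases max_cases (-a - lam) 0 with h3 | h3 <;> rcases max_cases (-b - lam) 0 with h4 | h4 <;>
    linarith
  have hP0 : 0 ≤ max (b - lam) 0 := le_max_right _ _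
  have hQ0 : 0 ≤ max (-a - lam) 0 := le_max_right _ _
  generalize max (a - lam) 0 = P at *
  generalize max (b - lam) 0 = P' at *
  generalize max (-a - lam) 0 = Q' at *
  generalize max (-b - lam) 0 = Q at *
  have e1 := sq_rpow_sub_le hp hP0 hP
  have e2 := sq_rpow_sub_le hp hQ0 hQ
  have m1 : 0 ≤ P ^ (p - 1) - P' ^ (p - 1) :=
    sub_nonneg.2 (Real.rpow_le_rpow hP0 hP (by linarith))
  have m2 : 0 ≤ Q ^ (p - 1) - Q' ^ (p - 1) :=
    sub_nonneg.2 (Real.rpow_le_rpow hQ0 hQ (by linarith))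
  have e3 : (P ^ (p - 1) - P' ^ (p - 1)) * (P - P') + (Q ^ (p - 1) - Q' ^ (p - 1)) * (Q - Q')
      ≤ (P ^ (p - 1) - P' ^ (p - 1) + (Q ^ (p - 1) - Q' ^ (p - 1))) * (a - b) := by
    have a1 := mul_le_mul_of_nonneg_left (by linarith : P - P' ≤ a - b) m1
    have a2 := mul_le_mul_of_nonneg_left (by linarith : Q - Q' ≤ a - b) m2
    nlinarith
  have e4 : (P ^ (p / 2) - Q' ^ (p / 2) - (P' ^ (p / 2) - Q ^ (p / 2))) ^ 2
      ≤ 2 * (P ^ (p / 2) - P' ^ (p / 2)) ^ 2 + 2 * (Q ^ (p / 2) - Q' ^ (p / 2)) ^ 2 := by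
    nlinarith [sq_nonneg ((P ^ (p / 2) - P' ^ (p / 2)) - (Q ^ (p / 2) - Q' ^ (p / 2)))]
  calc _ ≤ _ := e4
    _ ≤ 2 * (p ^ 2 / 4 * ((P ^ (p - 1) - P' ^ (p - 1)) * (P - P')))
        + 2 * (p ^ 2 / 4 * ((Q ^ (p - 1) - Q' ^ (p - 1)) * (Q - Q'))) := by gcongr
    _ = p ^ 2 / 2 * ((P ^ (p - 1) - P' ^ (p - 1)) * (P - P')
        + (Q ^ (p - 1) - Q' ^ (p - 1)) * (Q - Q')) := by ring
    _ ≤ p ^ 2 * ((P ^ (p - 1) - P' ^ (p - 1)) * (P - P')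
        + (Q ^ (p - 1) - Q' ^ (p - 1)) * (Q - Q')) := by
        have : 0 ≤ (P ^ (p - 1) - P' ^ (p - 1)) * (P - P')
          + (Q ^ (p - 1) - Q' ^ (p - 1)) * (Q - Q') :=
          add_nonneg (mul_nonneg m1 (by linarith)) (mul_nonneg m2 (by linarith))
        nlinarith [sq_nonneg p]
    _ ≤ p ^ 2 * ((P ^ (p - 1) - P' ^ (p - 1) + (Q ^ (p - 1) - Q' ^ (p - 1))) * (a - b)) := by
        gcongr
    _ = _ := by ring

lemma sum_sq_H_sub_le (hp : 2 < p) (hδ : ∀ i, 0 ≤ δ i) (ξ η : Space n) :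
    ∑ i, |H p (δ i) (ξ i) - H p (δ i) (η i)| ^ 2
      ≤ p ^ 2 * inner ℝ (gradF0 p δ ξ - gradF0 p δ η) (ξ - η) := by
  rw [PiLp.inner_apply, Finset.mul_sum]
  refine Finset.sum_le_sum fun i _ => (sq_H_sub_le hp (hδ i) _ _).trans_eq ?_
  rw [RCLike.inner_apply, conj_trivial, mul_comm (_ - _)]
  rfl

/-- If `‖ξ‖ ≥ 2 ‖η‖`, then `⟨ξ, ξ - η⟩ ≥ ‖ξ‖² / 2`, and the weight is at least `‖ξ‖ ^ (p - 2)`.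
Otherwise `‖ξ‖ ^ p` and the possibly negative inner product are both controlled by `(1 + 4 ‖η‖²) ^
(p / 2)`. The number `5` comes from `1 + 4 y² ≤ 5 max(1, y²)`. -/
lemma half_norm_rpow_le (hp : 2 < p) (ξ η : Space n) :
    ‖ξ‖ ^ p / 2 ≤ inner ℝ (gradG p ξ) (ξ - η) + 5 ^ p * (1 + ‖η‖ ^ p) := by
  have hin : inner ℝ (gradG p ξ) (ξ - η)
      = (1 + ‖ξ‖ ^ 2) ^ (p / 2 - 1) * (‖ξ‖ ^ 2 - inner ℝ ξ η) := by
    rw [gradG, real_inner_smul_left, inner_sub_right, real_inner_self_eq_norm_sq]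
  have hCS := real_inner_le_norm ξ η
  have hsq : ∀ (x r : ℝ), 0 ≤ x → (x ^ 2) ^ (r / 2) = x ^ r := fun x r hx => by
    rw [← Real.rpow_natCast, ← Real.rpow_mul hx]
    congr 1
    push_cast
    ring
  rw [hin]
  have hx := norm_nonneg ξ
  have hy := norm_nonneg η
  generalize ‖ξ‖ = x at *
  generalize ‖η‖ = y at *
  generalize inner ℝ ξ η = z at *
  have hm : 0 ≤ (1 + x ^ 2) ^ (p / 2 - 1) := by positivity
  rcases le_or_gt (2 * y) x with h | h
  · have h1 : x ^ p ≤ (1 + x ^ 2) ^ (p / 2 - 1) * x ^ 2 := by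
      calc x ^ p = (x ^ 2) ^ (p / 2 - 1) * x ^ 2 := by
            rcases hx.eq_or_lt with h0 | h0
            · rw [← h0, Real.zero_rpow (by linarith)]
              simp
            · rw [← Real.rpow_add_one (by positivity), sub_add_cancel, hsq x p hx]
        _ ≤ _ := by
            refine mul_le_mul_of_nonneg_right ?_ (by positivity)
            exact Real.rpow_le_rpow (by positivity) (by linarith) (by linarith)
    have h2 : x ^ 2 / 2 ≤ x ^ 2 - z := by nlinarith
    have h3 := mul_le_mul_of_nonneg_left h2 hm
    have h4 : (0 : ℝ) ≤ 5 ^ p * (1 + y ^ p) := by positivity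
    linarith
  · have hK : (1 + x ^ 2) ^ (p / 2 - 1) ≤ (1 + 4 * y ^ 2) ^ (p / 2 - 1) :=
      Real.rpow_le_rpow (by positivity) (by nlinarith) (by linarith)
    have h1 : -((1 + 4 * y ^ 2) ^ (p / 2) / 2) ≤ (1 + x ^ 2) ^ (p / 2 - 1) * (x ^ 2 - z) := by
      have e : (1 + 4 * y ^ 2) ^ (p / 2) = (1 + 4 * y ^ 2) ^ (p / 2 - 1) * (1 + 4 * y ^ 2) := by
        rw [← Real.rpow_add_one (by positivity), sub_add_cancel]
      have h2 : -(2 * y ^ 2) ≤ x ^ 2 - z := by nlinarith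
      have h3 := mul_le_mul_of_nonneg_left h2 hm
      have h4 := mul_le_mul_of_nonneg_right hK (by positivity : 0 ≤ 2 * y ^ 2)
      have h5 : 0 ≤ (1 + 4 * y ^ 2) ^ (p / 2 - 1) := by positivity
      rw [e]
      nlinarith
    have h2 : x ^ p ≤ (1 + 4 * y ^ 2) ^ (p / 2) := by
      rw [← hsq x p hx]
      exact Real.rpow_le_rpow (by positivity) (by nlinarith) (by linarith)
    have h3 : (1 + 4 * y ^ 2) ^ (p / 2) ≤ 5 ^ p * (1 + y ^ p) := by
      rcases le_total y 1 with h1 | h1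
      · calc (1 + 4 * y ^ 2) ^ (p / 2) ≤ 5 ^ (p / 2) :=
              Real.rpow_le_rpow (by positivity) (by nlinarith) (by linarith)
          _ ≤ 5 ^ p * 1 := by
              rw [mul_one]
              exact Real.rpow_le_rpow_of_exponent_le (by norm_num) (by linarith)
          _ ≤ _ := by
              gcongr
              linarith [Real.rpow_nonneg hy p]
      · calc (1 + 4 * y ^ 2) ^ (p / 2) ≤ (5 * y ^ 2) ^ (p / 2) :=
              Real.rpow_le_rpow (by positivity) (by nlinarith) (by linarith)
          _ = 5 ^ (p / 2) * y ^ p := by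
              rw [Real.mul_rpow (by norm_num) (by positivity), hsq y p hy]
          _ ≤ _ := by
              gcongr
              · norm_num
              · linarith
              · linarith
    linarith

lemma abs_H_le {lam : ℝ} (hp : 2 < p) (hl : 0 ≤ lam) (s : ℝ) :
    |H p lam s| ≤ |s| ^ (p / 2) := by
  rw [H_eq_oddPow hp hl]
  exact abs_oddPow_le (by linarith) hl s

end

section

/-! ### Translations and mollification -/

/-- The translation action on `L^p` is continuous for finite exponents. The statement covers a
general group because it is used on `ℝⁿ` for mollification and on space-time for shifts in time. -/
lemma tendsto_eLpNorm_translate {V E : Type*} [NormedAddCommGroup V] [SecondCountableTopology V]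
    [MeasurableSpace V] [BorelSpace V] [NormedAddCommGroup E] {μ : Measure V}
    [IsLocallyFiniteMeasure μ] [μ.InnerRegularCompactLTTop] [μ.IsAddLeftInvariant]
    {P : ENNReal} (hP : 1 ≤ P) (hP' : P ≠ ⊤) {f : V → E} (hf : MemLp f P μ) :
    Tendsto (fun y => eLpNorm (fun x => f (y + x) - f x) P μ) (𝓝 0) (𝓝 0) := by
  have : Fact (1 ≤ P) := ⟨hP⟩
  have : Fact (P ≠ ⊤) := ⟨hP'⟩
  have hc : Continuous fun y : V => (DomAddAct.mk y) +ᵥ hf.toLp f :=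
    (DomAddAct.continuous_mk).vadd continuous_const
  have h := (hc.tendsto 0).edist (tendsto_const_nhds (x := hf.toLp f))
  simp only [DomAddAct.mk_zero, zero_vadd, edist_self] at h
  refine h.congr fun y => ?_
  rw [DomAddAct.mk_vadd_toLp, Lp.edist_toLp_toLp]
  rfl

lemma eLpNorm_ofReal_rpow {X E : Type*} [MeasurableSpace X] [NormedAddCommGroup E] {p : ℝ}
    (hp : 0 < p) (f : X → E) (μ : Measure X) :
    eLpNorm f (ENNReal.ofReal p) μ ^ p = ∫⁻ x, ‖f x‖ₑ ^ p ∂μ := by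
  rw [eLpNorm_eq_lintegral_rpow_enorm_toReal (by simpa using hp) ENNReal.ofReal_ne_top,
    ENNReal.toReal_ofReal hp.le, ← ENNReal.rpow_mul, one_div_mul_cancel hp.ne', ENNReal.rpow_one]

variable {n : ℕ}

lemma tendsto_eLpNorm_translate_snd {E : Type*} [NormedAddCommGroup E]
    {P : ENNReal} (hP : 1 ≤ P) (hP' : P ≠ ⊤) {f : Space n × ℝ → E} (hf : MemLp f P volume) :
    Tendsto (fun h : ℝ => eLpNorm (fun z => f (z.1, h + z.2) - f z) P volume) (𝓝 0) (𝓝 0) := by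
  have : (volume : Measure (Space n × ℝ)).IsAddLeftInvariant :=
    inferInstanceAs ((volume : Measure (Space n)).prod (volume : Measure ℝ)).IsAddLeftInvariant
  have h := tendsto_eLpNorm_translate hP hP' hf
  have h2 : Tendsto (fun h : ℝ => ((0 : Space n), h)) (𝓝 0) (𝓝 0) :=
    (by fun_prop : Continuous fun h : ℝ => ((0 : Space n), h)).tendsto' 0 0 rfl
  refine (h.comp h2).congr fun r => ?_
  simp only [Function.comp]
  congr 1
  funext z
  congr 2
  ext <;> simp

/-- Mollification converges in `L^p`. -/
lemma eLpNorm_mollify_sub_le {E : Type*} [NormedAddCommGroup E] [NormedSpace ℝ E] [CompleteSpace E]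
    {p : ℝ} (hp : 1 ≤ p) {f : Space n → E} (hfm : StronglyMeasurable f)
    (hf : MemLp f (ENNReal.ofReal p) volume) (φ : ContDiffBump (0 : Space n)) {C : ENNReal}
    (hC : ∀ y, ‖y‖ < φ.rOut →
      eLpNorm (fun x => f (y + x) - f x) (ENNReal.ofReal p) volume ≤ C) :
    eLpNorm (fun x => convolution (φ.normed volume) f (ContinuousLinearMap.lsmul ℝ ℝ) volume x - f x)
      (ENNReal.ofReal p) volume ≤ C := by
  have hp0 : 0 < p := by linarith
  have hP0 : ENNReal.ofReal p ≠ 0 := by simpa using hp0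
  have hP1 : 1 ≤ ENNReal.ofReal p := by simpa using ENNReal.ofReal_le_ofReal hp
  have hloc : LocallyIntegrable f volume := hf.locallyIntegrable hP1
  set ρ := φ.normed volume with hρ
  have hρ0 : ∀ y, 0 ≤ ρ y := fun y => φ.nonneg_normed y
  have hρc : Continuous ρ := φ.continuous_normed
  have hρs : HasCompactSupport ρ := φ.hasCompactSupport_normed
  have hρi : Integrable ρ volume := hρc.integrable_of_hasCompactSupport hρs
  -- The normalized bump becomes the density of a probability measure. Jensen's inequality is then
  -- the monotonicity of `L^p` norms in the exponent, and Tonelli reduces the claim to translations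
  -- shorter than the radius of the bump.
  set ν := (volume : Measure (Space n)).withDensity fun y => ENNReal.ofReal (ρ y) with hν
  have hmρ : Measurable fun y => ENNReal.ofReal (ρ y) := (hρc.measurable).ennreal_ofReal
  have hν1 : IsProbabilityMeasure ν := by
    constructor
    rw [hν, withDensity_apply _ MeasurableSet.univ, Measure.restrict_univ,
      ← ofReal_integral_eq_lintegral_ofReal hρi (Eventually.of_forall hρ0), φ.integral_normed]
    simp
  have hm : StronglyMeasurable fun z : Space n × Space n => f (z.1 - z.2) - f z.1 :=
    (hfm.comp_measurable (measurable_fst.sub measurable_snd)).sub (hfm.comp_measurable measurable_fst)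
  have hpt : ∀ x, ‖convolution ρ f (ContinuousLinearMap.lsmul ℝ ℝ) volume x - f x‖ₑ ^ p
      ≤ ∫⁻ y, ‖f (x - y) - f x‖ₑ ^ p ∂ν := by
    intro x
    have hex := (hρs.convolutionExists_left (ContinuousLinearMap.lsmul ℝ ℝ) hρc hloc) x
    have e1 : convolution ρ f (ContinuousLinearMap.lsmul ℝ ℝ) volume x - f x
        = ∫ y, ρ y • (f (x - y) - f x) := by
      simp only [smul_sub]
      have hex' : Integrable (fun y => ρ y • f (x - y)) volume := hex
      rw [integral_sub hex' (hρi.smul_const _), integral_smul_const, φ.integral_normed, one_smul]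
      rfl
    have e2 : ‖convolution ρ f (ContinuousLinearMap.lsmul ℝ ℝ) volume x - f x‖ₑ
        ≤ ∫⁻ y, ‖f (x - y) - f x‖ₑ ∂ν := by
      rw [e1]
      refine (enorm_integral_le_lintegral_enorm _).trans_eq ?_
      have hmx : Measurable fun y => ‖f (x - y) - f x‖ₑ :=
        (hm.comp_measurable (measurable_prodMk_left (x := x))).enorm
      rw [hν, lintegral_withDensity_eq_lintegral_mul _ hmρ hmx]
      refine lintegral_congr fun y => ?_
      simp [enorm_smul, Real.enorm_eq_ofReal (hρ0 y)]
    have e3 := ENNReal.rpow_le_rpow (eLpNorm_le_eLpNorm_of_exponent_le (μ := ν) hP1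
      (hm.comp_measurable (measurable_prodMk_left (x := x))).aestronglyMeasurable) hp0.le
    rw [eLpNorm_one_eq_lintegral_enorm, eLpNorm_ofReal_rpow hp0] at e3
    exact (ENNReal.rpow_le_rpow e2 hp0.le).trans e3
  rw [← ENNReal.rpow_le_rpow_iff hp0, eLpNorm_ofReal_rpow hp0]
  calc _ ≤ ∫⁻ x, ∫⁻ y, ‖f (x - y) - f x‖ₑ ^ p ∂ν := lintegral_mono hpt
    _ = ∫⁻ y, (∫⁻ x, ‖f (x - y) - f x‖ₑ ^ p) ∂ν :=
        lintegral_lintegral_swap (hm.enorm.pow_const p).aemeasurable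
    _ = ∫⁻ y, ENNReal.ofReal (ρ y) * ∫⁻ x, ‖f (x - y) - f x‖ₑ ^ p := by
        rw [hν, lintegral_withDensity_eq_lintegral_mul _ hmρ]
        · rfl
        · exact (hm.enorm.pow_const p).lintegral_prod_left'
    _ ≤ ∫⁻ y, ENNReal.ofReal (ρ y) * C ^ p := by
        refine lintegral_mono fun y => ?_
        by_cases hy : ‖y‖ < φ.rOut
        · dsimp only
          gcongr
          have := hC (-y) (by rwa [norm_neg])
          rw [← ENNReal.rpow_le_rpow_iff hp0, eLpNorm_ofReal_rpow hp0] at this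
          simpa [neg_add_eq_sub] using this
        · have : ρ y = 0 := by
            rw [← Function.notMem_support, hρ, φ.support_normed_eq]
            simpa using hy
          simp [this]
    _ = C ^ p := by
        rw [lintegral_mul_const _ hmρ, ← ofReal_integral_eq_lintegral_ofReal hρi
          (Eventually.of_forall hρ0), φ.integral_normed]
        simp

end

/-! ### Weak gradients, mollification and membership in `W₀^{1,p}`. -/

section

variable {n : ℕ}

lemma gradient_apply (φ : Space n → ℝ) (x : Space n) (i : Fin n) :
    gradient φ x i = fderiv ℝ φ x (EuclideanSpace.single i 1) := by
  have h : inner ℝ (gradient φ x) (EuclideanSpace.single i (1 : ℝ))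
      = fderiv ℝ φ x (EuclideanSpace.single i 1) := by
    rw [gradient, InnerProductSpace.toDual_symm_apply]
  rw [← h, EuclideanSpace.inner_single_right]
  simp

lemma continuous_gradient {φ : Space n → ℝ} (hφ : ContDiff ℝ 1 φ) : Continuous (gradient φ) := by
  unfold gradient
  exact (LinearIsometryEquiv.continuous _).comp (hφ.continuous_fderiv one_ne_zero)

lemma hasCompactSupport_gradient {φ : Space n → ℝ} (hφ : HasCompactSupport φ) :
    HasCompactSupport (gradient φ) := by
  unfold gradient
  exact (hφ.fderiv ℝ).comp_left (map_zero _)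

lemma gradient_mul {φ ψ : Space n → ℝ} {x : Space n} (hφ : DifferentiableAt ℝ φ x)
    (hψ : DifferentiableAt ℝ ψ x) :
    gradient (fun y => φ y * ψ y) x = φ x • gradient ψ x + ψ x • gradient φ x := by
  ext i
  rw [gradient_apply, fderiv_fun_mul hφ hψ]
  simp [gradient_apply]

lemma IsTest.mul_left {O : Set (Space n)} {η φ : Space n → ℝ} (hη : IsTest O η)
    (hφ : ContDiff ℝ ∞ φ) : IsTest O fun x => η x * φ x :=
  ⟨hη.1.mul hφ, hη.2.1.mul_right, (tsupport_mul_subset_left).trans hη.2.2⟩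

/-- Differentiation commutes with mollification. -/
lemma gradient_mollify {F : Space n → ℝ} {DF : Space n → Space n} (hF : LocallyIntegrable F volume)
    (hDF : LocallyIntegrable DF volume) (hw : HasWeakGrad univ F DF)
    (φ : ContDiffBump (0 : Space n)) (x : Space n) :
    gradient (convolution (φ.normed volume) F (ContinuousLinearMap.lsmul ℝ ℝ) volume) x
      = convolution (φ.normed volume) DF (ContinuousLinearMap.lsmul ℝ ℝ) volume x := by
  set ρ := φ.normed volume with hρ
  have hρc : ContDiff ℝ ∞ ρ := φ.contDiff_normed
  have hρs : HasCompactSupport ρ := φ.hasCompactSupport_normed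
  have hρ1 : ContDiff ℝ 1 ρ := hρc.of_le (by exact_mod_cast le_top)
  have hd := hρs.hasFDerivAt_convolution_left (ContinuousLinearMap.lsmul ℝ ℝ) hρ1 hF x
  ext i
  rw [gradient_apply, hd.fderiv]
  have hex1 : Integrable (fun y => (ContinuousLinearMap.precompL (Space n)
      (ContinuousLinearMap.lsmul ℝ ℝ : ℝ →L[ℝ] ℝ →L[ℝ] ℝ)) (fderiv ℝ ρ y) (F (x - y))) volume :=
    (hρs.fderiv ℝ).convolutionExists_left _ (hρ1.continuous_fderiv one_ne_zero) hF x
  have hex2 : Integrable (fun y => ρ y • DF (x - y)) volume :=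
    hρs.convolutionExists_left (ContinuousLinearMap.lsmul ℝ ℝ) hρc.continuous hDF x
  have e1 : (convolution (fderiv ℝ ρ) F (ContinuousLinearMap.precompL (Space n)
      (ContinuousLinearMap.lsmul ℝ ℝ)) volume x) (EuclideanSpace.single i 1)
      = ∫ y, fderiv ℝ ρ y (EuclideanSpace.single i 1) * F (x - y) := by
    unfold convolution
    rw [ContinuousLinearMap.integral_apply hex1]
    rfl
  have e2 : (convolution ρ DF (ContinuousLinearMap.lsmul ℝ ℝ) volume x) i
      = ∫ y, ρ y * DF (x - y) i := by
    have h := (EuclideanSpace.proj i : Space n →L[ℝ] ℝ).integral_comp_comm hex2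
    exact h.symm
  rw [e1, e2]
  -- The reflected kernel `y ↦ ρ (x - y)` is the test function for the weak gradient. The sign from
  -- the chain rule cancels the one from integration by parts.
  have ht : IsTest univ fun y => ρ (x - y) := by
    refine ⟨hρc.comp (contDiff_const.sub contDiff_id), ?_, subset_univ _⟩
    exact hρs.comp_homeomorph (Homeomorph.subLeft x)
  have hw1 := hw _ ht i
  have hg : ∀ y, gradient (fun y => ρ (x - y)) y i
      = - fderiv ℝ ρ (x - y) (EuclideanSpace.single i 1) := by
    intro y
    rw [gradient_apply]
    have h1 : HasFDerivAt (fun y => x - y) (-(ContinuousLinearMap.id ℝ (Space n))) y :=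
      (hasFDerivAt_id y).const_sub x
    have h2 := ((hρ1.differentiable one_ne_zero) (x - y)).hasFDerivAt.comp y h1
    have h3 : fderiv ℝ (fun y => ρ (x - y)) y = _ := h2.fderiv
    rw [h3]
    simp
  simp only [hg, Measure.restrict_univ] at hw1
  have s1 : ∫ y, fderiv ℝ ρ y (EuclideanSpace.single i 1) * F (x - y)
      = ∫ y, fderiv ℝ ρ (x - y) (EuclideanSpace.single i 1) * F y := by
    rw [← integral_sub_left_eq_self _ volume x]
    simp
  have s2 : ∫ y, ρ y * DF (x - y) i = ∫ y, ρ (x - y) * DF y i := by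
    rw [← integral_sub_left_eq_self _ volume x]
    simp
  rw [s1, s2]
  have s3 : ∫ y, F y * -fderiv ℝ ρ (x - y) (EuclideanSpace.single i 1)
      = - ∫ y, fderiv ℝ ρ (x - y) (EuclideanSpace.single i 1) * F y := by
    rw [← integral_neg]
    congr 1
    funext y
    ring
  rw [s3, neg_inj] at hw1
  rw [hw1]
  simp only [mul_comm]

lemma HasWeakGrad.congr_ae {O : Set (Space n)} {f f' : Space n → ℝ} {Df Df' : Space n → Space n}
    (h : HasWeakGrad O f Df) (hf : f =ᵐ[volume.restrict O] f')
    (hDf : Df =ᵐ[volume.restrict O] Df') : HasWeakGrad O f' Df' := by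
  intro φ hφ i
  have e1 : ∫ x in O, f x * (gradient φ x) i = ∫ x in O, f' x * (gradient φ x) i :=
    integral_congr_ae (by filter_upwards [hf] with x hx; rw [hx])
  have e2 : ∫ x in O, (Df x) i * φ x = ∫ x in O, (Df' x) i * φ x :=
    integral_congr_ae (by filter_upwards [hDf] with x hx; rw [hx])
  rw [← e1, ← e2]
  exact h φ hφ i

lemma IsW01p.congr_ae {p : ℝ} {O : Set (Space n)} {f f' : Space n → ℝ} {Df Df' : Space n → Space n}
    (h : IsW01p p O f Df) (hf : f =ᵐ[volume.restrict O] f')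
    (hDf : Df =ᵐ[volume.restrict O] Df') : IsW01p p O f' Df' := by
  obtain ⟨φ, h1, h2, h3⟩ := h
  refine ⟨φ, h1, h2.congr fun k => eLpNorm_congr_ae ?_, h3.congr fun k => eLpNorm_congr_ae ?_⟩
  · filter_upwards [hf] with x hx
    rw [hx]
  · filter_upwards [hDf] with x hx
    rw [hx]

/-- A compactly supported `W^{1,p}` function on the whole space belongs to `W₀^{1,p}`. -/
lemma isW01p_of_hasWeakGrad_univ {p : ℝ} (hp : 1 ≤ p) {O K : Set (Space n)} (hO : IsOpen O)
    (hK : IsCompact K) (hKO : K ⊆ O) {F : Space n → ℝ} {DF : Space n → Space n}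
    (hFm : StronglyMeasurable F) (hDFm : StronglyMeasurable DF)
    (hF : MemLp F (ENNReal.ofReal p) volume) (hDF : MemLp DF (ENNReal.ofReal p) volume)
    (hw : HasWeakGrad univ F DF) (hs : ∀ x ∉ K, F x = 0) : IsW01p p O F DF := by
  have hP1 : 1 ≤ ENNReal.ofReal p := by simpa using ENNReal.ofReal_le_ofReal hp
  obtain ⟨r, hr, hrO⟩ := hK.exists_cthickening_subset_open hO hKO
  -- The radii stay below `r`, so every mollification is supported in the closed `r`-thickening of
  -- `K`, which lies in `O`.
  let φ : ℕ → ContDiffBump (0 : Space n) := fun k =>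
    ⟨r / (k + 2) / 2, r / (k + 2), by positivity, half_lt_self (by positivity)⟩
  have hrk : ∀ k, (φ k).rOut = r / (k + 2) := fun k => rfl
  have hlim : Tendsto (fun k => (φ k).rOut) atTop (𝓝 0) := by
    simp only [hrk]
    exact tendsto_const_nhds.div_atTop
      (tendsto_atTop_add_const_right _ _ tendsto_natCast_atTop_atTop)
  have hloc := hF.locallyIntegrable hP1
  have hlocD := hDF.locallyIntegrable hP1
  have hconv : ∀ {E : Type} [NormedAddCommGroup E] [NormedSpace ℝ E] [CompleteSpace E]
      (f : Space n → E) (_ : StronglyMeasurable f) (_ : MemLp f (ENNReal.ofReal p) volume),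
      Tendsto (fun k => eLpNorm (fun x => convolution ((φ k).normed volume) f
        (ContinuousLinearMap.lsmul ℝ ℝ) volume x - f x) (ENNReal.ofReal p) (volume.restrict O))
        atTop (𝓝 0) := by
    intro E _ _ _ f hfm hf
    have ht := tendsto_eLpNorm_translate hP1 ENNReal.ofReal_ne_top hf
    rw [ENNReal.tendsto_nhds_zero] at ht ⊢
    intro C hC
    obtain ⟨d, hd, hd'⟩ := Metric.eventually_nhds_iff.1 (ht C hC)
    filter_upwards [hlim.eventually (gt_mem_nhds hd)] with k hk
    refine (eLpNorm_mono_measure _ Measure.restrict_le_self).trans ?_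
    exact eLpNorm_mollify_sub_le hp hfm hf (φ k) fun y hy => hd' (by simpa using hy.trans hk)
  have hcont : ∀ k, tsupport (convolution ((φ k).normed volume) F
      (ContinuousLinearMap.lsmul ℝ ℝ) volume) ⊆ Metric.cthickening r K := by
    intro k
    refine closure_minimal ?_ Metric.isClosed_cthickening
    refine (support_convolution_subset _).trans ?_
    rw [(φ k).support_normed_eq]
    rintro _ ⟨a, ha, b, hb, rfl⟩
    have hbK : b ∈ K := by
      by_contra h
      exact hb (hs b h)
    refine Metric.mem_cthickening_of_dist_le _ b r K hbK ?_
    have h1 : ‖a‖ < r / (k + 2) := by simpa [hrk] using ha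
    have h2 : r / ((k : ℝ) + 2) ≤ r := div_le_self hr.le (by linarith [k.cast_nonneg (α := ℝ)])
    simp only [dist_eq_norm, add_sub_cancel_right]
    linarith
  refine ⟨fun k => convolution ((φ k).normed volume) F (ContinuousLinearMap.lsmul ℝ ℝ) volume,
    fun k => ⟨?_, ?_, (hcont k).trans hrO⟩, hconv F hFm hF, ?_⟩
  · exact (φ k).hasCompactSupport_normed.contDiff_convolution_left _ (φ k).contDiff_normed hloc
  · exact HasCompactSupport.of_support_subset_isCompact hK.cthickening
      ((subset_tsupport _).trans (hcont k))
  · simp only [gradient_mollify hloc hlocD hw]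
    exact hconv DF hDFm hDF

/-- Multiplication by a cut-off function maps `W^{1,p}` to `W₀^{1,p}`. -/
lemma isW01p_mul_test {p : ℝ} (hp : 1 ≤ p) {O : Set (Space n)} (hO : IsOpen O)
    {f : Space n → ℝ} {Df : Space n → Space n}
    (hf : MemLp f (ENNReal.ofReal p) (volume.restrict O))
    (hDf : MemLp Df (ENNReal.ofReal p) (volume.restrict O))
    (hw : HasWeakGrad O f Df) {η : Space n → ℝ} (hη : IsTest O η) :
    IsW01p p O (fun x => η x * f x) (fun x => η x • Df x + f x • gradient η x) := by
  have hP1 : 1 ≤ ENNReal.ofReal p := by simpa using ENNReal.ofReal_le_ofReal hp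
  have hη1 : ContDiff ℝ 1 η := hη.1.of_le (by exact_mod_cast le_top)
  have hmO := hO.measurableSet
  -- Extension by zero of measurable representatives. After multiplication by `η`, which is
  -- supported inside `O`, it has a weak gradient on the whole space.
  let f' := O.indicator (hf.1.mk f)
  let D' := O.indicator (hDf.1.mk Df)
  have hf'm : StronglyMeasurable f' := hf.1.stronglyMeasurable_mk.indicator hmO
  have hD'm : StronglyMeasurable D' := hDf.1.stronglyMeasurable_mk.indicator hmO
  have ef : f =ᵐ[volume.restrict O] f' :=
    hf.1.ae_eq_mk.trans (indicator_ae_eq_restrict hmO).symm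
  have eD : Df =ᵐ[volume.restrict O] D' :=
    hDf.1.ae_eq_mk.trans (indicator_ae_eq_restrict hmO).symm
  have hf' : MemLp f' (ENNReal.ofReal p) volume :=
    (memLp_indicator_iff_restrict hmO).2 (hf.ae_eq hf.1.ae_eq_mk)
  have hD' : MemLp D' (ENNReal.ofReal p) volume :=
    (memLp_indicator_iff_restrict hmO).2 (hDf.ae_eq hDf.1.ae_eq_mk)
  have hw' : HasWeakGrad O f' D' := hw.congr_ae ef eD
  have hηc : Continuous η := hη.1.continuous
  have hgc : Continuous (gradient η) := continuous_gradient hη1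
  obtain ⟨C1, hC1⟩ := hη.2.1.exists_bound_of_continuous hηc
  obtain ⟨C2, hC2⟩ := (hasCompactSupport_gradient hη.2.1).exists_bound_of_continuous hgc
  have hFm : StronglyMeasurable fun x => η x * f' x := hηc.stronglyMeasurable.mul hf'm
  have m1 : StronglyMeasurable fun x => η x • D' x := hηc.stronglyMeasurable.smul hD'm
  have m2 : StronglyMeasurable fun x => f' x • gradient η x := hf'm.smul hgc.stronglyMeasurable
  have hF : MemLp (fun x => η x * f' x) (ENNReal.ofReal p) volume :=
    hf'.of_le_mul (c := C1) hFm.aestronglyMeasurable (Eventually.of_forall fun x => by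
      rw [norm_mul]; gcongr; exact hC1 x)
  have hG1 : MemLp (fun x => η x • D' x) (ENNReal.ofReal p) volume :=
    hD'.of_le_mul (c := C1) m1.aestronglyMeasurable (Eventually.of_forall fun x => by
      rw [norm_smul]; gcongr; exact hC1 x)
  have hG2 : MemLp (fun x => f' x • gradient η x) (ENNReal.ofReal p) volume :=
    hf'.of_le_mul (c := C2) m2.aestronglyMeasurable (Eventually.of_forall fun x => by
      rw [norm_smul, mul_comm]; gcongr; exact hC2 x)
  have hint : ∀ {g : Space n → ℝ} (_ : MemLp g (ENNReal.ofReal p) volume) {k : Space n → ℝ}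
      (_ : Continuous k) (_ : HasCompactSupport k), Integrable (fun x => g x * k x) volume := by
    intro g hg k hk hks
    have := (hg.locallyIntegrable hP1).integrable_smul_left_of_hasCompactSupport hk hks
    simpa [mul_comm] using this
  refine (isW01p_of_hasWeakGrad_univ hp hO hη.2.1 hη.2.2 hFm (m1.add m2) hF (hG1.add hG2) ?_
    fun x hx => ?_).congr_ae ?_ ?_
  · intro φ hφ i
    have hφ1 : ContDiff ℝ 1 φ := hφ.1.of_le (by exact_mod_cast le_top)
    -- Leibniz rule: `η φ` is admissible on `O`, and the terms with `φ ∇η` on the two sides agree.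
    have h := hw' _ (hη.mul_left hφ.1) i
    have hz1 : ∀ x ∉ O, f' x * gradient (fun y => η y * φ y) x i = 0 := fun x hx => by
      simp [f', hx]
    have hz2 : ∀ x ∉ O, D' x i * (η x * φ x) = 0 := fun x hx => by simp [D', hx]
    rw [setIntegral_eq_integral_of_forall_compl_eq_zero hz1,
      setIntegral_eq_integral_of_forall_compl_eq_zero hz2] at h
    rw [Measure.restrict_univ]
    have hgi : Continuous fun x => gradient η x i := (EuclideanSpace.proj i).continuous.comp hgc
    have i1 : Integrable (fun x => (η x * f' x) * gradient φ x i) volume := by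
      refine hint hF ((EuclideanSpace.proj i).continuous.comp (continuous_gradient hφ1)) ?_
      exact (hasCompactSupport_gradient hφ.2.1).comp_left (g := fun v : Space n => v i) rfl
    have i2 : Integrable (fun x => f' x * (φ x * gradient η x i)) volume :=
      hint hf' (hφ.1.continuous.mul hgi) hφ.2.1.mul_right
    have i3 : Integrable (fun x => D' x i * (η x * φ x)) volume := by
      refine hint ?_ (hηc.mul hφ.1.continuous) hη.2.1.mul_right
      exact hD'.of_le_mul (c := 1) ((EuclideanSpace.proj i).continuous.comp_stronglyMeasurable
        hD'm).aestronglyMeasurable (Eventually.of_forall fun x => by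
          rw [one_mul]; exact PiLp.norm_apply_le (D' x) i)
    have e1 : ∫ x, f' x * gradient (fun y => η y * φ y) x i
        = (∫ x, (η x * f' x) * gradient φ x i) + ∫ x, f' x * (φ x * gradient η x i) := by
      rw [← integral_add i1 i2]
      congr 1
      funext x
      rw [gradient_mul ((hη1.differentiable one_ne_zero) x) ((hφ1.differentiable one_ne_zero) x)]
      simp
      ring
    have e2 : ∫ x, (η x • D' x + f' x • gradient η x) i * φ x
        = (∫ x, D' x i * (η x * φ x)) + ∫ x, f' x * (φ x * gradient η x i) := by
      rw [← integral_add i3 i2]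
      congr 1
      funext x
      simp
      ring
    have e3 : ∫ x, ((fun x => η x • D' x) + fun x => f' x • gradient η x) x i * φ x = _ := e2
    rw [e3]
    linarith
  · rw [image_eq_zero_of_notMem_tsupport hx, zero_mul]
  · filter_upwards [ef] with x hx
    rw [hx]
  · filter_upwards [ef, eD] with x hx hx'
    simp [hx, hx']

end

section

/-! ### The lemma of du Bois-Reymond on an interval -/

lemma IsTest.sub {X : Type*} [NormedAddCommGroup X] [NormedSpace ℝ X] {A : Set X} {φ ψ : X → ℝ}
    (hφ : IsTest A φ) (hψ : IsTest A ψ) : IsTest A fun x => φ x - ψ x :=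
  ⟨hφ.1.sub hψ.1, hφ.2.1.sub hψ.2.1, (tsupport_sub φ ψ).trans (union_subset hφ.2.2 hψ.2.2)⟩

lemma IsTest.const_mul {X : Type*} [NormedAddCommGroup X] [NormedSpace ℝ X] {A : Set X} {φ : X → ℝ}
    (hφ : IsTest A φ) (c : ℝ) : IsTest A fun x => c * φ x :=
  ⟨contDiff_const.mul hφ.1, hφ.2.1.mul_left, (tsupport_mul_subset_right).trans hφ.2.2⟩

lemma IsTest.integrable {X : Type*} [NormedAddCommGroup X] [NormedSpace ℝ X] [MeasurableSpace X]
    [OpensMeasurableSpace X] {A : Set X} {φ : X → ℝ} (hφ : IsTest A φ) (μ : Measure X)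
    [IsFiniteMeasureOnCompacts μ] : Integrable φ μ :=
  hφ.1.continuous.integrable_of_hasCompactSupport hφ.2.1

lemma _root_.MeasureTheory.Integrable.mul_isTest {X : Type*} [NormedAddCommGroup X]
    [NormedSpace ℝ X] [MeasurableSpace X] [OpensMeasurableSpace X] [SecondCountableTopology X]
    {A : Set X} {φ : X → ℝ} {μ : Measure X} {h : X → ℝ} (hh : Integrable h μ) (hφ : IsTest A φ) :
    Integrable (fun x => h x * φ x) μ := by
  obtain ⟨C, hC⟩ := hφ.2.1.exists_bound_of_continuous hφ.1.continuous
  exact hh.mul_bdd hφ.1.continuous.aestronglyMeasurable (Eventually.of_forall hC)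

/-- Subtracting a multiple of one normalized bump `θ` gives every test function mean zero. Hence `h
- ∫ h θ` annihilates all test functions. -/
lemma ae_eq_const_of_integral_mul_eq_zero {a b : ℝ} (hab : a < b) {h : ℝ → ℝ}
    (hh : IntegrableOn h (Ioo a b))
    (H : ∀ χ : ℝ → ℝ, IsTest (Ioo a b) χ → ∫ t in Ioo a b, χ t = 0 →
      ∫ t in Ioo a b, h t * χ t = 0) :
    ∃ c : ℝ, ∀ᵐ t ∂(volume.restrict (Ioo a b)), h t = c := by
  let φ : ContDiffBump ((a + b) / 2) :=
    ⟨(b - a) / 8, (b - a) / 4, by linarith, by linarith⟩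
  set θ : ℝ → ℝ := φ.normed volume with hθ
  have hθt : IsTest (Ioo a b) θ := by
    refine ⟨φ.contDiff_normed, φ.hasCompactSupport_normed, ?_⟩
    rw [hθ, φ.tsupport_normed_eq, Real.closedBall_eq_Icc]
    have : φ.rOut = (b - a) / 4 := rfl
    rw [this]
    exact Icc_subset_Ioo (by linarith) (by linarith)
  have hzero : ∀ {χ : ℝ → ℝ}, IsTest (Ioo a b) χ → ∀ x ∉ Ioo a b, χ x = 0 := fun hχ x hx =>
    image_eq_zero_of_notMem_tsupport fun h => hx (hχ.2.2 h)
  have hθ1 : ∫ t in Ioo a b, θ t = 1 := by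
    rw [setIntegral_eq_integral_of_forall_compl_eq_zero (hzero hθt), φ.integral_normed]
  refine ⟨∫ t in Ioo a b, h t * θ t, ?_⟩
  set c := ∫ t in Ioo a b, h t * θ t with hc
  have hloc : LocallyIntegrableOn (fun t => h t - c) (Ioo a b) volume :=
    (hh.sub (integrableOn_const (by simp))).locallyIntegrableOn
  have key := isOpen_Ioo.ae_eq_zero_of_integral_contDiff_smul_eq_zero hloc fun χ h1 h2 h3 => by
    have hχ : IsTest (Ioo a b) χ := ⟨h1, h2, h3⟩
    set m := ∫ t in Ioo a b, χ t with hm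
    have hχ' := hχ.sub (hθt.const_mul m)
    have e0 : ∫ t in Ioo a b, (χ t - m * θ t) = 0 := by
      rw [integral_sub (hχ.integrable _) ((hθt.integrable _).const_mul m), integral_const_mul, hθ1]
      simp [hm]
    have e1 := H _ hχ' e0
    have e2 : ∫ t in Ioo a b, h t * (χ t - m * θ t) = (∫ t in Ioo a b, h t * χ t) - m * c := by
      rw [hc, ← integral_const_mul, ← integral_sub (hh.mul_isTest hχ)
        ((hh.mul_isTest hθt).const_mul m)]
      congr 1
      funext t
      ring
    have e3 : ∫ t in Ioo a b, χ t • (h t - c) = (∫ t in Ioo a b, h t * χ t) - m * c := by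
      rw [hm, ← integral_mul_const, ← integral_sub (hh.mul_isTest hχ)
        ((hχ.integrable _).mul_const c)]
      congr 1
      funext t
      simp only [smul_eq_mul]
      ring
    rw [← setIntegral_eq_integral_of_forall_compl_eq_zero (s := Ioo a b)
      fun x hx => by rw [hzero hχ x hx, zero_smul], e3, ← e2, e1]
  rw [ae_restrict_iff' measurableSet_Ioo]
  filter_upwards [key] with t ht hmem
  linarith [ht hmem]

/-- The vanishing mean makes the primitive vanish to the right of the support too. This supplies the
test function whose derivative is a prescribed `χ` of mean zero. -/
lemma IsTest.primitive {a b : ℝ} (hab : a < b) {χ : ℝ → ℝ} (hχ : IsTest (Ioo a b) χ)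
    (h0 : ∫ t in Ioo a b, χ t = 0) :
    IsTest (Ioo a b) (fun t => ∫ s in a..t, χ s) ∧
      ∀ t, HasDerivAt (fun t => ∫ s in a..t, χ s) (χ t) t := by
  have hc : Continuous χ := hχ.1.continuous
  have hd : ∀ t, HasDerivAt (fun t => ∫ s in a..t, χ s) (χ t) t := fun t =>
    intervalIntegral.integral_hasDerivAt_right (hc.intervalIntegrable _ _)
      (hc.stronglyMeasurableAtFilter _ _) hc.continuousAt
  refine ⟨?_, hd⟩
  -- Adding the midpoint keeps the compact set nonempty even for `χ = 0`, so that it has a least and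
  -- a greatest element.
  have hm : (a + b) / 2 ∈ insert ((a + b) / 2) (tsupport χ) := mem_insert _ _
  have hK : IsCompact (insert ((a + b) / 2) (tsupport χ)) := hχ.2.1.insert _
  have hKJ : insert ((a + b) / 2) (tsupport χ) ⊆ Ioo a b :=
    insert_subset ⟨by linarith, by linarith⟩ hχ.2.2
  obtain ⟨a', ha', hal⟩ := hK.exists_isLeast ⟨_, hm⟩
  obtain ⟨b', hb', hbl⟩ := hK.exists_isGreatest ⟨_, hm⟩
  have hz : ∀ t ∉ Icc a' b', χ t = 0 := fun t ht =>
    image_eq_zero_of_notMem_tsupport fun h =>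
      ht ⟨hal (mem_insert_of_mem _ h), hbl (mem_insert_of_mem _ h)⟩
  have hfull : ∫ s in a..b, χ s = 0 := by
    rw [intervalIntegral.integral_of_le hab.le, integral_Ioc_eq_integral_Ioo, h0]
  have hsupp : ∀ t ∉ Icc a' b', ∫ s in a..t, χ s = 0 := by
    intro t ht
    rw [mem_Icc, not_and_or, not_le, not_le] at ht
    have hza : ∀ u < a', ∫ s in a..u, χ s = 0 := fun u hu => by
      rw [intervalIntegral.integral_congr (g := fun _ => 0), intervalIntegral.integral_zero]
      intro s hs
      refine hz s fun h => ?_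
      have : a ⊔ u < a' := sup_lt_iff.2 ⟨(hKJ ha').1, hu⟩
      exact absurd h.1 (not_le.2 (hs.2.trans_lt this))
    rcases ht with ht | ht
    · exact hza t ht
    · rw [← intervalIntegral.integral_add_adjacent_intervals (b := b) (hc.intervalIntegrable _ _)
        (hc.intervalIntegrable _ _), hfull, zero_add,
        intervalIntegral.integral_congr (g := fun _ => 0), intervalIntegral.integral_zero]
      intro s hs
      refine hz s fun h => ?_
      have h1 := hs.1
      have h2 := (hKJ hb').2
      have : b' < b ⊓ t := lt_inf_iff.2 ⟨h2, ht⟩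
      exact absurd h.2 (not_le.2 (this.trans_le h1))
  refine ⟨?_, HasCompactSupport.of_support_subset_isCompact
    (isCompact_Icc (a := a') (b := b')) fun t ht => ?_, ?_⟩
  · rw [contDiff_infty_iff_deriv]
    refine ⟨fun t => (hd t).differentiableAt, ?_⟩
    rw [funext fun t => (hd t).deriv]
    exact hχ.1
  · by_contra h
    exact ht (hsupp t h)
  · refine (closure_minimal (fun t ht => ?_) isClosed_Icc).trans
      (Icc_subset_Ioo (hKJ ha').1 (hKJ hb').2)
    by_contra h
    exact ht (hsupp t h)

/-- An integrable function with integrable weak derivative `-β` is a primitive of `-β`. -/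
lemma ae_eq_sub_integral_of_weakDeriv {a b : ℝ} (hab : a < b) {f β : ℝ → ℝ}
    (hf : IntegrableOn f (Ioo a b)) (hβ : IntegrableOn β (Ioo a b))
    (H : ∀ ζ : ℝ → ℝ, IsTest (Ioo a b) ζ →
      ∫ t in Ioo a b, f t * deriv ζ t = ∫ t in Ioo a b, β t * ζ t) :
    ∃ c : ℝ, ∀ᵐ t ∂(volume.restrict (Ioo a b)), f t = c + ∫ r in Ioo t b, β r := by
  -- This is the primitive `∫ₜᵇ β`, written with an indicator over a fixed domain so that Fubini
  -- applies on the triangle `t < r`.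
  set k : ℝ → ℝ := fun t => ∫ r in Ioo a b, (Ioi t).indicator β r with hk
  have hkI : ∀ t ∈ Ioo a b, k t = ∫ r in Ioo t b, β r := by
    intro t ht
    rw [hk]
    simp only
    rw [integral_indicator measurableSet_Ioi, Measure.restrict_restrict measurableSet_Ioi]
    congr 2
    ext r
    simp only [mem_inter_iff, mem_Ioi, mem_Ioo]
    constructor
    · rintro ⟨h1, h2, h3⟩
      exact ⟨h1, h3⟩
    · rintro ⟨h1, h3⟩
      exact ⟨h1, ht.1.trans h1, h3⟩
  have hmeas : MeasurableSet {z : ℝ × ℝ | z.1 < z.2} := measurableSet_lt measurable_fst measurable_snd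
  have hint2 : ∀ {χ : ℝ → ℝ}, IntegrableOn χ (Ioo a b) →
      Integrable ({z : ℝ × ℝ | z.1 < z.2}.indicator fun z => χ z.1 * β z.2)
        ((volume.restrict (Ioo a b)).prod (volume.restrict (Ioo a b))) := fun hχ =>
    (hχ.mul_prod hβ).indicator hmeas
  have hind : ∀ (χ : ℝ → ℝ) (t r : ℝ), ({z : ℝ × ℝ | z.1 < z.2}.indicator
      (fun z => χ z.1 * β z.2)) (t, r) = χ t * (Ioi t).indicator β r := by
    intro χ t r
    by_cases h : t < r <;> simp [indicator, h]
  have hkint : IntegrableOn k (Ioo a b) := by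
    refine ((hint2 (χ := fun _ => 1)
      (integrableOn_const (by simp))).integral_prod_left).congr (Eventually.of_forall fun t => ?_)
    exact integral_congr_ae (Eventually.of_forall fun r => (hind (fun _ => 1) t r).trans (one_mul _))
  obtain ⟨c, hc⟩ := ae_eq_const_of_integral_mul_eq_zero hab (h := fun t => f t - k t)
    (hf.sub hkint) fun χ hχ h0 => by
      obtain ⟨hζ, hd⟩ := hχ.primitive hab h0
      have e1 := H _ hζ
      simp only [fun t => (hd t).deriv] at e1
      -- Exchanging the integrals gives `k` the same weak derivative as `f`, so `f - k` is
      -- orthogonal to all test functions of mean zero.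
      have e2 : ∫ t in Ioo a b, k t * χ t = ∫ t in Ioo a b, β t * ∫ s in a..t, χ s := by
        have s1 := integral_integral_swap (f := fun t r => χ t * (Ioi t).indicator β r)
          ((hint2 (hχ.integrable _)).congr (Eventually.of_forall fun z => hind χ z.1 z.2))
        simp only [integral_const_mul] at s1
        rw [show (fun t => k t * χ t) = fun t => χ t * k t from funext fun t => mul_comm _ _, hk, s1]
        refine setIntegral_congr_fun measurableSet_Ioo fun r hr => ?_
        rw [intervalIntegral.integral_of_le hr.1.le, integral_Ioc_eq_integral_Ioo,
          ← integral_const_mul]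
        have : ∀ t, χ t * (Ioi t).indicator β r = (Iio r).indicator (fun t => β r * χ t) t := by
          intro t
          by_cases h : t < r <;> simp [indicator, h, mul_comm]
        simp only [this]
        rw [integral_indicator measurableSet_Iio, Measure.restrict_restrict measurableSet_Iio]
        congr 2
        ext t
        simp only [mem_inter_iff, mem_Iio, mem_Ioo]
        constructor
        · rintro ⟨h1, h2, h3⟩
          exact ⟨h2, h1⟩
        · rintro ⟨h1, h3⟩
          exact ⟨h3, h1, h3.trans hr.2⟩
      have e3 : ∫ t in Ioo a b, (f t - k t) * χ t
          = (∫ t in Ioo a b, f t * χ t) - ∫ t in Ioo a b, k t * χ t := by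
        rw [← integral_sub (hf.mul_isTest hχ) (hkint.mul_isTest hχ)]
        simp only [sub_mul]
      rw [e3, e2, e1, sub_self]
  refine ⟨c, ?_⟩
  filter_upwards [hc, ae_restrict_mem measurableSet_Ioo] with t ht hmem
  rw [← hkI t hmem]
  linarith

end

section

/-! ### The slice identity -/

variable {n : ℕ} {p q : ℝ}

lemma one_le_ofReal {p : ℝ} (hp : 1 ≤ p) : 1 ≤ ENNReal.ofReal p := by
  simpa using ENNReal.ofReal_le_ofReal hp

/-- Hölder's inequality for real exponents. -/
lemma lintegral_enorm_mul_le {X E F : Type*} [MeasurableSpace X] [NormedAddCommGroup E]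
    [NormedAddCommGroup F] (hpq : p.HolderConjugate q) {μ : Measure X} {f : X → E} {g : X → F}
    (hf : AEStronglyMeasurable f μ) (hg : AEStronglyMeasurable g μ) :
    ∫⁻ x, ‖f x‖ₑ * ‖g x‖ₑ ∂μ
      ≤ eLpNorm f (ENNReal.ofReal q) μ * eLpNorm g (ENNReal.ofReal p) μ := by
  have h := ENNReal.lintegral_mul_le_Lp_mul_Lq μ hpq.symm hf.enorm hg.enorm
  rw [eLpNorm_eq_lintegral_rpow_enorm_toReal (by simpa using hpq.symm.pos) ENNReal.ofReal_ne_top,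
    eLpNorm_eq_lintegral_rpow_enorm_toReal (by simpa using hpq.pos) ENNReal.ofReal_ne_top,
    ENNReal.toReal_ofReal hpq.pos.le, ENNReal.toReal_ofReal hpq.symm.pos.le]
  exact h

lemma enorm_inner_le {E : Type*} [NormedAddCommGroup E] [InnerProductSpace ℝ E] (x y : E) :
    ‖inner ℝ x y‖ₑ ≤ ‖x‖ₑ * ‖y‖ₑ := by
  rw [← ofReal_norm, ← ofReal_norm, ← ofReal_norm, ← ENNReal.ofReal_mul (norm_nonneg _)]
  exact ENNReal.ofReal_le_ofReal (norm_inner_le_norm x y)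

lemma integrable_inner_of_memLp {X E : Type*} [MeasurableSpace X] [NormedAddCommGroup E]
    [InnerProductSpace ℝ E] (hpq : p.HolderConjugate q) {μ : Measure X} {f g : X → E}
    (hf : MemLp f (ENNReal.ofReal q) μ) (hg : MemLp g (ENNReal.ofReal p) μ) :
    Integrable (fun x => inner ℝ (f x) (g x)) μ := by
  refine ⟨hf.1.inner hg.1, ?_⟩
  refine (lintegral_mono fun x => enorm_inner_le (f x) (g x)).trans_lt ?_
  exact (lintegral_enorm_mul_le hpq hf.1 hg.1).trans_lt (ENNReal.mul_lt_top hf.2 hg.2)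

lemma enorm_integral_inner_le {X E : Type*} [MeasurableSpace X] [NormedAddCommGroup E]
    [InnerProductSpace ℝ E] (hpq : p.HolderConjugate q) {μ : Measure X} {f g : X → E}
    (hf : AEStronglyMeasurable f μ) (hg : AEStronglyMeasurable g μ) :
    ‖∫ x, inner ℝ (f x) (g x) ∂μ‖ₑ
      ≤ eLpNorm f (ENNReal.ofReal q) μ * eLpNorm g (ENNReal.ofReal p) μ :=
  (enorm_integral_le_lintegral_enorm _).trans
    ((lintegral_mono fun x => enorm_inner_le (f x) (g x)).trans (lintegral_enorm_mul_le hpq hf hg))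

lemma eLpNorm_comp_fst {X Y E : Type*} [MeasurableSpace X] [MeasurableSpace Y]
    [NormedAddCommGroup E] {μ : Measure X} {ν : Measure Y} [SFinite ν] (hp : 0 < p) {f : X → E}
    (hf : AEStronglyMeasurable f μ) :
    eLpNorm (fun z : X × Y => f z.1) (ENNReal.ofReal p) (μ.prod ν)
      = ν univ ^ (1 / p) * eLpNorm f (ENNReal.ofReal p) μ := by
  have h : eLpNorm (f ∘ Prod.fst) (ENNReal.ofReal p) (μ.prod ν)
      = eLpNorm f (ENNReal.ofReal p) ((μ.prod ν).map Prod.fst) := by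
    refine (eLpNorm_map_measure ?_ measurable_fst.aemeasurable).symm
    rw [Measure.map_fst_prod]
    exact hf.smul_measure _
  rw [show (fun z : X × Y => f z.1) = f ∘ Prod.fst from rfl, h, Measure.map_fst_prod,
    eLpNorm_smul_measure_of_ne_top ENNReal.ofReal_ne_top, smul_eq_mul, one_div, one_div,
    ENNReal.toReal_inv, ENNReal.toReal_ofReal hp.le]

lemma volume_restrict_prod (O : Set (Space n)) (J : Set ℝ) :
    (volume : Measure (Space n × ℝ)).restrict (O ×ˢ J)
      = (volume.restrict O).prod (volume.restrict J) := by
  rw [Measure.prod_restrict]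
  rfl

/-- There is a countable family of test functions that is dense in `W₀^{1,p}`. -/
lemma exists_countable_dense_tests (hp : 1 ≤ p) (O : Set (Space n)) :
    ∃ D : Set (Space n → ℝ), D.Countable ∧ (∀ φ ∈ D, IsTest O φ) ∧
      ∀ (ψ : Space n → ℝ) (Ψ : Space n → Space n), IsW01p p O ψ Ψ →
        MemLp ψ (ENNReal.ofReal p) (volume.restrict O) →
        MemLp Ψ (ENNReal.ofReal p) (volume.restrict O) → ∀ C : ENNReal, 0 < C → ∃ φ ∈ D,
        eLpNorm (fun x => ψ x - φ x) (ENNReal.ofReal p) (volume.restrict O) ≤ C ∧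
        eLpNorm (fun x => Ψ x - gradient φ x) (ENNReal.ofReal p) (volume.restrict O) ≤ C := by
  set P := ENNReal.ofReal p with hP
  have : Fact (1 ≤ P) := ⟨one_le_ofReal hp⟩
  have : Fact (P ≠ ⊤) := ⟨ENNReal.ofReal_ne_top⟩
  set μ := (volume : Measure (Space n)).restrict O with hμ
  have mem1 : ∀ φ : {φ : Space n → ℝ // IsTest O φ}, MemLp φ.1 P μ := fun φ =>
    φ.2.1.continuous.memLp_of_hasCompactSupport φ.2.2.1
  have mem2 : ∀ φ : {φ : Space n → ℝ // IsTest O φ}, MemLp (gradient φ.1) P μ := fun φ =>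
    (continuous_gradient (φ.2.1.of_le (by exact_mod_cast le_top))).memLp_of_hasCompactSupport
      (hasCompactSupport_gradient φ.2.2.1)
  -- The pair (function, gradient) maps the test functions into a second countable space. The
  -- induced topology is then second countable, which provides a dense sequence made of test
  -- functions themselves.
  let Φ : {φ : Space n → ℝ // IsTest O φ} → Lp ℝ P μ × Lp (Space n) P μ := fun φ =>
    ((mem1 φ).toLp _, (mem2 φ).toLp _)
  let _ : TopologicalSpace {φ : Space n → ℝ // IsTest O φ} := TopologicalSpace.induced Φ inferInstance
  have s0 : IsSeparable μ := inferInstance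
  have s1 : SecondCountableTopology (Lp ℝ P μ) := inferInstance
  have s2 : SecondCountableTopology (Lp (Space n) P μ) := inferInstance
  have : SecondCountableTopology {φ : Space n → ℝ // IsTest O φ} :=
    TopologicalSpace.secondCountableTopology_induced _ _ Φ
  obtain ⟨D, hDc, hDd⟩ := TopologicalSpace.exists_countable_dense {φ : Space n → ℝ // IsTest O φ}
  refine ⟨Subtype.val '' D, hDc.image _, ?_, ?_⟩
  · rintro _ ⟨φ, _, rfl⟩
    exact φ.2
  intro ψ Ψ hψ hm1 hm2 C hC
  obtain ⟨φ, hφ, h1, h2⟩ := hψ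
  have hC2 : 0 < C / 2 := ENNReal.half_pos hC.ne'
  obtain ⟨k, hk1, hk2⟩ := (((ENNReal.tendsto_nhds_zero.1 h1) _ hC2).and
    ((ENNReal.tendsto_nhds_zero.1 h2) _ hC2)).exists
  have hcl : Φ ⟨φ k, hφ k⟩ ∈ closure (Φ '' D) := closure_induced.1 (hDd ⟨φ k, hφ k⟩)
  obtain ⟨_, ⟨d, hd, rfl⟩, hdist⟩ := EMetric.mem_closure_iff.1 hcl _ hC2
  have hd1 : eLpNorm (φ k - d.1) P μ < C / 2 := by
    rw [← Lp.edist_toLp_toLp _ _ (mem1 ⟨φ k, hφ k⟩) (mem1 d)]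
    exact (le_max_left _ _).trans_lt hdist
  have hd2 : eLpNorm (gradient (φ k) - gradient d.1) P μ < C / 2 := by
    rw [← Lp.edist_toLp_toLp _ _ (mem2 ⟨φ k, hφ k⟩) (mem2 d)]
    exact (le_max_right _ _).trans_lt hdist
  refine ⟨d.1, ⟨d, hd, rfl⟩, ?_, ?_⟩
  · calc eLpNorm (fun x => ψ x - d.1 x) P μ = eLpNorm ((ψ - φ k) + (φ k - d.1)) P μ := by
          congr 1; funext x; simp
      _ ≤ eLpNorm (ψ - φ k) P μ + eLpNorm (φ k - d.1) P μ :=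
          eLpNorm_add_le (hm1.1.sub (mem1 ⟨φ k, hφ k⟩).1) ((mem1 ⟨φ k, hφ k⟩).sub (mem1 d)).1
            (one_le_ofReal hp)
      _ ≤ C / 2 + C / 2 := by
          refine add_le_add ?_ hd1.le
          rw [eLpNorm_sub_comm]
          exact hk1
      _ = C := ENNReal.add_halves C
  · calc eLpNorm (fun x => Ψ x - gradient d.1 x) P μ
        = eLpNorm ((Ψ - gradient (φ k)) + (gradient (φ k) - gradient d.1)) P μ := by
          congr 1; funext x; simp
      _ ≤ eLpNorm (Ψ - gradient (φ k)) P μ + eLpNorm (gradient (φ k) - gradient d.1) P μ :=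
          eLpNorm_add_le (hm2.1.sub (mem2 ⟨φ k, hφ k⟩).1) ((mem2 ⟨φ k, hφ k⟩).sub (mem2 d)).1
            (one_le_ofReal hp)
      _ ≤ C / 2 + C / 2 := by
          refine add_le_add ?_ hd2.le
          rw [eLpNorm_sub_comm]
          exact hk2
      _ = C := ENNReal.add_halves C

lemma isTest_mul_prod {O : Set (Space n)} {J : Set ℝ} {ψ : Space n → ℝ} {ζ : ℝ → ℝ}
    (hψ : IsTest O ψ) (hζ : IsTest J ζ) :
    IsTest (O ×ˢ J) fun z : Space n × ℝ => ψ z.1 * ζ z.2 := by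
  have hs : Function.support (fun z : Space n × ℝ => ψ z.1 * ζ z.2) ⊆ tsupport ψ ×ˢ tsupport ζ := by
    intro z hz
    exact ⟨subset_tsupport _ (left_ne_zero_of_mul hz), subset_tsupport _ (right_ne_zero_of_mul hz)⟩
  refine ⟨(hψ.1.comp contDiff_fst).mul (hζ.1.comp contDiff_snd),
    HasCompactSupport.of_support_subset_isCompact (hψ.2.1.prod hζ.2.1) hs, ?_⟩
  exact (closure_minimal hs ((isClosed_tsupport _).prod (isClosed_tsupport _))).trans
    (prod_mono hψ.2.2 hζ.2.2)

lemma gradient_mul_const (ψ : Space n → ℝ) (x : Space n) (c : ℝ) (hψ : DifferentiableAt ℝ ψ x) :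
    gradient (fun y => ψ y * c) x = c • gradient ψ x := by
  ext i
  rw [gradient_apply, fderiv_mul_const hψ]
  simp [gradient_apply]

/-- The time slices of a distributional solution of `∂ₜ w = div B`, tested with a fixed function. -/
lemma ae_integral_slice_mul (hpq : p.HolderConjugate q) {O : Set (Space n)}
    {a b : ℝ} (hab : a < b) {w : Space n × ℝ → ℝ} {B : Space n × ℝ → Space n}
    (hw : Integrable w (volume.restrict (O ×ˢ Ioo a b)))
    (hB : MemLp B (ENNReal.ofReal q) (volume.restrict (O ×ˢ Ioo a b)))
    (H : ∀ φ : Space n × ℝ → ℝ, IsTest (O ×ˢ Ioo a b) φ →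
      ∫ z in O ×ˢ Ioo a b, (w z * deriv (fun s => φ (z.1, s)) z.2
        - inner ℝ (B z) (gradient (fun y => φ (y, z.2)) z.1)) = 0)
    {ψ : Space n → ℝ} (hψ : IsTest O ψ) :
    ∃ c : ℝ, ∀ᵐ t ∂(volume.restrict (Ioo a b)), ∫ x in O, w (x, t) * ψ x
      = c + ∫ r in Ioo t b, ∫ x in O, inner ℝ (B (x, r)) (gradient ψ x) := by
  rw [volume_restrict_prod] at hw hB
  have hψ1 : ContDiff ℝ 1 ψ := hψ.1.of_le (by exact_mod_cast le_top)
  have hgψ : MemLp (gradient ψ) (ENNReal.ofReal p) (volume.restrict O) :=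
    (continuous_gradient hψ1).memLp_of_hasCompactSupport (hasCompactSupport_gradient hψ.2.1)
  obtain ⟨C, hC⟩ := hψ.2.1.exists_bound_of_continuous hψ.1.continuous
  have i1 : Integrable (fun z : Space n × ℝ => w z * ψ z.1)
      ((volume.restrict O).prod (volume.restrict (Ioo a b))) :=
    hw.mul_bdd (hψ.1.continuous.comp continuous_fst).aestronglyMeasurable
      (Eventually.of_forall fun z => hC z.1)
  have i2 : Integrable (fun z : Space n × ℝ => inner ℝ (B z) (gradient ψ z.1))
      ((volume.restrict O).prod (volume.restrict (Ioo a b))) :=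
    integrable_inner_of_memLp hpq hB (hgψ.comp_fst _)
  refine ae_eq_sub_integral_of_weakDeriv hab i1.integral_prod_right i2.integral_prod_right
    fun ζ hζ => ?_
  have hζ1 : ContDiff ℝ 1 ζ := hζ.1.of_le (by exact_mod_cast le_top)
  obtain ⟨C0, hC0⟩ := hζ.2.1.exists_bound_of_continuous hζ.1.continuous
  obtain ⟨C1, hC1⟩ := hζ.2.1.deriv.exists_bound_of_continuous (hζ1.continuous_deriv le_rfl)
  have j1 : Integrable (fun z : Space n × ℝ => (w z * ψ z.1) * deriv ζ z.2)
      ((volume.restrict O).prod (volume.restrict (Ioo a b))) :=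
    i1.mul_bdd ((hζ1.continuous_deriv le_rfl).comp continuous_snd).aestronglyMeasurable
      (Eventually.of_forall fun z => hC1 z.2)
  have j2 : Integrable (fun z : Space n × ℝ => inner ℝ (B z) (gradient ψ z.1) * ζ z.2)
      ((volume.restrict O).prod (volume.restrict (Ioo a b))) :=
    i2.mul_bdd (hζ.1.continuous.comp continuous_snd).aestronglyMeasurable
      (Eventually.of_forall fun z => hC0 z.2)
  have h := H _ (isTest_mul_prod hψ hζ)
  rw [volume_restrict_prod] at h
  have e : ∀ z : Space n × ℝ, w z * deriv (fun s => ψ z.1 * ζ s) z.2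
      - inner ℝ (B z) (gradient (fun y => ψ y * ζ z.2) z.1)
      = (w z * ψ z.1) * deriv ζ z.2 - inner ℝ (B z) (gradient ψ z.1) * ζ z.2 := by
    intro z
    rw [deriv_const_mul _ ((hζ1.differentiable one_ne_zero) _),
      gradient_mul_const _ _ _ ((hψ1.differentiable one_ne_zero) _), inner_smul_right]
    ring
  simp only [e] at h
  rw [integral_sub j1 j2, sub_eq_zero, integral_prod_symm _ j1, integral_prod_symm _ j2] at h
  simpa only [integral_mul_const] using h

end

/-! ### Testing with functions of `W₀^{1,p}` at almost all pairs of times. -/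

section

variable {n : ℕ} {p q : ℝ}

lemma memLp_slice {X Y E : Type*} [MeasurableSpace X] [MeasurableSpace Y] [NormedAddCommGroup E]
    {μ : Measure X} {ν : Measure Y} [SFinite μ] [SFinite ν] (hp : 0 < p) {f : X × Y → E}
    (hf : MemLp f (ENNReal.ofReal p) (μ.prod ν)) :
    ∀ᵐ t ∂ν, MemLp (fun x => f (x, t)) (ENNReal.ofReal p) μ := by
  have h1 : ∀ᵐ t ∂ν, AEStronglyMeasurable (fun x => f (x, t)) μ := hf.1.prod_swap.prodMk_left
  have h2 : ∫⁻ z, ‖f z‖ₑ ^ p ∂(μ.prod ν) < ⊤ := by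
    rw [← eLpNorm_ofReal_rpow hp]
    exact ENNReal.rpow_lt_top_of_nonneg hp.le hf.2.ne
  rw [lintegral_prod_symm _ (hf.1.enorm.pow_const p)] at h2
  have h3 := ae_lt_top' (hf.1.enorm.pow_const p).prod_swap.lintegral_prod_right' h2.ne
  filter_upwards [h1, h3] with t ht1 ht2
  refine ⟨ht1, ?_⟩
  rw [← ENNReal.rpow_lt_top_iff_of_pos hp, eLpNorm_ofReal_rpow hp]
  exact ht2

lemma setIntegral_Ioo_add {a b s t : ℝ} {β : ℝ → ℝ} (hβ : IntegrableOn β (Ioo a b)) (hs : a ≤ s)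
    (hst : s < t) (htb : t < b) :
    ∫ r in Ioo s b, β r = (∫ r in Ioo s t, β r) + ∫ r in Ioo t b, β r := by
  have hβ' : IntegrableOn β (Ioc a b) := (integrableOn_Ioc_iff_integrableOn_Ioo (by finiteness)).2 hβ
  rw [← integral_Ioc_eq_integral_Ioo, ← integral_Ioc_eq_integral_Ioo,
    ← integral_Ioc_eq_integral_Ioo, ← Ioc_union_Ioc_eq_Ioc hst.le htb.le]
  exact setIntegral_union (Ioc_disjoint_Ioc_of_le le_rfl) measurableSet_Ioc
    (hβ'.mono_set (Ioc_subset_Ioc hs htb.le)) (hβ'.mono_set (Ioc_subset_Ioc (hs.trans hst.le) le_rfl))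

/-- The equation `∂ₜ w = div B`, tested with functions of `W₀^{1,p}` at almost all pairs of times. -/
lemma exists_slice_identity (hpq : p.HolderConjugate q) {O : Set (Space n)}
    (hOf : volume O < ⊤) {a b : ℝ} (hab : a < b) {w : Space n × ℝ → ℝ} {B : Space n × ℝ → Space n}
    (hw : MemLp w (ENNReal.ofReal q) (volume.restrict (O ×ˢ Ioo a b)))
    (hB : MemLp B (ENNReal.ofReal q) (volume.restrict (O ×ˢ Ioo a b)))
    (H : ∀ φ : Space n × ℝ → ℝ, IsTest (O ×ˢ Ioo a b) φ →
      ∫ z in O ×ˢ Ioo a b, (w z * deriv (fun s => φ (z.1, s)) z.2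
        - inner ℝ (B z) (gradient (fun y => φ (y, z.2)) z.1)) = 0) :
    ∃ E : Set ℝ, (∀ᵐ t ∂(volume.restrict (Ioo a b)), t ∈ E) ∧ ∀ s ∈ E, ∀ t ∈ E, s < t →
      ∀ (ψ : Space n → ℝ) (Ψ : Space n → Space n), IsW01p p O ψ Ψ →
        MemLp ψ (ENNReal.ofReal p) (volume.restrict O) →
        MemLp Ψ (ENNReal.ofReal p) (volume.restrict O) →
        ∫ x in O, (w (x, t) - w (x, s)) * ψ x
          = - ∫ z in O ×ˢ Ioo s t, inner ℝ (B z) (Ψ z.1) := by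
  obtain ⟨D, hDc, hDt, hD⟩ := exists_countable_dense_tests (p := p) hpq.lt.le O
  have : IsFiniteMeasure ((volume : Measure (Space n)).restrict O) := ⟨by simpa using hOf⟩
  have hwi : Integrable w (volume.restrict (O ×ˢ Ioo a b)) := by
    rw [volume_restrict_prod] at hw ⊢
    exact hw.integrable (one_le_ofReal hpq.symm.lt.le)
  -- Countability of `D` allows one null set of times for all `ψ ∈ D`. The constants depend on `ψ`
  -- but not on the time, so they cancel in differences.
  have h1 : ∀ᵐ t ∂(volume.restrict (Ioo a b)), ∀ ψ (hψ : ψ ∈ D),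
      ∫ x in O, w (x, t) * ψ x = (ae_integral_slice_mul hpq hab hwi hB H (hDt ψ hψ)).choose
        + ∫ r in Ioo t b, ∫ x in O, inner ℝ (B (x, r)) (gradient ψ x) := by
    rw [ae_ball_iff hDc]
    exact fun ψ hψ => (ae_integral_slice_mul hpq hab hwi hB H (hDt ψ hψ)).choose_spec
  have hw' := hw
  have hB' := hB
  rw [volume_restrict_prod] at hw' hB'
  refine ⟨{t | t ∈ Ioo a b ∧ MemLp (fun x => w (x, t)) (ENNReal.ofReal q) (volume.restrict O) ∧
    ∀ ψ (hψ : ψ ∈ D),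
      ∫ x in O, w (x, t) * ψ x = (ae_integral_slice_mul hpq hab hwi hB H (hDt ψ hψ)).choose
        + ∫ r in Ioo t b, ∫ x in O, inner ℝ (B (x, r)) (gradient ψ x)}, ?_, ?_⟩
  · filter_upwards [h1, memLp_slice hpq.symm.pos hw', ae_restrict_mem measurableSet_Ioo]
      with t h1 h2 h3 using ⟨h3, h2, h1⟩
  rintro s ⟨hs, hws, hsD⟩ t ⟨ht, hwt, htD⟩ hst ψ Ψ hψ hψm hΨm
  have hsub : Ioo s t ⊆ Ioo a b := Ioo_subset_Ioo hs.1.le ht.2.le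
  have hBst : MemLp B (ENNReal.ofReal q) ((volume.restrict O).prod (volume.restrict (Ioo s t))) := by
    rw [← volume_restrict_prod]
    exact hB.mono_measure (Measure.restrict_mono (prod_mono le_rfl hsub) le_rfl)
  have hd : MemLp (fun x => w (x, t) - w (x, s)) (ENNReal.ofReal q) (volume.restrict O) := hwt.sub hws
  have hφ : ∀ φ ∈ D, (∫ x in O, inner ℝ (w (x, t) - w (x, s)) (φ x))
      + ∫ z, inner ℝ (B z) (gradient φ z.1)
        ∂((volume.restrict O).prod (volume.restrict (Ioo s t))) = 0 := by
    intro φ hφD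
    have hφt := hDt φ hφD
    have hφ1 : ContDiff ℝ 1 φ := hφt.1.of_le (by exact_mod_cast le_top)
    have hgφ : MemLp (gradient φ) (ENNReal.ofReal p) (volume.restrict O) :=
      (continuous_gradient hφ1).memLp_of_hasCompactSupport (hasCompactSupport_gradient hφt.2.1)
    have i1 : Integrable (fun z : Space n × ℝ => inner ℝ (B z) (gradient φ z.1))
        ((volume.restrict O).prod (volume.restrict (Ioo a b))) :=
      integrable_inner_of_memLp hpq hB' (hgφ.comp_fst _)
    have i2 : Integrable (fun z : Space n × ℝ => inner ℝ (B z) (gradient φ z.1))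
        ((volume.restrict O).prod (volume.restrict (Ioo s t))) :=
      integrable_inner_of_memLp hpq hBst (hgφ.comp_fst _)
    have hadd := setIntegral_Ioo_add i1.integral_prod_right hs.1.le hst ht.2
    have e1 := htD φ hφD
    have e2 := hsD φ hφD
    have j1 := (hwt.integrable (one_le_ofReal hpq.symm.lt.le)).mul_isTest hφt
    have j2 := (hws.integrable (one_le_ofReal hpq.symm.lt.le)).mul_isTest hφt
    have e3 : ∫ x in O, inner ℝ (w (x, t) - w (x, s)) (φ x)
        = (∫ x in O, w (x, t) * φ x) - ∫ x in O, w (x, s) * φ x := by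
      rw [← integral_sub j1 j2]
      refine integral_congr_ae (Eventually.of_forall fun x => ?_)
      simp only [RCLike.inner_apply, conj_trivial]
      ring
    rw [e3, integral_prod_symm _ i2, e1, e2, hadd]
    ring
  -- The expression is continuous in `(ψ, Ψ)` for the `W^{1,p}` norm, by Hölder, and vanishes on the
  -- dense family.
  have hbound : ∀ C : ENNReal, 0 < C → ‖(∫ x in O, inner ℝ (w (x, t) - w (x, s)) (ψ x))
      + ∫ z, inner ℝ (B z) (Ψ z.1) ∂((volume.restrict O).prod (volume.restrict (Ioo s t)))‖ₑ
      ≤ (eLpNorm (fun x => w (x, t) - w (x, s)) (ENNReal.ofReal q) (volume.restrict O)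
        + eLpNorm B (ENNReal.ofReal q) ((volume.restrict O).prod (volume.restrict (Ioo s t)))
        * (volume.restrict (Ioo s t)) univ ^ (1 / p)) * C := by
    intro C hC
    obtain ⟨φ, hφD, hφ1, hφ2⟩ := hD ψ Ψ hψ hψm hΨm C hC
    have hφt := hDt φ hφD
    have hφm : MemLp φ (ENNReal.ofReal p) (volume.restrict O) :=
      hφt.1.continuous.memLp_of_hasCompactSupport hφt.2.1
    have hgφ : MemLp (gradient φ) (ENNReal.ofReal p) (volume.restrict O) :=
      (continuous_gradient (hφt.1.of_le (by exact_mod_cast le_top))).memLp_of_hasCompactSupport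
        (hasCompactSupport_gradient hφt.2.1)
    have hgφ' := hgφ.comp_fst (volume.restrict (Ioo s t))
    have hΨ' := hΨm.comp_fst (volume.restrict (Ioo s t))
    have e1 : (∫ x in O, inner ℝ (w (x, t) - w (x, s)) (ψ x))
        + ∫ z, inner ℝ (B z) (Ψ z.1) ∂((volume.restrict O).prod (volume.restrict (Ioo s t)))
        = (∫ x in O, inner ℝ (w (x, t) - w (x, s)) (ψ x - φ x))
        + ∫ z, inner ℝ (B z) (Ψ z.1 - gradient φ z.1)
          ∂((volume.restrict O).prod (volume.restrict (Ioo s t))) := by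
      simp only [inner_sub_right (𝕜 := ℝ)]
      rw [integral_sub (integrable_inner_of_memLp hpq hd hψm)
        (integrable_inner_of_memLp hpq hd hφm), integral_sub
        (integrable_inner_of_memLp hpq hBst hΨ') (integrable_inner_of_memLp hpq hBst hgφ')]
      linarith [hφ φ hφD]
    rw [e1, add_mul]
    refine (enorm_add_le _ _).trans (add_le_add ?_ ?_)
    · refine (enorm_integral_inner_le hpq hd.1 (hψm.sub hφm).1).trans ?_
      gcongr
      exact hφ1
    · refine (enorm_integral_inner_le hpq hBst.1 (hΨ'.sub hgφ').1).trans ?_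
      rw [mul_assoc]
      gcongr
      have := eLpNorm_comp_fst (ν := volume.restrict (Ioo s t)) hpq.pos (hΨm.sub hgφ).1
      refine this.le.trans ?_
      gcongr
      exact hφ2
  have hzero : ‖(∫ x in O, inner ℝ (w (x, t) - w (x, s)) (ψ x))
      + ∫ z, inner ℝ (B z) (Ψ z.1) ∂((volume.restrict O).prod (volume.restrict (Ioo s t)))‖ₑ = 0 := by
    refine le_antisymm (le_of_forall_gt fun M hM => ?_) zero_le
    obtain ⟨C, hC, hCM⟩ := ENNReal.exists_pos_mul_lt (a := (eLpNorm (fun x => w (x, t) - w (x, s))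
      (ENNReal.ofReal q) (volume.restrict O)
        + eLpNorm B (ENNReal.ofReal q) ((volume.restrict O).prod (volume.restrict (Ioo s t)))
        * (volume.restrict (Ioo s t)) univ ^ (1 / p))) (ENNReal.add_ne_top.2 ⟨hd.2.ne,
          ENNReal.mul_ne_top hBst.2.ne (ENNReal.rpow_ne_top_of_nonneg
            (one_div_nonneg.2 hpq.pos.le) (measure_ne_top _ _))⟩) hM.ne'
    exact (hbound C hC).trans_lt (by rwa [mul_comm])
  rw [volume_restrict_prod]
  rw [enorm_eq_zero] at hzero
  have e : ∀ x, (w (x, t) - w (x, s)) * ψ x = inner ℝ (w (x, t) - w (x, s)) (ψ x) := by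
    intro x
    simp [mul_comm]
  simp only [e]
  linarith

end

section

/-! ### Functions whose increments are small in the mean are constant -/

/-- At points `s < t` where the primitive of `D` is differentiable, `D t - D s` is the limit of `h⁻¹
∫ₛᵗ (D (h + r) - D r) dr`, which the hypothesis bounds by any `η > 0`. Hence `D` takes the same
value at almost all points. -/
lemma ae_eq_const_of_lintegral_translate_le {a b : ℝ} (hab : a < b) {D : ℝ → ℝ}
    (hD : IntegrableOn D (Ioo a b))
    (H : ∀ η : ℝ, 0 < η → ∃ h₀ : ℝ, 0 < h₀ ∧ ∀ h : ℝ, 0 < h → h < h₀ →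
      ∫⁻ s in Ioo a (b - h), ‖D (h + s) - D s‖ₑ ≤ ENNReal.ofReal (h * η)) :
    ∃ c : ℝ, ∀ᵐ t ∂(volume.restrict (Ioo a b)), D t = c := by
  have hDi : IntervalIntegrable D volume a b := by
    rw [intervalIntegrable_iff_integrableOn_Ioo_of_le hab.le]
    exact hD
  have hsub : ∀ {x y : ℝ}, x ∈ Icc a b → y ∈ Icc a b → IntervalIntegrable D volume x y :=
    fun hx hy => hDi.mono_set (by
      rw [uIcc_of_le hab.le]
      exact uIcc_subset_Icc hx hy)
  set P : ℝ → ℝ := fun t => ∫ r in a..t, D r with hP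
  have hder : ∀ᵐ t ∂(volume.restrict (Ioo a b)), HasDerivAt P (D t) t := by
    rw [ae_restrict_iff' measurableSet_Ioo]
    filter_upwards [hDi.ae_hasDerivAt_integral] with t ht hmem
    exact ht (by rw [uIcc_of_le hab.le]; exact Ioo_subset_Icc_self hmem) a
      (by rw [uIcc_of_le hab.le]; exact left_mem_Icc.2 hab.le)
  have hkey : ∀ s t, s ∈ Ioo a b → t ∈ Ioo a b → s < t → HasDerivAt P (D s) s →
      HasDerivAt P (D t) t → D t = D s := by
    intro s t hs ht hst hds hdt
    have hlim : Tendsto (fun h : ℝ => h⁻¹ * ((P (t + h) - P t) - (P (s + h) - P s))) (𝓝[>] 0)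
        (𝓝 (D t - D s)) := by
      have h1 := hdt.tendsto_slope_zero_right
      have h2 := hds.tendsto_slope_zero_right
      refine (h1.sub h2).congr fun h => ?_
      simp only [smul_eq_mul]
      ring
    have habs : ∀ η : ℝ, 0 < η → |D t - D s| ≤ η := by
      intro η hη
      obtain ⟨h₀, hh₀, hH⟩ := H η hη
      refine le_of_tendsto hlim.abs ?_
      filter_upwards [Ioo_mem_nhdsGT (lt_min hh₀ (sub_pos.2 ht.2))] with h hh
      have hh1 : 0 < h := hh.1
      have hh2 : h < h₀ := hh.2.trans_le (min_le_left _ _)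
      have hh3 : h < b - t := hh.2.trans_le (min_le_right _ _)
      have hIs : s ∈ Icc a b := Ioo_subset_Icc_self hs
      have hIt : t ∈ Icc a b := Ioo_subset_Icc_self ht
      have hIs' : s + h ∈ Icc a b := ⟨by linarith [hs.1], by linarith⟩
      have hIt' : t + h ∈ Icc a b := ⟨by linarith [ht.1], by linarith⟩
      have hIa : a ∈ Icc a b := left_mem_Icc.2 hab.le
      have e1 : (P (t + h) - P t) - (P (s + h) - P s) = ∫ r in s..t, (D (h + r) - D r) := by
        have i1 : IntervalIntegrable (fun r => D (h + r)) volume s t := by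
          have := (hsub hIs' hIt').comp_add_left h
          simpa using this
        rw [intervalIntegral.integral_sub i1 (hsub hIs hIt),
          intervalIntegral.integral_comp_add_left (fun r => D r) h, add_comm h s, add_comm h t, hP]
        simp only
        rw [← intervalIntegral.integral_interval_sub_left (hsub hIa hIt') (hsub hIa hIs'),
          ← intervalIntegral.integral_interval_sub_left (hsub hIa hIt) (hsub hIa hIs)]
        ring
      rw [e1, abs_mul, abs_of_pos (inv_pos.2 hh1), inv_mul_le_iff₀ hh1]
      rw [← ENNReal.ofReal_le_ofReal_iff (by positivity), ← Real.enorm_eq_ofReal_abs,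
        intervalIntegral.integral_of_le hst.le]
      refine (enorm_integral_le_lintegral_enorm _).trans ((lintegral_mono_set ?_).trans (hH h hh1 hh2))
      intro r hr
      exact ⟨hs.1.trans hr.1, by linarith [hr.2]⟩
    have := le_of_forall_pos_le_add (a := |D t - D s|) (b := 0) fun η hη => by
      simpa using habs η hη
    exact sub_eq_zero.1 (abs_nonpos_iff.1 this)
  have hmem := ae_restrict_mem (μ := (volume : Measure ℝ)) (measurableSet_Ioo (a := a) (b := b))
  have hne : (ae ((volume : Measure ℝ).restrict (Ioo a b))).NeBot := by
    rw [ae_neBot, Ne, Measure.restrict_eq_zero, Real.volume_Ioo]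
    simpa using hab
  obtain ⟨s, hs1, hs2⟩ := (hder.and hmem).exists
  refine ⟨D s, ?_⟩
  filter_upwards [hder, hmem] with t ht1 ht2
  rcases lt_trichotomy s t with h | h | h
  · exact hkey s t hs2 ht2 h hs1 ht1
  · rw [h]
  · exact (hkey t s ht2 hs2 h ht1 hs1).symm

/-! ### The energy identity -/

variable {n : ℕ} {p q : ℝ}

/-- `L^p(X × ℝ)`-continuity of translations in time, combined with Hölder's inequality. -/
lemma exists_lintegral_increment_le (hpq : p.HolderConjugate q)
    {Z B : Space n × ℝ → Space n} (hZm : StronglyMeasurable Z) (hBm : StronglyMeasurable B)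
    (hZ : MemLp Z (ENNReal.ofReal p) volume) (hB : MemLp B (ENNReal.ofReal q) volume)
    {η : ℝ} (hη : 0 < η) :
    ∃ h₀ : ℝ, 0 < h₀ ∧ ∀ h : ℝ, 0 < h → h < h₀ →
      ∫⁻ s, ∫⁻ r in Ioo s (h + s), ∫⁻ x, ‖B (x, r)‖ₑ *
        (‖Z (x, r) - Z (x, s)‖ₑ + ‖Z (x, r) - Z (x, h + s)‖ₑ) ≤ ENNReal.ofReal (h * η) := by
  set osc : ℝ → ENNReal := fun h =>
    eLpNorm (fun z : Space n × ℝ => Z (z.1, h + z.2) - Z z) (ENNReal.ofReal p) volume with hosc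
  set M := eLpNorm B (ENNReal.ofReal q) volume with hM
  have hoscl := tendsto_eLpNorm_translate_snd (one_le_ofReal hpq.lt.le) ENNReal.ofReal_ne_top hZ
  have hC : ∃ C : ENNReal, 0 < C ∧ C * (2 * M) < ENNReal.ofReal η :=
    ENNReal.exists_pos_mul_lt (ENNReal.mul_ne_top (by simp) hB.2.ne) (by simpa using hη)
  obtain ⟨C, hC0, hC1⟩ := hC
  obtain ⟨h₀, hh₀, hsmall⟩ := Metric.eventually_nhds_iff.1 ((ENNReal.tendsto_nhds_zero.1 hoscl) C hC0)
  refine ⟨h₀, hh₀, fun h hh hhh => ?_⟩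
  have hmp : ∀ ρ : ℝ, MeasurePreserving (fun z : Space n × ℝ => (z.1, ρ + z.2)) volume volume :=
    fun ρ => (MeasurePreserving.id _).prod (measurePreserving_add_left volume ρ)
  have hmeas : ∀ ρ : ℝ, Measurable fun z : Space n × ℝ => (z.1, ρ + z.2) := fun ρ => by fun_prop
  have hBρ : ∀ ρ : ℝ, eLpNorm (fun z : Space n × ℝ => B (z.1, ρ + z.2)) (ENNReal.ofReal q) volume
      = M := fun ρ => eLpNorm_comp_measurePreserving hBm.aestronglyMeasurable (hmp ρ)
  -- With `r = ρ + s` and `ρ` fixed, the integral over `s` is a Hölder product of the norm of `B`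
  -- with oscillations of `Z` under shifts by `ρ` and `h - ρ`, both smaller than `h₀`. Integrating
  -- over `ρ ∈ (0, h)` then produces the factor `h`.
  have h1 : ∀ ρ ∈ Ioo 0 h, ∫⁻ z : Space n × ℝ, ‖B (z.1, ρ + z.2)‖ₑ *
      (‖Z (z.1, ρ + z.2) - Z z‖ₑ + ‖Z (z.1, ρ + z.2) - Z (z.1, h + z.2)‖ₑ)
      ≤ ENNReal.ofReal η := by
    intro ρ hρ
    have hm1 : StronglyMeasurable fun z : Space n × ℝ => B (z.1, ρ + z.2) :=
      hBm.comp_measurable (hmeas ρ)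
    have hm2 : StronglyMeasurable fun z : Space n × ℝ => Z (z.1, ρ + z.2) - Z z :=
      (hZm.comp_measurable (hmeas ρ)).sub hZm
    have hm3 : StronglyMeasurable fun z : Space n × ℝ => Z (z.1, ρ + z.2) - Z (z.1, h + z.2) :=
      (hZm.comp_measurable (hmeas ρ)).sub (hZm.comp_measurable (hmeas h))
    have e3 : eLpNorm (fun z : Space n × ℝ => Z (z.1, ρ + z.2) - Z (z.1, h + z.2))
        (ENNReal.ofReal p) volume = osc (h - ρ) := by
      have hm4 : StronglyMeasurable fun z : Space n × ℝ => Z (z.1, (h - ρ) + z.2) - Z z :=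
        (hZm.comp_measurable (hmeas _)).sub hZm
      rw [hosc]
      simp only
      rw [← eLpNorm_comp_measurePreserving hm4.aestronglyMeasurable (hmp ρ), ← eLpNorm_neg]
      congr 1
      funext z
      simp only [Pi.neg_apply, Function.comp, neg_sub]
      congr 3
      ring
    calc _ = (∫⁻ z : Space n × ℝ, ‖B (z.1, ρ + z.2)‖ₑ * ‖Z (z.1, ρ + z.2) - Z z‖ₑ)
          + ∫⁻ z : Space n × ℝ, ‖B (z.1, ρ + z.2)‖ₑ * ‖Z (z.1, ρ + z.2) - Z (z.1, h + z.2)‖ₑ := by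
          simp only [mul_add]
          exact lintegral_add_left (hm1.enorm.mul hm2.enorm) _
      _ ≤ M * osc ρ + M * osc (h - ρ) := by
          refine add_le_add ?_ ?_
          · refine (lintegral_enorm_mul_le hpq hm1.aestronglyMeasurable
              hm2.aestronglyMeasurable).trans_eq ?_
            rw [hBρ]
          · refine (lintegral_enorm_mul_le hpq hm1.aestronglyMeasurable
              hm3.aestronglyMeasurable).trans_eq ?_
            rw [hBρ, e3]
      _ ≤ M * C + M * C := by
          gcongr
          · exact hsmall (by rw [dist_zero_right, Real.norm_eq_abs, abs_of_pos hρ.1]; linarith [hρ.2])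
          · refine hsmall ?_
            rw [dist_zero_right, Real.norm_eq_abs, abs_of_pos (sub_pos.2 hρ.2)]
            linarith [hρ.1]
      _ = C * (2 * M) := by ring
      _ ≤ _ := hC1.le
  have hBm' := hBm.measurable
  have hZm' := hZm.measurable
  calc _ = ∫⁻ s : ℝ, ∫⁻ ρ in Ioo 0 h, ∫⁻ x : Space n, ‖B (x, ρ + s)‖ₑ *
        (‖Z (x, ρ + s) - Z (x, s)‖ₑ + ‖Z (x, ρ + s) - Z (x, h + s)‖ₑ) := by
        refine lintegral_congr fun s => ?_
        have hmp := (measurePreserving_add_right (volume : Measure ℝ) s).setLIntegral_comp_preimage_emb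
          (MeasurableEquiv.addRight s).measurableEmbedding (fun r => ∫⁻ x, ‖B (x, r)‖ₑ *
        (‖Z (x, r) - Z (x, s)‖ₑ + ‖Z (x, r) - Z (x, h + s)‖ₑ)) (Ioo s (h + s))
        rw [← hmp]
        congr 3
        ext r
        simp
    _ = ∫⁻ ρ in Ioo 0 h, ∫⁻ s : ℝ, ∫⁻ x : Space n, ‖B (x, ρ + s)‖ₑ *
        (‖Z (x, ρ + s) - Z (x, s)‖ₑ + ‖Z (x, ρ + s) - Z (x, h + s)‖ₑ) := by
        refine lintegral_lintegral_swap (Measurable.aemeasurable ?_)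
        have : Measurable fun y : (ℝ × ℝ) × Space n => ‖B (y.2, y.1.2 + y.1.1)‖ₑ *
          (‖Z (y.2, y.1.2 + y.1.1) - Z (y.2, y.1.1)‖ₑ
            + ‖Z (y.2, y.1.2 + y.1.1) - Z (y.2, h + y.1.1)‖ₑ) := by
          fun_prop
        exact this.lintegral_prod_right'
    _ ≤ ∫⁻ ρ in Ioo 0 h, ENNReal.ofReal η := by
        refine setLIntegral_mono measurable_const fun ρ hρ => ?_
        refine le_trans (le_of_eq ?_) (h1 ρ hρ)
        have hmf : Measurable fun z : Space n × ℝ => ‖B (z.1, ρ + z.2)‖ₑ *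
            (‖Z (z.1, ρ + z.2) - Z z‖ₑ + ‖Z (z.1, ρ + z.2) - Z (z.1, h + z.2)‖ₑ) := by
          fun_prop
        exact (lintegral_prod_symm _ hmf.aemeasurable).symm
    _ = ENNReal.ofReal (h * η) := by
        rw [lintegral_const, Measure.restrict_apply_univ, Real.volume_Ioo, sub_zero, mul_comm,
          ENNReal.ofReal_mul hh.le]

end

/-! ### Conservation of the total energy. -/

section

variable {n : ℕ} {p q a b : ℝ}

/-- A function `w` on `ℝⁿ × (a, b)` with `∂ₜ w = div B` in the weak sense that the equation may be
tested, at the times of a set `E` of full measure, with the function whose slice is `w` and whose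
gradient is `Z`. -/
structure EnergyData (p q a b : ℝ) (w : Space n × ℝ → ℝ) (Z B : Space n × ℝ → Space n)
    (E : Set ℝ) : Prop where
  hpq : p.HolderConjugate q
  hab : a < b
  w_meas : StronglyMeasurable w
  Z_meas : StronglyMeasurable Z
  B_meas : StronglyMeasurable B
  w_memLp : MemLp w 2 volume
  Z_memLp : MemLp Z (ENNReal.ofReal p) volume
  B_memLp : MemLp B (ENNReal.ofReal q) volume
  ae_mem : ∀ᵐ t ∂(volume.restrict (Ioo a b)), t ∈ E
  subset : E ⊆ Ioo a b
  w_slice : ∀ t ∈ E, MemLp (fun x => w (x, t)) 2 volume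
  Z_slice : ∀ t ∈ E, MemLp (fun x => Z (x, t)) (ENNReal.ofReal p) volume
  eq_left : ∀ s ∈ E, ∀ t ∈ E, s < t → ∫ x, (w (x, t) - w (x, s)) * w (x, s)
    = - ∫ z, inner ℝ (B z) (Z (z.1, s)) ∂((volume : Measure (Space n)).prod
      (volume.restrict (Ioo s t)))
  eq_right : ∀ s ∈ E, ∀ t ∈ E, s < t → ∫ x, (w (x, t) - w (x, s)) * w (x, t)
    = - ∫ z, inner ℝ (B z) (Z (z.1, t)) ∂((volume : Measure (Space n)).prod
      (volume.restrict (Ioo s t)))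

namespace EnergyData

variable {w : Space n × ℝ → ℝ} {Z B : Space n × ℝ → Space n} {E : Set ℝ}

/-- The measure on `ℝⁿ × I`. -/
abbrev slab (n : ℕ) (I : Set ℝ) : Measure (Space n × ℝ) :=
  (volume : Measure (Space n)).prod (volume.restrict I)

lemma slab_eq (I : Set ℝ) : slab n I = volume.restrict (univ ×ˢ I) := by
  rw [volume_restrict_prod, Measure.restrict_univ]

lemma slab_le (I : Set ℝ) : slab n I ≤ volume := by
  rw [slab_eq]
  exact Measure.restrict_le_self

lemma inner_slice_integrable (h : EnergyData p q a b w Z B E) {τ : ℝ} (hτ : τ ∈ E) (s t : ℝ) :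
    Integrable (fun z : Space n × ℝ => inner ℝ (B z) (Z (z.1, τ))) (slab n (Ioo s t)) :=
  integrable_inner_of_memLp h.hpq (h.B_memLp.mono_measure (slab_le _)) ((h.Z_slice τ hτ).comp_fst _)

lemma inner_integrable (h : EnergyData p q a b w Z B E) :
    Integrable (fun z : Space n × ℝ => inner ℝ (B z) (Z z)) volume :=
  integrable_inner_of_memLp h.hpq h.B_memLp h.Z_memLp

lemma sq_integrable (h : EnergyData p q a b w Z B E) {t : ℝ} (ht : t ∈ E) :
    Integrable (fun x => w (x, t) ^ 2) volume := (h.w_slice t ht).integrable_sq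

lemma mul_integrable (h : EnergyData p q a b w Z B E) {s t : ℝ} (hs : s ∈ E) (ht : t ∈ E) :
    Integrable (fun x => w (x, s) * w (x, t)) volume :=
  (h.w_slice s hs).integrable_mul (h.w_slice t ht)

/-- The accumulated energy `∫ₐᵗ ∫ ⟨B, Z⟩`. -/
def work (a : ℝ) (B Z : Space n × ℝ → Space n) (t : ℝ) : ℝ :=
  ∫ r in a..t, ∫ x, inner ℝ (B (x, r)) (Z (x, r))

lemma work_sub (h : EnergyData p q a b w Z B E) {s t : ℝ} (hst : s ≤ t) :
    work a B Z t - work a B Z s = ∫ z, inner ℝ (B z) (Z z) ∂(slab n (Ioo s t)) := by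
  have hi : Integrable (fun r => ∫ x, inner ℝ (B (x, r)) (Z (x, r))) volume :=
    h.inner_integrable.integral_prod_right
  have hj : Integrable (fun z : Space n × ℝ => inner ℝ (B z) (Z z)) (slab n (Ioo s t)) :=
    h.inner_integrable.mono_measure (slab_le _)
  rw [integral_prod_symm _ hj]
  unfold work
  rw [intervalIntegral.integral_interval_sub_left hi.intervalIntegrable hi.intervalIntegrable,
    intervalIntegral.integral_of_le hst, integral_Ioc_eq_integral_Ioo]

lemma continuous_work (h : EnergyData p q a b w Z B E) : Continuous (work a B Z) := by
  have hi : Integrable (fun r => ∫ x, inner ℝ (B (x, r)) (Z (x, r))) volume :=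
    h.inner_integrable.integral_prod_right
  exact intervalIntegral.continuous_primitive (fun _ _ => hi.intervalIntegrable) a

/-- The kinetic energy plus twice the work. -/
def total (a : ℝ) (w : Space n × ℝ → ℝ) (B Z : Space n × ℝ → Space n) (t : ℝ) : ℝ :=
  (∫ x, w (x, t) ^ 2) + 2 * work a B Z t

/-- The sum of the tests with `w(s)` and `w(t)`, since `(w(t) - w(s)) (w(t) + w(s))` is a difference
of squares. -/
lemma sq_sub_sq (h : EnergyData p q a b w Z B E) {s t : ℝ} (hs : s ∈ E) (ht : t ∈ E) (hst : s < t) :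
    (∫ x, w (x, t) ^ 2) - ∫ x, w (x, s) ^ 2
      = - ((∫ z, inner ℝ (B z) (Z (z.1, s)) ∂(slab n (Ioo s t)))
        + ∫ z, inner ℝ (B z) (Z (z.1, t)) ∂(slab n (Ioo s t))) := by
  have e1 : ∫ x, (w (x, t) - w (x, s)) * w (x, s)
      = (∫ x, w (x, t) * w (x, s)) - ∫ x, w (x, s) ^ 2 := by
    rw [← integral_sub (h.mul_integrable ht hs) (h.sq_integrable hs)]
    simp only [sub_mul, pow_two]
  have e2 : ∫ x, (w (x, t) - w (x, s)) * w (x, t)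
      = (∫ x, w (x, t) ^ 2) - ∫ x, w (x, t) * w (x, s) := by
    rw [← integral_sub (h.sq_integrable ht) (h.mul_integrable ht hs)]
    congr 1
    funext x
    ring
  have e3 := h.eq_left s hs t ht hst
  have e4 := h.eq_right s hs t ht hst
  linarith

/-- By `sq_sub_sq` the change of the kinetic energy is a trapezoidal approximation of minus twice
the work. What remains is its error, in which `Z` is compared with its slices at the two end times.
-/
lemma enorm_total_sub_le (h : EnergyData p q a b w Z B E) {s t : ℝ} (hs : s ∈ E) (ht : t ∈ E)
    (hst : s < t) :
    ‖total a w B Z t - total a w B Z s‖ₑ ≤ ∫⁻ r in Ioo s t, ∫⁻ x, ‖B (x, r)‖ₑ *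
        (‖Z (x, r) - Z (x, s)‖ₑ + ‖Z (x, r) - Z (x, t)‖ₑ) := by
  have i0 : Integrable (fun z : Space n × ℝ => inner ℝ (B z) (Z z)) (slab n (Ioo s t)) :=
    h.inner_integrable.mono_measure (slab_le _)
  have i1 := h.inner_slice_integrable hs s t
  have i2 := h.inner_slice_integrable ht s t
  have e : total a w B Z t - total a w B Z s = ∫ z, (inner ℝ (B z) (Z z - Z (z.1, s))
      + inner ℝ (B z) (Z z - Z (z.1, t))) ∂(slab n (Ioo s t)) := by
    have e1 := h.sq_sub_sq hs ht hst
    have e2 := h.work_sub hst.le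
    simp only [inner_sub_right (𝕜 := ℝ)]
    rw [integral_add (f := fun z : Space n × ℝ => inner ℝ (B z) (Z z) - inner ℝ (B z) (Z (z.1, s)))
      (g := fun z : Space n × ℝ => inner ℝ (B z) (Z z) - inner ℝ (B z) (Z (z.1, t)))
      (i0.sub i1) (i0.sub i2), integral_sub i0 i1, integral_sub i0 i2]
    unfold total
    linarith
  rw [e]
  refine (enorm_integral_le_lintegral_enorm _).trans ?_
  have hB := h.B_meas.measurable
  have hZ := h.Z_meas.measurable
  have hm : Measurable fun z : Space n × ℝ => ‖B z‖ₑ *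
      (‖Z z - Z (z.1, s)‖ₑ + ‖Z z - Z (z.1, t)‖ₑ) := by fun_prop
  rw [← lintegral_prod_symm (fun z : Space n × ℝ => ‖B z‖ₑ *
      (‖Z z - Z (z.1, s)‖ₑ + ‖Z z - Z (z.1, t)‖ₑ)) hm.aemeasurable]
  refine lintegral_mono fun z => (enorm_add_le _ _).trans ?_
  rw [mul_add]
  exact add_le_add (enorm_inner_le _ _) (enorm_inner_le _ _)

lemma total_integrableOn (h : EnergyData p q a b w Z B E) :
    IntegrableOn (total a w B Z) (Ioo a b) := by
  have h1 : Integrable (fun z => w z ^ 2) (volume : Measure (Space n × ℝ)) := h.w_memLp.integrable_sq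
  have h2 : Integrable (fun t => ∫ x, w (x, t) ^ 2) volume := h1.integral_prod_right
  have h3 : IntegrableOn (work a B Z) (Ioo a b) :=
    (h.continuous_work.integrableOn_Icc).mono_set Ioo_subset_Icc_self
  exact h2.integrableOn.add (h3.const_mul 2)

/-- The total energy is conserved. -/
lemma exists_total_eq (h : EnergyData p q a b w Z B E) :
    ∃ c : ℝ, ∀ᵐ t ∂(volume.restrict (Ioo a b)), total a w B Z t = c := by
  refine ae_eq_const_of_lintegral_translate_le h.hab h.total_integrableOn fun η hη => ?_
  obtain ⟨h₀, hh₀, H⟩ := exists_lintegral_increment_le h.hpq h.Z_meas h.B_meas h.Z_memLp h.B_memLp hη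
  refine ⟨h₀, hh₀, fun d hd hd' => le_trans ?_ (H d hd hd')⟩
  have hE := h.ae_mem
  rw [ae_restrict_iff' measurableSet_Ioo] at hE
  -- Both `s` and `d + s` must be admissible times. The exceptional set for the second is a
  -- translate of a null set.
  have hE' : ∀ᵐ s ∂(volume : Measure ℝ), d + s ∈ Ioo a b → d + s ∈ E :=
    (measurePreserving_add_left (volume : Measure ℝ) d).quasiMeasurePreserving.ae hE
  calc _ ≤ ∫⁻ s in Ioo a (b - d), ∫⁻ r in Ioo s (d + s), ∫⁻ x, ‖B (x, r)‖ₑ *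
        (‖Z (x, r) - Z (x, s)‖ₑ + ‖Z (x, r) - Z (x, d + s)‖ₑ) := by
        refine lintegral_mono_ae ?_
        refine (ae_restrict_iff' measurableSet_Ioo).2 ?_
        filter_upwards [hE, hE'] with s h1 h2 hs
        exact h.enorm_total_sub_le (h1 ⟨hs.1, by linarith [hs.2]⟩)
          (h2 ⟨by linarith [hs.1], by linarith [hs.2]⟩) (by linarith)
    _ ≤ _ := setLIntegral_le_lintegral _ _

/-- Combining conservation of energy with the test by `w(s)` gives `‖w(t) - w(s)‖² = ∓ 2 ∫ ⟨B, Z -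
Z(s)⟩` over the interval between the times. Only the slice of `Z` at `s` enters, so it suffices that
`s` is a good time, while `t` is arbitrary. -/
lemma sq_dist_le (h : EnergyData p q a b w Z B E) {c : ℝ} (hc : ∀ t ∈ E, total a w B Z t = c)
    {s t α β : ℝ} (hs : s ∈ E) (ht : t ∈ E) (hsI : s ∈ Ioo α β) (htI : t ∈ Ioo α β) :
    ENNReal.ofReal (∫ x, (w (x, t) - w (x, s)) ^ 2)
      ≤ 2 * (eLpNorm B (ENNReal.ofReal q) volume *
        (eLpNorm Z (ENNReal.ofReal p) (slab n (Ioo α β))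
          + ENNReal.ofReal (β - α) ^ (1 / p) *
            eLpNorm (fun x => Z (x, s)) (ENNReal.ofReal p) volume)) := by
  have e0 : ∫ x, (w (x, t) - w (x, s)) ^ 2
      = (∫ x, w (x, t) ^ 2) - 2 * (∫ x, w (x, t) * w (x, s)) + ∫ x, w (x, s) ^ 2 := by
    rw [← integral_const_mul, ← integral_sub (h.sq_integrable ht) ((h.mul_integrable ht hs).const_mul 2),
      ← integral_add (f := fun x => w (x, t) ^ 2 - 2 * (w (x, t) * w (x, s)))
        ((h.sq_integrable ht).sub ((h.mul_integrable ht hs).const_mul 2))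
        (h.sq_integrable hs)]
    congr 1
    funext x
    ring
  have key : ∀ s' t' : ℝ, s' ≤ t' → Ioo s' t' ⊆ Ioo α β →
      ‖∫ z, inner ℝ (B z) (Z z - Z (z.1, s)) ∂(slab n (Ioo s' t'))‖ₑ
      ≤ eLpNorm B (ENNReal.ofReal q) volume *
        (eLpNorm Z (ENNReal.ofReal p) (slab n (Ioo α β))
          + ENNReal.ofReal (β - α) ^ (1 / p) *
            eLpNorm (fun x => Z (x, s)) (ENNReal.ofReal p) volume) := by
    intro s' t' hst' hsub
    have hle : slab n (Ioo s' t') ≤ slab n (Ioo α β) := by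
      rw [slab_eq, slab_eq]
      exact Measure.restrict_mono (prod_mono le_rfl hsub) le_rfl
    have m1 : AEStronglyMeasurable (fun z : Space n × ℝ => Z (z.1, s)) (slab n (Ioo s' t')) :=
      (h.Z_meas.comp_measurable (measurable_fst.prodMk measurable_const)).aestronglyMeasurable
    refine (enorm_integral_inner_le h.hpq h.B_meas.aestronglyMeasurable
      (h.Z_meas.aestronglyMeasurable.sub m1)).trans ?_
    gcongr
    · exact slab_le _
    · refine (eLpNorm_sub_le h.Z_meas.aestronglyMeasurable m1 (one_le_ofReal h.hpq.lt.le)).trans ?_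
      refine add_le_add (eLpNorm_mono_measure _ hle) ?_
      refine (eLpNorm_mono_measure _ hle).trans_eq ?_
      rw [eLpNorm_comp_fst h.hpq.pos (f := fun x => Z (x, s)) (h.Z_slice s hs).1,
        Measure.restrict_apply_univ, Real.volume_Ioo]
  have i0 : ∀ s' t' : ℝ, Integrable (fun z : Space n × ℝ => inner ℝ (B z) (Z z))
      (slab n (Ioo s' t')) := fun s' t' => h.inner_integrable.mono_measure (slab_le _)
  have i1 := h.inner_slice_integrable hs
  have hmain : ∃ s' t' : ℝ, s' ≤ t' ∧ Ioo s' t' ⊆ Ioo α β ∧ ∫ x, (w (x, t) - w (x, s)) ^ 2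
      ≤ 2 * |∫ z, inner ℝ (B z) (Z z - Z (z.1, s)) ∂(slab n (Ioo s' t'))| := by
    have hcs := hc s hs
    have hct := hc t ht
    unfold total at hcs hct
    rcases lt_trichotomy s t with hst | hst | hst
    · refine ⟨s, t, hst.le, Ioo_subset_Ioo hsI.1.le htI.2.le, ?_⟩
      have e1 : ∫ x, (w (x, t) - w (x, s)) * w (x, s)
          = (∫ x, w (x, t) * w (x, s)) - ∫ x, w (x, s) ^ 2 := by
        rw [← integral_sub (h.mul_integrable ht hs) (h.sq_integrable hs)]
        simp only [sub_mul, pow_two]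
      have e2 := h.eq_left s hs t ht hst
      have e3 := h.work_sub hst.le
      simp only [inner_sub_right (𝕜 := ℝ)]
      rw [integral_sub (i0 s t) (i1 s t)]
      refine le_trans (le_of_eq ?_) (mul_le_mul_of_nonneg_left (neg_le_abs _) zero_le_two)
      linarith
    · refine ⟨s, s, le_rfl, by simp, ?_⟩
      rw [hst]
      simp
    · refine ⟨t, s, hst.le, Ioo_subset_Ioo htI.1.le hsI.2.le, ?_⟩
      have e1 : ∫ x, (w (x, s) - w (x, t)) * w (x, s)
          = (∫ x, w (x, s) ^ 2) - ∫ x, w (x, t) * w (x, s) := by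
        rw [← integral_sub (h.sq_integrable hs) (h.mul_integrable ht hs)]
        congr 1
        funext x
        ring
      have e2 := h.eq_right t ht s hs hst
      have e3 := h.work_sub hst.le
      simp only [inner_sub_right (𝕜 := ℝ)]
      rw [integral_sub (i0 t s) (i1 t s)]
      refine le_trans (le_of_eq ?_) (mul_le_mul_of_nonneg_left (le_abs_self _) zero_le_two)
      linarith
  obtain ⟨s', t', h1, h2, h3⟩ := hmain
  refine (ENNReal.ofReal_le_ofReal h3).trans ?_
  rw [ENNReal.ofReal_mul zero_le_two, ← Real.enorm_eq_ofReal_abs]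
  simp only [ENNReal.ofReal_ofNat]
  gcongr
  exact key s' t' h1 h2

end EnergyData

end

/-! ### Continuity in time with values in `L²`. -/

section

variable {n : ℕ} {p q a b : ℝ}

namespace EnergyData

variable {w : Space n × ℝ → ℝ} {Z B : Space n × ℝ → Space n} {E : Set ℝ}

lemma mono (h : EnergyData p q a b w Z B E) {E' : Set ℝ} (hE' : E' ⊆ E)
    (hae : ∀ᵐ t ∂(volume.restrict (Ioo a b)), t ∈ E') : EnergyData p q a b w Z B E' :=
  { h with
    ae_mem := hae
    subset := hE'.trans h.subset
    w_slice := fun t ht => h.w_slice t (hE' ht)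
    Z_slice := fun t ht => h.Z_slice t (hE' ht)
    eq_left := fun s hs t ht => h.eq_left s (hE' hs) t (hE' ht)
    eq_right := fun s hs t ht => h.eq_right s (hE' hs) t (hE' ht) }

lemma eLpNorm_slab_rpow (h : EnergyData p q a b w Z B E) (I : Set ℝ) :
    eLpNorm Z (ENNReal.ofReal p) (slab n I) ^ p = ∫⁻ r in I, ∫⁻ x, ‖Z (x, r)‖ₑ ^ p := by
  rw [eLpNorm_ofReal_rpow h.hpq.pos,
    lintegral_prod_symm _ (h.Z_meas.enorm.pow_const p).aemeasurable]

lemma tendsto_eLpNorm_slab (h : EnergyData p q a b w Z B E) (τ : ℝ) :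
    Tendsto (fun d : ℝ => eLpNorm Z (ENNReal.ofReal p) (slab n (Ioo (τ - d) (τ + d)))) (𝓝[>] 0)
      (𝓝 0) := by
  have hfin : ∫⁻ r, ∫⁻ x, ‖Z (x, r)‖ₑ ^ p ≠ ⊤ := by
    have := h.eLpNorm_slab_rpow univ
    rw [Measure.restrict_univ] at this
    rw [← this]
    exact (ENNReal.rpow_lt_top_of_nonneg h.hpq.pos.le
      (h.Z_memLp.mono_measure (slab_le _)).2.ne).ne
  have hvol : Tendsto (fun d : ℝ => volume (Ioo (τ - d) (τ + d))) (𝓝[>] 0) (𝓝 0) := by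
    have : Tendsto (fun d : ℝ => ENNReal.ofReal ((τ + d) - (τ - d))) (𝓝 0) (𝓝 0) := by
      have hc : Continuous fun d : ℝ => ENNReal.ofReal ((τ + d) - (τ - d)) :=
        ENNReal.continuous_ofReal.comp (by fun_prop)
      exact hc.tendsto' 0 0 (by simp)
    simpa only [Real.volume_Ioo] using this.mono_left nhdsWithin_le_nhds
  have h1 := tendsto_setLIntegral_zero hfin hvol
  simp only [← h.eLpNorm_slab_rpow] at h1
  have h2 := (ENNReal.continuous_rpow_const (y := 1 / p)).continuousAt.tendsto.comp h1
  rw [ENNReal.zero_rpow_of_pos (one_div_pos.2 h.hpq.pos)] at h2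
  refine h2.congr fun d => ?_
  simp only [Function.comp]
  rw [← ENNReal.rpow_mul, mul_one_div_cancel h.hpq.pos.ne', ENNReal.rpow_one]

/-- Every interval contains a time at which the slice of `Z` is controlled by the mean value. -/
lemma exists_good_time (h : EnergyData p q a b w Z B E) {α β : ℝ} (hα : a ≤ α) (hαβ : α < β)
    (hβ : β ≤ b) : ∃ s ∈ E, s ∈ Ioo α β ∧ ENNReal.ofReal (β - α) ^ (1 / p) *
      eLpNorm (fun x => Z (x, s)) (ENNReal.ofReal p) volume
        ≤ eLpNorm Z (ENNReal.ofReal p) (slab n (Ioo α β)) := by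
  have hp := h.hpq.pos
  have hm : Measurable fun r => ∫⁻ x, ‖Z (x, r)‖ₑ ^ p :=
    (h.Z_meas.enorm.pow_const p).lintegral_prod_left'
  have hne : (volume : Measure ℝ).restrict (Ioo α β) ≠ 0 := by
    rw [Ne, Measure.restrict_eq_zero, Real.volume_Ioo]
    simpa using hαβ
  have hN : (volume : Measure ℝ).restrict (Ioo α β) {t | ¬ (t ∈ E ∧ t ∈ Ioo α β)} = 0 := by
    have h1 := ae_restrict_of_ae_restrict_of_subset (Ioo_subset_Ioo hα hβ) h.ae_mem
    exact ae_iff.1 (h1.and (ae_restrict_mem measurableSet_Ioo))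
  -- Some point outside a given null set has a value not above the average.
  obtain ⟨s, hs, hle⟩ := exists_notMem_null_le_laverage hne hm.aemeasurable hN
  simp only [mem_ofPred_eq, not_not] at hs
  refine ⟨s, hs.1, hs.2, ?_⟩
  have hpos : ENNReal.ofReal (β - α) ≠ 0 := by simpa using hαβ
  rw [← ENNReal.rpow_le_rpow_iff hp, ENNReal.mul_rpow_of_nonneg _ _ hp.le, ← ENNReal.rpow_mul,
    one_div_mul_cancel hp.ne', ENNReal.rpow_one, eLpNorm_ofReal_rpow hp, h.eLpNorm_slab_rpow]
  rw [laverage_eq, Measure.restrict_apply_univ, Real.volume_Ioo] at hle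
  refine (mul_le_mul_right hle _).trans_eq ?_
  rw [ENNReal.mul_div_cancel hpos ENNReal.ofReal_ne_top]

/-- This is the Cauchy condition at `τ`, endpoints included. With a good reference time `s`, both
terms of `sq_dist_le` are bounded by the norm of `Z` over a short time interval, which is small by
absolute continuity of the integral. -/
lemma exists_uniform_sq_dist_le (h : EnergyData p q a b w Z B E) {c : ℝ}
    (hc : ∀ t ∈ E, total a w B Z t = c) {τ : ℝ} (hτ : τ ∈ Icc a b) {ε : ℝ} (hε : 0 < ε) :
    ∃ d : ℝ, 0 < d ∧ ∃ s ∈ E, ∀ t ∈ E, t ∈ Ioo (τ - d) (τ + d) →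
      ∫ x, (w (x, t) - w (x, s)) ^ 2 ≤ ε := by
  have hlim : Tendsto (fun d : ℝ => (4 * eLpNorm B (ENNReal.ofReal q) volume) *
      eLpNorm Z (ENNReal.ofReal p) (slab n (Ioo (τ - d) (τ + d)))) (𝓝[>] 0) (𝓝 0) := by
    have := ENNReal.Tendsto.const_mul (a := 4 * eLpNorm B (ENNReal.ofReal q) volume)
      (h.tendsto_eLpNorm_slab τ) (Or.inr (ENNReal.mul_ne_top (by simp) h.B_memLp.2.ne))
    simpa only [mul_zero] using this
  obtain ⟨d, hd, hd0⟩ := ((ENNReal.tendsto_nhds_zero.1 hlim (ENNReal.ofReal ε) (by simpa using hε)).and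
    self_mem_nhdsWithin).exists
  have hd0 : 0 < d := hd0
  refine ⟨d, hd0, ?_⟩
  have hαβ : max (τ - d) a < min (τ + d) b := by
    refine max_lt (lt_min (by linarith) (by linarith [hτ.2])) (lt_min (by linarith [hτ.1]) h.hab)
  obtain ⟨s, hsE, hsI, hs⟩ := h.exists_good_time (le_max_right _ _) hαβ (min_le_right _ _)
  refine ⟨s, hsE, fun t htE ht => ?_⟩
  have htI : t ∈ Ioo (max (τ - d) a) (min (τ + d) b) :=
    ⟨max_lt ht.1 (h.subset htE).1, lt_min ht.2 (h.subset htE).2⟩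
  rw [← ENNReal.ofReal_le_ofReal_iff hε.le]
  refine (h.sq_dist_le hc hsE htE hsI htI).trans (le_trans ?_ hd)
  have hmono : eLpNorm Z (ENNReal.ofReal p) (slab n (Ioo (max (τ - d) a) (min (τ + d) b)))
      ≤ eLpNorm Z (ENNReal.ofReal p) (slab n (Ioo (τ - d) (τ + d))) := by
    refine eLpNorm_mono_measure _ ?_
    rw [slab_eq, slab_eq]
    exact Measure.restrict_mono
      (Set.prod_mono le_rfl (Ioo_subset_Ioo (le_max_left _ _) (min_le_left _ _))) le_rfl
  calc _ ≤ 2 * (eLpNorm B (ENNReal.ofReal q) volume *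
        (eLpNorm Z (ENNReal.ofReal p) (slab n (Ioo (τ - d) (τ + d)))
          + eLpNorm Z (ENNReal.ofReal p) (slab n (Ioo (τ - d) (τ + d))))) := by
        gcongr
        exact hs.trans hmono
    _ = _ := by ring

open Classical in
/-- The slices of `w`, as elements of `L²`. -/
def slice (w : Space n × ℝ → ℝ) (t : ℝ) : Lp ℝ 2 (volume : Measure (Space n)) :=
  if h : MemLp (fun x => w (x, t)) 2 volume then h.toLp _ else 0

lemma slice_eq (h : EnergyData p q a b w Z B E) {t : ℝ} (ht : t ∈ E) :
    slice w t = (h.w_slice t ht).toLp _ := dif_pos _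

lemma norm_toLp_sq {X : Type*} [MeasurableSpace X] {μ : Measure X} {f : X → ℝ} (hf : MemLp f 2 μ) :
    ‖hf.toLp f‖ ^ 2 = ∫ x, f x ^ 2 ∂μ := by
  rw [← real_inner_self_eq_norm_sq, L2.inner_def]
  refine integral_congr_ae ?_
  filter_upwards [hf.coeFn_toLp] with x hx
  rw [hx, RCLike.inner_apply, conj_trivial, pow_two]

lemma norm_slice_sub_sq (h : EnergyData p q a b w Z B E) {s t : ℝ} (hs : s ∈ E) (ht : t ∈ E) :
    ‖slice w t - slice w s‖ ^ 2 = ∫ x, (w (x, t) - w (x, s)) ^ 2 := by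
  rw [h.slice_eq hs, h.slice_eq ht, ← MemLp.toLp_sub, norm_toLp_sq]
  rfl

/-- A set of full measure is dense. Good times serve here merely as points of `E` in every interval.
-/
lemma mem_closure (h : EnergyData p q a b w Z B E) : Icc a b ⊆ closure E := by
  intro τ hτ
  rw [Metric.mem_closure_iff]
  intro d hd
  have hαβ : max (τ - d) a < min (τ + d) b := by
    refine max_lt (lt_min (by linarith) (by linarith [hτ.2])) (lt_min (by linarith [hτ.1]) h.hab)
  obtain ⟨s, hsE, hsI, -⟩ := h.exists_good_time (le_max_right _ _) hαβ (min_le_right _ _)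
  refine ⟨s, hsE, ?_⟩
  have h1 := (le_max_left _ _).trans_lt hsI.1
  have h2 := hsI.2.trans_le (min_le_left _ _)
  rw [Real.dist_eq, abs_lt]
  constructor <;> linarith

/-- The energy identity, with the continuity in time of the solution as a map into `L²`. -/
theorem exists_continuous (h : EnergyData p q a b w Z B E) :
    ∃ W : ℝ → Lp ℝ 2 (volume : Measure (Space n)), ContinuousOn W (Icc a b) ∧
      (∀ᵐ t ∂(volume.restrict (Ioo a b)), ⇑(W t) =ᵐ[volume] fun x => w (x, t)) ∧
      ‖W b‖ ^ 2 - ‖W a‖ ^ 2 = - (2 * ∫ z, inner ℝ (B z) (Z z) ∂(slab n (Ioo a b))) := by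
  obtain ⟨c, hc⟩ := h.exists_total_eq
  -- The times are restricted to those at which the total energy equals `c` exactly, so that the
  -- estimates hold at every remaining time.
  have h' : EnergyData p q a b w Z B {t | t ∈ E ∧ total a w B Z t = c} :=
    h.mono (fun t ht => ht.1) (h.ae_mem.and hc)
  set E' := {t | t ∈ E ∧ total a w B Z t = c} with hE'
  have hc' : ∀ t ∈ E', total a w B Z t = c := fun t ht => ht.2
  -- Completeness of `L²` turns the uniform closeness to one slice into a limit at every point of
  -- the closed interval.
  have hlim : ∀ τ ∈ Icc a b, ∃ y, Tendsto (slice w) (𝓝[E'] τ) (𝓝 y) := by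
    intro τ hτ
    have hne : (𝓝[E'] τ).NeBot := mem_closure_iff_nhdsWithin_neBot.1 (h'.mem_closure hτ)
    refine cauchy_map_iff_exists_tendsto.1 (Metric.cauchy_iff.2 ⟨hne.map _, fun ε hε => ?_⟩)
    obtain ⟨d, hd, s, hsE, hs⟩ := h'.exists_uniform_sq_dist_le hc' hτ
      (by positivity : 0 < (ε / 3) ^ 2)
    refine ⟨slice w '' (E' ∩ Ioo (τ - d) (τ + d)), image_mem_map ?_, ?_⟩
    · exact inter_mem self_mem_nhdsWithin (mem_nhdsWithin_of_mem_nhds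
        (Ioo_mem_nhds (by linarith) (by linarith)))
    · have hdist : ∀ t ∈ E' ∩ Ioo (τ - d) (τ + d), dist (slice w t) (slice w s) ≤ ε / 3 := by
        intro t ht
        have := hs t ht.1 ht.2
        rw [← h'.norm_slice_sub_sq hsE ht.1] at this
        rw [dist_eq_norm]
        exact le_of_sq_le_sq this (by positivity)
      rintro _ ⟨t, ht, rfl⟩ _ ⟨r, hr, rfl⟩
      calc _ ≤ dist (slice w t) (slice w s) + dist (slice w r) (slice w s) :=
            dist_triangle_right _ _ _
        _ ≤ ε / 3 + ε / 3 := add_le_add (hdist t ht) (hdist r hr)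
        _ < ε := by linarith
  have hext : ∀ τ ∈ Icc a b, Tendsto (slice w) (𝓝[E'] τ) (𝓝 (extendFrom E' (slice w) τ)) :=
    fun τ hτ => tendsto_extendFrom (hlim τ hτ)
  have heq : ∀ t ∈ E', extendFrom E' (slice w) t = slice w t := by
    intro t ht
    have h1 := (hext t (Ioo_subset_Icc_self (h'.subset ht))).mono_left
      (pure_le_nhdsWithin ht)
    exact tendsto_nhds_unique h1 (tendsto_pure_nhds _ _)
  have hcont : ContinuousOn (extendFrom E' (slice w)) (Icc a b) :=
    continuousOn_extendFrom h'.mem_closure hlim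
  -- Both terms are continuous, so conservation passes from the dense set of times to the endpoints.
  have htot : ∀ τ ∈ Icc a b, ‖extendFrom E' (slice w) τ‖ ^ 2 + 2 * work a B Z τ = c := by
    intro τ hτ
    have hne : (𝓝[E'] τ).NeBot := mem_closure_iff_nhdsWithin_neBot.1 (h'.mem_closure hτ)
    have h1 := ((hext τ hτ).norm.pow 2).add
      (((h.continuous_work.tendsto τ).mono_left nhdsWithin_le_nhds).const_mul 2)
    refine tendsto_nhds_unique h1 (tendsto_const_nhds.congr' ?_)
    filter_upwards [self_mem_nhdsWithin] with t ht
    rw [h'.slice_eq ht, norm_toLp_sq]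
    exact (hc' t ht).symm
  refine ⟨extendFrom E' (slice w), hcont, ?_, ?_⟩
  · filter_upwards [h'.ae_mem] with t ht
    rw [heq t ht, h'.slice_eq ht]
    exact (h'.w_slice t ht).coeFn_toLp
  · have h1 := htot b (right_mem_Icc.2 h.hab.le)
    have h2 := htot a (left_mem_Icc.2 h.hab.le)
    have h3 := h.work_sub h.hab.le
    linarith

end EnergyData

end

/-! ### From the weak equation to the energy identity. -/

section

variable {n : ℕ} {p q a b : ℝ}

lemma ae_slice {X Y : Type*} [MeasurableSpace X] [MeasurableSpace Y] {μ : Measure X} {ν : Measure Y}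
    [SFinite μ] [SFinite ν] {P : X × Y → Prop} (h : ∀ᵐ z ∂(μ.prod ν), P z) :
    ∀ᵐ t ∂ν, ∀ᵐ x ∂μ, P (x, t) := by
  have h' : ∀ᵐ z ∂(ν.prod μ), P z.swap := Measure.measurePreserving_swap.quasiMeasurePreserving.ae h
  exact Measure.ae_ae_of_ae_prod h'

/-- A weak solution of `∂ₜ w = div B` that may be tested with `η² w` is continuous in time, up to
the factor `η`, as a map into `L²`, and satisfies the energy identity. -/
theorem exists_continuous_of_weakEq (hp : 2 < p) (hpq : p.HolderConjugate q) {O : Set (Space n)}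
    (hO : MeasurableSet O) (hOf : volume O < ⊤) (hab : a < b) {w : Space n × ℝ → ℝ}
    {Z B : Space n × ℝ → Space n}
    (hw : MemLp w (ENNReal.ofReal p) (volume.restrict (O ×ˢ Ioo a b)))
    (hZ : MemLp Z (ENNReal.ofReal p) (volume.restrict (O ×ˢ Ioo a b)))
    (hB : MemLp B (ENNReal.ofReal q) (volume.restrict (O ×ˢ Ioo a b)))
    (H : ∀ φ : Space n × ℝ → ℝ, IsTest (O ×ˢ Ioo a b) φ →
      ∫ z in O ×ˢ Ioo a b, (w z * deriv (fun s => φ (z.1, s)) z.2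
        - inner ℝ (B z) (gradient (fun y => φ (y, z.2)) z.1)) = 0)
    {η : Space n → ℝ} (hη : Continuous η) {C : ℝ} (hηC : ∀ x, ‖η x‖ ≤ C)
    (hsl : ∀ᵐ t ∂(volume.restrict (Ioo a b)),
      IsW01p p O (fun x => η x ^ 2 * w (x, t)) (fun x => Z (x, t))) :
    ∃ W : ℝ → Lp ℝ 2 (volume : Measure (Space n)), ContinuousOn W (Icc a b) ∧
      (∀ᵐ t ∂(volume.restrict (Ioo a b)),
        ⇑(W t) =ᵐ[volume] O.indicator fun x => η x * w (x, t)) ∧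
      ‖W b‖ ^ 2 - ‖W a‖ ^ 2 = - (2 * ∫ z in O ×ˢ Ioo a b, inner ℝ (B z) (Z z)) := by
  have hp0 : 0 < p := by linarith
  have hC0 : 0 ≤ C := (norm_nonneg _).trans (hηC 0)
  have hQ : MeasurableSet (O ×ˢ Ioo a b) := hO.prod measurableSet_Ioo
  have hfinO : IsFiniteMeasure ((volume : Measure (Space n)).restrict O) := ⟨by simpa using hOf⟩
  have hfinQ : IsFiniteMeasure ((volume : Measure (Space n × ℝ)).restrict (O ×ˢ Ioo a b)) := by
    rw [volume_restrict_prod]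
    infer_instance
  have h2p : (2 : ENNReal) ≤ ENNReal.ofReal p := by
    simpa using ENNReal.ofReal_le_ofReal hp.le
  have hqp : ENNReal.ofReal q ≤ ENNReal.ofReal p := by
    refine ENNReal.ofReal_le_ofReal ?_
    have h1 := hpq.symm.sub_one_mul_conj
    have h2 := hpq.lt
    have h3 := hpq.symm.lt
    nlinarith
  obtain ⟨E₀, hE₀, hid⟩ := exists_slice_identity hpq hOf hab (hw.mono_exponent hqp) hB H
  obtain ⟨wm, hwm, ew⟩ := hw.1
  obtain ⟨Zm, hZm, eZ⟩ := hZ.1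
  obtain ⟨Bm, hBm, eB⟩ := hB.1
  -- Zero extensions of measurable representatives. The set `E` below collects the times at which
  -- they agree with the given slices and these slices have all the properties needed.
  set w' : Space n × ℝ → ℝ := (O ×ˢ Ioo a b).indicator fun z => η z.1 * wm z with hw'
  set Z' : Space n × ℝ → Space n := (O ×ˢ Ioo a b).indicator Zm with hZ'
  set B' : Space n × ℝ → Space n := (O ×ˢ Ioo a b).indicator Bm with hB'
  have hsm : StronglyMeasurable fun z : Space n × ℝ => η z.1 * wm z :=
    (hη.comp continuous_fst).stronglyMeasurable.mul hwm
  have hwmk : MemLp (fun z : Space n × ℝ => η z.1 * wm z) (ENNReal.ofReal p)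
      (volume.restrict (O ×ˢ Ioo a b)) := by
    refine (hw.ae_eq ew).of_le_mul (c := C) hsm.aestronglyMeasurable (Eventually.of_forall fun z => ?_)
    rw [norm_mul]
    gcongr
    exact hηC _
  have ew' := ew
  have eZ' := eZ
  have hw1 := hw
  have hZ1 := hZ
  rw [volume_restrict_prod] at ew' eZ' hw1 hZ1
  set E : Set ℝ := {t | t ∈ Ioo a b ∧ t ∈ E₀ ∧
    (∀ᵐ x ∂(volume.restrict O), w (x, t) = wm (x, t)) ∧
    (∀ᵐ x ∂(volume.restrict O), Z (x, t) = Zm (x, t)) ∧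
    MemLp (fun x => w (x, t)) (ENNReal.ofReal p) (volume.restrict O) ∧
    MemLp (fun x => Z (x, t)) (ENNReal.ofReal p) (volume.restrict O) ∧
    IsW01p p O (fun x => η x ^ 2 * w (x, t)) (fun x => Z (x, t))} with hE
  have hw's : ∀ t ∈ E, (fun x => w' (x, t)) =ᵐ[volume] O.indicator fun x => η x * w (x, t) := by
    rintro t ⟨ht, -, h1, -⟩
    rw [ae_restrict_iff' hO] at h1
    filter_upwards [h1] with x hx
    by_cases hxO : x ∈ O
    · have : (x, t) ∈ O ×ˢ Ioo a b := ⟨hxO, ht⟩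
      rw [hw', indicator_of_mem this, indicator_of_mem hxO, hx hxO]
    · have : (x, t) ∉ O ×ˢ Ioo a b := fun h => hxO h.1
      rw [hw', indicator_of_notMem this, indicator_of_notMem hxO]
  have hZ's : ∀ t ∈ E, (fun x => Z' (x, t)) =ᵐ[volume] O.indicator fun x => Z (x, t) := by
    rintro t ⟨ht, -, -, h1, -⟩
    rw [ae_restrict_iff' hO] at h1
    filter_upwards [h1] with x hx
    by_cases hxO : x ∈ O
    · have : (x, t) ∈ O ×ˢ Ioo a b := ⟨hxO, ht⟩
      rw [hZ', indicator_of_mem this, indicator_of_mem hxO, hx hxO]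
    · have : (x, t) ∉ O ×ˢ Ioo a b := fun h => hxO h.1
      rw [hZ', indicator_of_notMem this, indicator_of_notMem hxO]
  have hηw : ∀ t ∈ E, MemLp (fun x => η x * w (x, t)) (ENNReal.ofReal p) (volume.restrict O) := by
    rintro t ⟨-, -, -, -, h1, -⟩
    refine h1.of_le_mul (c := C) (hη.aestronglyMeasurable.mul h1.1) (Eventually.of_forall fun x => ?_)
    rw [norm_mul]
    gcongr
    exact hηC _
  have hη2w : ∀ t ∈ E, MemLp (fun x => η x ^ 2 * w (x, t)) (ENNReal.ofReal p)
      (volume.restrict O) := by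
    intro t ht
    refine (hηw t ht).of_le_mul (c := C)
      ((hη.pow 2).aestronglyMeasurable.mul ht.2.2.2.2.1.1) (Eventually.of_forall fun x => ?_)
    rw [pow_two, mul_assoc, norm_mul]
    gcongr
    exact hηC _
  have htest : ∀ s ∈ E, ∀ t ∈ E, s < t → ∀ τ ∈ E, ∫ x, (w' (x, t) - w' (x, s)) * w' (x, τ)
      = - ∫ z, inner ℝ (B' z) (Z' (z.1, τ)) ∂((volume : Measure (Space n)).prod
      (volume.restrict (Ioo s t))) := by
    intro s hs t ht hst τ hτ
    -- One factor `η` moves from the difference to the other side: `η (w(t) - w(s)) · η w(τ) = (w(t)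
    -- - w(s)) · η² w(τ)`. This makes `η² w(τ)` the test function.
    have e1 : ∫ x, (w' (x, t) - w' (x, s)) * w' (x, τ)
        = ∫ x in O, (w (x, t) - w (x, s)) * (η x ^ 2 * w (x, τ)) := by
      rw [← integral_indicator hO]
      refine integral_congr_ae ?_
      filter_upwards [hw's s hs, hw's t ht, hw's τ hτ] with x h1 h2 h3
      rw [h1, h2, h3]
      by_cases hx : x ∈ O
      · simp only [indicator_of_mem hx]
        ring
      · simp only [indicator_of_notMem hx]
        ring
    rw [e1, hid s hs.2.1 t ht.2.1 hst _ _ hτ.2.2.2.2.2.2 (hη2w τ hτ) hτ.2.2.2.2.2.1]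
    congr 1
    have hsub : Ioo s t ⊆ Ioo a b := Ioo_subset_Ioo hs.1.1.le ht.1.2.le
    have e2 : (volume : Measure (Space n)).prod (volume.restrict (Ioo s t))
        = volume.restrict (univ ×ˢ Ioo s t) := EnergyData.slab_eq _
    have hBst := ae_restrict_of_ae_restrict_of_subset (Set.prod_mono le_rfl hsub) eB
    have hZst : ∀ᵐ z ∂((volume : Measure (Space n × ℝ)).restrict (univ ×ˢ Ioo s t)),
        Z' (z.1, τ) = O.indicator (fun x => Z (x, τ)) z.1 := by
      rw [← e2]
      exact Measure.quasiMeasurePreserving_fst.ae (hZ's τ hτ)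
    rw [e2, ← integral_indicator (hO.prod measurableSet_Ioo),
      ← integral_indicator (MeasurableSet.univ.prod measurableSet_Ioo)]
    refine integral_congr_ae ?_
    rw [ae_restrict_iff' (hO.prod measurableSet_Ioo)] at hBst
    rw [ae_restrict_iff' (MeasurableSet.univ.prod measurableSet_Ioo)] at hZst
    filter_upwards [hBst, hZst] with z h1 h2
    by_cases hz : z ∈ O ×ˢ Ioo s t
    · have hz1 : z ∈ (univ : Set (Space n)) ×ˢ Ioo s t := ⟨mem_univ _, hz.2⟩
      have hz2 : z ∈ O ×ˢ Ioo a b := ⟨hz.1, hsub hz.2⟩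
      rw [indicator_of_mem hz, indicator_of_mem hz1, h2 hz1, indicator_of_mem hz.1, hB',
        indicator_of_mem hz2, h1 hz]
    · rw [indicator_of_notMem hz]
      by_cases hz1 : z ∈ (univ : Set (Space n)) ×ˢ Ioo s t
      · have hzO : z.1 ∉ O := fun h => hz ⟨h, hz1.2⟩
        rw [indicator_of_mem hz1, h2 hz1, indicator_of_notMem hzO, inner_zero_right]
      · rw [indicator_of_notMem hz1]
  have hdata : EnergyData p q a b w' Z' B' E :=
    { hpq := hpq
      hab := hab
      w_meas := hsm.indicator hQ
      Z_meas := hZm.indicator hQ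
      B_meas := hBm.indicator hQ
      w_memLp := (memLp_indicator_iff_restrict hQ).2 (hwmk.mono_exponent h2p)
      Z_memLp := (memLp_indicator_iff_restrict hQ).2 (hZ.ae_eq eZ)
      B_memLp := (memLp_indicator_iff_restrict hQ).2 (hB.ae_eq eB)
      ae_mem := by
        filter_upwards [ae_restrict_mem measurableSet_Ioo, hE₀, ae_slice ew', ae_slice eZ',
          memLp_slice hp0 hw1, memLp_slice hp0 hZ1, hsl] with t h1 h2 h3 h4 h5 h6 h7
        exact ⟨h1, h2, h3, h4, h5, h6, h7⟩
      subset := fun t ht => ht.1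
      w_slice := fun t ht => ((memLp_indicator_iff_restrict hO).2
        ((hηw t ht).mono_exponent h2p)).ae_eq (hw's t ht).symm
      Z_slice := fun t ht => ((memLp_indicator_iff_restrict hO).2
        ht.2.2.2.2.2.1).ae_eq (hZ's t ht).symm
      eq_left := fun s hs t ht hst => htest s hs t ht hst s hs
      eq_right := fun s hs t ht hst => htest s hs t ht hst t ht }
  obtain ⟨W, hW1, hW2, hW3⟩ := hdata.exists_continuous
  refine ⟨W, hW1, ?_, ?_⟩
  · filter_upwards [hW2, hdata.ae_mem] with t h1 h2
    exact h1.trans (hw's t h2)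
  · rw [hW3, EnergyData.slab_eq, ← integral_indicator hQ,
      ← integral_indicator (MeasurableSet.univ.prod measurableSet_Ioo)]
    congr 2
    refine integral_congr_ae ?_
    rw [Filter.EventuallyEq, ae_restrict_iff' hQ] at eB eZ
    filter_upwards [eB, eZ] with z h1 h2
    by_cases hz : z ∈ O ×ˢ Ioo a b
    · have hz1 : z ∈ (univ : Set (Space n)) ×ˢ Ioo a b := ⟨mem_univ _, hz.2⟩
      rw [indicator_of_mem hz, indicator_of_mem hz1, hB', hZ', indicator_of_mem hz,
        indicator_of_mem hz, h1 hz, h2 hz]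
    · rw [indicator_of_notMem hz, indicator_apply, hB', indicator_of_notMem hz, inner_zero_left,
        ite_self]

end

section

variable {n : ℕ} {p q : ℝ}

/-! ### Integrability of the nonlinear terms -/

lemma memLp_norm_rpow_sub_one {X E : Type*} [MeasurableSpace X] [NormedAddCommGroup E]
    {μ : Measure X} (hpq : p.HolderConjugate q) {f : X → E} (hf : MemLp f (ENNReal.ofReal p) μ) :
    MemLp (fun x => ‖f x‖ ^ (p - 1)) (ENNReal.ofReal q) μ := by
  have h := hf.norm_rpow_div (ENNReal.ofReal (p - 1))
  have h1 : 0 < p - 1 := by linarith [hpq.lt]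
  rw [ENNReal.toReal_ofReal h1.le, ← ENNReal.ofReal_div_of_pos h1] at h
  rwa [hpq.conjugate_eq]

lemma memLp_gradF0 {X : Type*} [MeasurableSpace X] {μ : Measure X} (hp : 2 < p)
    (hpq : p.HolderConjugate q) {δ : Fin n → ℝ} (hδ : ∀ i, 0 ≤ δ i) {f : X → Space n}
    (hf : MemLp f (ENNReal.ofReal p) μ) :
    MemLp (fun x => gradF0 p δ (f x)) (ENNReal.ofReal q) μ := by
  have hb : ∀ x, ‖gradF0 p δ (f x)‖ ≤ (n : ℝ) * ‖‖f x‖ ^ (p - 1)‖ := fun x => by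
    rw [Real.norm_of_nonneg (Real.rpow_nonneg (norm_nonneg (f x)) (p - 1))]
    exact norm_gradF0_le hp hδ _
  have hm : AEStronglyMeasurable (fun x => gradF0 p δ (f x)) μ :=
    (continuous_gradF0 (δ := δ) hp).comp_aestronglyMeasurable hf.1
  exact (memLp_norm_rpow_sub_one hpq hf).of_le_mul hm (Eventually.of_forall hb)

lemma memLp_gradG {X : Type*} [MeasurableSpace X] {μ : Measure X} [IsFiniteMeasure μ] (hp : 2 < p)
    (hpq : p.HolderConjugate q) {f : X → Space n} (hf : MemLp f (ENNReal.ofReal p) μ) :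
    MemLp (fun x => gradG p (f x)) (ENNReal.ofReal q) μ := by
  have h0 : MemLp (fun _ : X => (1 : ℝ)) (ENNReal.ofReal p) μ := memLp_const 1
  have h1 : MemLp (fun x => 1 + ‖f x‖) (ENNReal.ofReal p) μ := h0.add hf.norm
  refine (memLp_norm_rpow_sub_one hpq h1).of_le_mul (c := 1)
    (continuous_gradG.comp_aestronglyMeasurable hf.1) (Eventually.of_forall fun x => ?_)
  rw [Real.norm_of_nonneg (by positivity), Real.norm_of_nonneg (by positivity), one_mul]
  exact norm_gradG_le hp _

lemma memLp_H {X : Type*} [MeasurableSpace X] {μ : Measure X} (hp : 2 < p) {lam : ℝ}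
    (hl : 0 ≤ lam) {f : X → Space n} (hf : MemLp f (ENNReal.ofReal p) μ) (i : Fin n) :
    MemLp (fun x => H p lam (f x i)) 2 μ := by
  have h := hf.norm_rpow_div (ENNReal.ofReal (p / 2))
  have h1 : 0 < p / 2 := by linarith
  rw [ENNReal.toReal_ofReal h1.le, ← ENNReal.ofReal_div_of_pos h1,
    show p / (p / 2) = 2 by field_simp] at h
  simp only [ENNReal.ofReal_ofNat] at h
  have hc : Continuous fun ξ : Space n => H p lam (ξ i) := by
    simp only [H_eq_oddPow hp hl]
    exact (continuous_oddPow h1.le lam).comp (EuclideanSpace.proj i).continuous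
  refine h.of_le_mul (c := 1) (hc.comp_aestronglyMeasurable hf.1) (Eventually.of_forall fun x => ?_)
  rw [one_mul, Real.norm_of_nonneg (by positivity : 0 ≤ ‖f x‖ ^ (p / 2)), Real.norm_eq_abs]
  refine (abs_H_le hp hl _).trans (Real.rpow_le_rpow (abs_nonneg _) ?_ h1.le)
  exact PiLp.norm_apply_le (f x) i

lemma integrable_norm_rpow_of_memLp {X E : Type*} [MeasurableSpace X] [NormedAddCommGroup E]
    {μ : Measure X} (hp : 0 < p) {f : X → E} (hf : MemLp f (ENNReal.ofReal p) μ) :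
    Integrable (fun x => ‖f x‖ ^ p) μ := by
  have := hf.integrable_norm_rpow (by simpa using hp) ENNReal.ofReal_ne_top
  rwa [ENNReal.toReal_ofReal hp.le] at this

/-! ### Test functions in space-time -/

/-- Expressing the partial derivatives of a test function through `fderiv` makes their continuity
and compact support available. -/
lemma deriv_snd_eq {φ : Space n × ℝ → ℝ} (hφ : ContDiff ℝ ∞ φ) (z : Space n × ℝ) :
    deriv (fun s => φ (z.1, s)) z.2 = fderiv ℝ φ z (0, 1) := by
  have h1 : HasFDerivAt φ (fderiv ℝ φ z) (z.1, z.2) :=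
    (hφ.differentiable (by simp) z).hasFDerivAt
  have h2 : HasDerivAt (fun s : ℝ => (z.1, s)) (0, 1) z.2 :=
    (hasDerivAt_const _ _).prodMk (hasDerivAt_id _)
  exact (h1.comp_hasDerivAt z.2 h2).deriv

lemma gradient_fst_eq {φ : Space n × ℝ → ℝ} (hφ : ContDiff ℝ ∞ φ) (z : Space n × ℝ) :
    gradient (fun y => φ (y, z.2)) z.1 = (InnerProductSpace.toDual ℝ (Space n)).symm
      ((fderiv ℝ φ z).comp (ContinuousLinearMap.inl ℝ (Space n) ℝ)) := by
  have h1 : HasFDerivAt φ (fderiv ℝ φ z) (z.1, z.2) :=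
    (hφ.differentiable (by simp) z).hasFDerivAt
  have h3 : HasFDerivAt (fun y => φ (y, z.2)) _ z.1 := h1.comp z.1 (hasFDerivAt_prodMk_left z.1 z.2)
  rw [gradient, h3.fderiv]

lemma weakEq_integrand_eq_zero {A : Set (Space n × ℝ)} {φ : Space n × ℝ → ℝ} (hφ : IsTest A φ)
    {z : Space n × ℝ} (hz : z ∉ A) (r : ℝ) (ξ : Space n) :
    r * deriv (fun s => φ (z.1, s)) z.2 - inner ℝ ξ (gradient (fun y => φ (y, z.2)) z.1) = 0 := by
  have h0 : fderiv ℝ φ z = 0 := by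
    by_contra h
    exact hz (hφ.2.2 (support_fderiv_subset ℝ h))
  rw [deriv_snd_eq hφ.1, gradient_fst_eq hφ.1, h0]
  simp

lemma memLp_deriv_snd {A : Set (Space n × ℝ)} {φ : Space n × ℝ → ℝ} (hφ : IsTest A φ)
    (P : ENNReal) (μ : Measure (Space n × ℝ)) [IsFiniteMeasureOnCompacts μ] :
    MemLp (fun z : Space n × ℝ => deriv (fun s => φ (z.1, s)) z.2) P μ := by
  simp only [deriv_snd_eq hφ.1]
  have hc : Continuous (fderiv ℝ φ) := hφ.1.continuous_fderiv (by simp)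
  exact (hc.clm_apply continuous_const).memLp_of_hasCompactSupport
    ((hφ.2.1.fderiv ℝ).comp_left (g := fun L : Space n × ℝ →L[ℝ] ℝ => L (0, 1)) (by simp))

lemma memLp_gradient_fst {A : Set (Space n × ℝ)} {φ : Space n × ℝ → ℝ} (hφ : IsTest A φ)
    (P : ENNReal) (μ : Measure (Space n × ℝ)) [IsFiniteMeasureOnCompacts μ] :
    MemLp (fun z : Space n × ℝ => gradient (fun y => φ (y, z.2)) z.1) P μ := by
  simp only [gradient_fst_eq hφ.1]
  have hc : Continuous (fderiv ℝ φ) := hφ.1.continuous_fderiv (by simp)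
  refine Continuous.memLp_of_hasCompactSupport ?_ ((hφ.2.1.fderiv ℝ).comp_left
    (g := fun L : Space n × ℝ →L[ℝ] ℝ => (InnerProductSpace.toDual ℝ (Space n)).symm
      (L.comp (ContinuousLinearMap.inl ℝ (Space n) ℝ))) (by simp))
  exact (LinearIsometryEquiv.continuous _).comp (hc.clm_comp continuous_const)

lemma integrable_weakEq_integrand (hpq : p.HolderConjugate q) {Q : Set (Space n × ℝ)}
    {A : Set (Space n × ℝ)} {φ : Space n × ℝ → ℝ} (hφ : IsTest A φ) {u : Space n × ℝ → ℝ}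
    {B : Space n × ℝ → Space n} (hu : MemLp u (ENNReal.ofReal p) (volume.restrict Q))
    (hB : MemLp B (ENNReal.ofReal q) (volume.restrict Q)) :
    Integrable (fun z : Space n × ℝ => u z * deriv (fun s => φ (z.1, s)) z.2
      - inner ℝ (B z) (gradient (fun y => φ (y, z.2)) z.1)) (volume.restrict Q) := by
  refine Integrable.sub ?_ (integrable_inner_of_memLp hpq hB (memLp_gradient_fst hφ _ _))
  have := integrable_inner_of_memLp hpq.symm hu (memLp_deriv_snd hφ (ENNReal.ofReal q)
    (volume.restrict Q))
  refine this.congr (Eventually.of_forall fun z => ?_)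
  simp [mul_comm]

/-- A test function on the smaller cylinder is one on the larger, and the integrand vanishes off its
support. -/
lemma WeakEq.mono {F : Space n → ℝ} {Ω Ω' : Set (Space n)} {I J : Set ℝ} {u : Space n × ℝ → ℝ}
    {Du : Space n × ℝ → Space n} (h : WeakEq F Ω I u Du) (hΩ : Ω' ⊆ Ω) (hJ : J ⊆ I)
    (hm : MeasurableSet (Ω ×ˢ I)) : WeakEq F Ω' J u Du := by
  intro φ hφ
  have hsub : Ω' ×ˢ J ⊆ Ω ×ˢ I := Set.prod_mono hΩ hJ
  rw [← h φ ⟨hφ.1, hφ.2.1, hφ.2.2.trans hsub⟩]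
  exact (setIntegral_eq_of_subset_of_forall_sdiff_eq_zero hm hsub fun z hz =>
    weakEq_integrand_eq_zero hφ hz.2 _ _).symm

/-- The intermediate open set forces the support of the smooth Urysohn function, and not just its
set of nonzero values, into `O`. -/
lemma exists_cutoff {K O : Set (Space n)} (hK : IsClosed K) (hO : IsOpen O) (hKO : K ⊆ O)
    (hOc : IsCompact (closure O)) : ∃ η : Space n → ℝ, IsTest O η ∧ ∀ x ∈ K, η x = 1 := by
  obtain ⟨O', hO', hKO', hO'O⟩ := normal_exists_closure_subset hK hO hKO
  obtain ⟨f, h1, h2, -⟩ := exists_contMDiffMap_zero_one_of_isClosed (n := (⊤ : ℕ∞))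
    (modelWithCornersSelf ℝ (Space n)) hO'.isClosed_compl hK
    (disjoint_left.2 fun x hx hxK => hx (hKO' hxK))
  have hs : tsupport f ⊆ closure O' := by
    refine closure_mono fun x hx => ?_
    by_contra h
    exact hx (h1 h)
  refine ⟨f, ⟨f.contMDiff.contDiff, ?_, hs.trans hO'O⟩, fun x hx => h2 hx⟩
  exact HasCompactSupport.of_support_subset_isCompact hOc
    ((subset_tsupport _).trans (hs.trans (hO'O.trans subset_closure)))

end

section

variable {n : ℕ} {p q : ℝ}

/-! ### Continuity in time and the energy estimate -/

lemma IsContRep.of_ae_eq {O : Set (Space n)} {a b : ℝ} {f : Space n × ℝ → ℝ}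
    {W : ℝ → Lp ℝ 2 (volume : Measure (Space n))} (hW : ContinuousOn W (Icc a b))
    (h : ∀ᵐ t ∂(volume.restrict (Ioo a b)), ⇑(W t) =ᵐ[volume.restrict O] fun x => f (x, t)) :
    IsContRep O a b f fun t => LpToLpRestrictCLM (Space n) ℝ ℝ volume 2 O (W t) where
  continuousOn := (LpToLpRestrictCLM (Space n) ℝ ℝ volume 2 O).continuous.comp_continuousOn hW
  ae_eq := by
    filter_upwards [h] with t ht
    exact (LpToLpRestrictCLM_coeFn ℝ O (W t)).trans ht

lemma IsContRep.add {O : Set (Space n)} {a b : ℝ} {f g : Space n × ℝ → ℝ}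
    {F G : ℝ → Lp ℝ 2 (volume.restrict O)} (hF : IsContRep O a b f F) (hG : IsContRep O a b g G) :
    IsContRep O a b (fun z => f z + g z) fun t => F t + G t where
  continuousOn := hF.continuousOn.add hG.continuousOn
  ae_eq := by
    filter_upwards [hF.ae_eq, hG.ae_eq] with t h1 h2
    filter_upwards [Lp.coeFn_add (F t) (G t), h1, h2] with x h3 h4 h5
    rw [h3, Pi.add_apply, h4, h5]

/-- Local weak solutions are continuous in time with values in `L²_loc`. -/
lemma IsLocalWeakSol.exists_isContRep (hp : 2 < p) (hpq : p.HolderConjugate q) {δ : Fin n → ℝ}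
    (hδ : ∀ i, 0 ≤ δ i) {Ω Ω' : Set (Space n)} (hΩ : IsOpen Ω) (hΩ' : IsCompact (closure Ω'))
    (hsub : closure Ω' ⊆ Ω) {T₀ T₁ a b : ℝ} (ha : T₀ < a) (hab : a < b) (hb : b < T₁)
    {u : Space n × ℝ → ℝ} {Du : Space n × ℝ → Space n}
    (hu : IsLocalWeakSol p δ Ω (Ioo T₀ T₁) u Du) : ∃ U, IsContRep Ω' a b u U := by
  have hp1 : 1 ≤ p := by linarith
  -- An intermediate domain leaves room for a cut-off that equals `1` on the closure of `Ω'`, where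
  -- `η u = u`.
  obtain ⟨O, hO, hΩO, hOΩ, hOc⟩ := exists_open_between_and_isCompact_closure hΩ' hΩ hsub
  have hmem := hu.memLoc O hO hOc hOΩ a b hab (Icc_subset_Ioo ha hb)
  obtain ⟨η, hη, hη1⟩ := exists_cutoff isClosed_closure hO hΩO hOc
  have hη2 : IsTest O fun x => η x ^ 2 := by
    simpa only [pow_two] using hη.mul_left hη.1
  have hη2c : ContDiff ℝ 1 fun x => η x ^ 2 := hη2.1.of_le (by exact_mod_cast le_top)
  obtain ⟨C, hC⟩ := hη.2.1.exists_bound_of_continuous hη.1.continuous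
  obtain ⟨C2, hC2⟩ := hη2.2.1.exists_bound_of_continuous hη2.1.continuous
  obtain ⟨C3, hC3⟩ := (hasCompactSupport_gradient hη2.2.1).exists_bound_of_continuous
    (continuous_gradient hη2c)
  have m1 : MemLp (fun z : Space n × ℝ => η z.1 ^ 2 • Du z) (ENNReal.ofReal p)
      (volume.restrict (O ×ˢ Ioo a b)) := by
    refine hmem.memLp_grad.of_le_mul (c := C2)
      ((hη2.1.continuous.comp continuous_fst).aestronglyMeasurable.smul hmem.memLp_grad.1)
      (Eventually.of_forall fun z => ?_)
    rw [norm_smul]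
    gcongr
    exact hC2 _
  have m2 : MemLp (fun z : Space n × ℝ => u z • gradient (fun x => η x ^ 2) z.1) (ENNReal.ofReal p)
      (volume.restrict (O ×ˢ Ioo a b)) := by
    refine hmem.memLp.of_le_mul (c := C3) (hmem.memLp.1.smul
      ((continuous_gradient hη2c).comp continuous_fst).aestronglyMeasurable)
      (Eventually.of_forall fun z => ?_)
    rw [norm_smul, mul_comm]
    gcongr
    exact hC3 _
  have hB := memLp_gradF0 hp hpq hδ hmem.memLp_grad
  have hweak := hu.weakEq.mono (subset_closure.trans hOΩ)
    ((Ioo_subset_Ioo ha.le hb.le) : Ioo a b ⊆ Ioo T₀ T₁)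
    (hΩ.measurableSet.prod measurableSet_Ioo)
  have hOf : volume O < ⊤ := (measure_mono subset_closure).trans_lt hOc.measure_lt_top
  have hs1 := hmem.memLp
  have hs2 := hmem.memLp_grad
  rw [volume_restrict_prod] at hs1 hs2
  obtain ⟨W, hW1, hW2, -⟩ := exists_continuous_of_weakEq hp hpq hO.measurableSet hOf hab hmem.memLp
    (m1.add m2) hB (fun φ hφ => by simpa only [gradient_F0 hp hδ] using hweak φ hφ)
    hη.1.continuous hC (by
      filter_upwards [hmem.weakGrad, memLp_slice hpq.pos hs1, memLp_slice hpq.pos hs2]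
        with t h1 h2 h3
      exact isW01p_mul_test hp1 hO h2 h3 h1 hη2)
  refine ⟨_, IsContRep.of_ae_eq hW1 ?_⟩
  filter_upwards [hW2] with t ht
  refine ae_restrict_of_ae_restrict_of_subset subset_closure ?_
  rw [ae_restrict_iff' isClosed_closure.measurableSet]
  filter_upwards [ht] with x hx hxm
  rw [hx, indicator_of_mem (hΩO hxm), hη1 x hxm, one_mul]

/-- Every right neighbourhood of `a` has positive measure, so limits along this filter are unique
and the initial condition determines the value at `a`. -/
lemma neBot_nhdsGT_inf_ae (a : ℝ) : (𝓝[>] a ⊓ ae (volume : Measure ℝ)).NeBot := by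
  rw [Filter.inf_neBot_iff]
  intro s hs t ht
  obtain ⟨c, hc, hcs⟩ := mem_nhdsGT_iff_exists_Ioo_subset.1 hs
  by_contra h
  have h1 : Ioo a c ⊆ tᶜ := fun x hx hxt => h ⟨x, hcs hx, hxt⟩
  have h2 := measure_mono_null h1 (mem_ae_iff.1 ht)
  rw [Real.volume_Ioo, ENNReal.ofReal_eq_zero, sub_nonpos] at h2
  exact absurd hc (not_lt.2 h2)

/-- The energy identity for the difference of the two solutions. -/
lemma IsCauchyDirichletSol.exists_energy_identity (hp : 2 < p) (hpq : p.HolderConjugate q)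
    {δ : Fin n → ℝ} (hδ : ∀ i, 0 ≤ δ i) {Ω Ω' : Set (Space n)} (hΩ : IsOpen Ω) (hΩo : IsOpen Ω')
    (hΩ' : IsCompact (closure Ω')) (hsub : closure Ω' ⊆ Ω) {T₀ T₁ a b : ℝ} (ha : T₀ < a)
    (hab : a < b) (hb : b < T₁) {u : Space n × ℝ → ℝ} {Du : Space n × ℝ → Space n}
    (hu : IsLocalWeakSol p δ Ω (Ioo T₀ T₁) u Du) {ε : ℝ} {v : Space n × ℝ → ℝ}
    {Dv : Space n × ℝ → Space n} (hv : IsCauchyDirichletSol p δ ε Ω' a b u Du v Dv) :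
    ∃ W : ℝ → Lp ℝ 2 (volume : Measure (Space n)), ContinuousOn W (Icc a b) ∧
      (∀ᵐ t ∂(volume.restrict (Ioo a b)),
        ⇑(W t) =ᵐ[volume] Ω'.indicator fun x => v (x, t) - u (x, t)) ∧
      ‖W b‖ ^ 2 = - (2 * ∫ z in Ω' ×ˢ Ioo a b,
        inner ℝ ((gradF0 p δ (Dv z) + ε • gradG p (Dv z)) - gradF0 p δ (Du z)) (Dv z - Du z)) := by
  have hp1 : 1 ≤ p := by linarith
  have hmem := hu.memLoc Ω' hΩo hΩ' hsub a b hab (Icc_subset_Ioo ha hb)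
  have hOf : volume Ω' < ⊤ := (measure_mono subset_closure).trans_lt hΩ'.measure_lt_top
  have hfinO : IsFiniteMeasure ((volume : Measure (Space n)).restrict Ω') := ⟨by simpa using hOf⟩
  have hfinQ : IsFiniteMeasure ((volume : Measure (Space n × ℝ)).restrict (Ω' ×ˢ Ioo a b)) := by
    rw [volume_restrict_prod]
    infer_instance
  have hBu := memLp_gradF0 hp hpq hδ hmem.memLp_grad
  have hBv := (memLp_gradF0 hp hpq hδ hv.mem.memLp_grad).add
    ((memLp_gradG hp hpq hv.mem.memLp_grad).const_smul ε)
  have hweak := hu.weakEq.mono (subset_closure.trans hsub)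
    ((Ioo_subset_Ioo ha.le hb.le) : Ioo a b ⊆ Ioo T₀ T₁)
    (hΩ.measurableSet.prod measurableSet_Ioo)
  -- The lateral condition makes the slices of `v - u` themselves admissible, so the cut-off is `η =
  -- 1`.
  obtain ⟨W, hW1, hW2, hW3⟩ := exists_continuous_of_weakEq hp hpq hΩo.measurableSet hOf hab
    (w := fun z => v z - u z) (Z := fun z => Dv z - Du z)
    (B := fun z => (gradF0 p δ (Dv z) + ε • gradG p (Dv z)) - gradF0 p δ (Du z))
    hv.lateral.memLp hv.lateral.memLp_grad (hBv.sub hBu)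
    (fun φ hφ => by
      have h1 := hv.weakEq φ hφ
      have h2 := hweak φ hφ
      simp only [gradient_F0 hp hδ] at h2
      simp only [gradient_Feps hp hδ] at h1
      have i1 := integrable_weakEq_integrand hpq hφ hv.mem.memLp hBv
      have i2 := integrable_weakEq_integrand hpq hφ hmem.memLp hBu
      have h3 := integral_sub i1 i2
      simp only [Pi.add_apply, Pi.smul_apply] at h3
      rw [h1, h2, sub_self] at h3
      rw [← h3]
      refine integral_congr_ae (Eventually.of_forall fun z => ?_)
      simp only [inner_sub_left (𝕜 := ℝ)]
      ring)
    (continuous_const (y := (1 : ℝ))) (C := 1) (by simp)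
    (by simpa only [one_pow, one_mul] using hv.lateral.slice_zero)
  simp only [one_mul] at hW2
  refine ⟨W, hW1, hW2, ?_⟩
  -- The norm of `W t` tends to that of `W a` by continuity and, for almost every `t`, equals the
  -- quantity that the initial condition sends to zero.
  have hWa : W a = 0 := by
    have hne := neBot_nhdsGT_inf_ae a
    have h1 : Tendsto (fun t => ‖W t‖ₑ) (𝓝[>] a ⊓ ae volume) (𝓝 ‖W a‖ₑ) := by
      have h2 : Tendsto W (𝓝[>] a) (𝓝 (W a)) :=
        ((hW1 a (left_mem_Icc.2 hab.le)).mono_of_mem_nhdsWithin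
          (mem_of_superset (Ioo_mem_nhdsGT hab) Ioo_subset_Icc_self))
      exact (h2.mono_left inf_le_left).enorm
    have h2 : (fun t => ‖W t‖ₑ) =ᶠ[𝓝[>] a ⊓ ae volume]
        fun t => eLpNorm (fun x => v (x, t) - u (x, t)) 2 (volume.restrict Ω') := by
      rw [ae_restrict_iff' measurableSet_Ioo] at hW2
      filter_upwards [mem_inf_of_left (Ioo_mem_nhdsGT hab), mem_inf_of_right hW2] with t ht1 ht2
      rw [Lp.enorm_def, eLpNorm_congr_ae (ht2 ht1), eLpNorm_indicator_eq_eLpNorm_restrict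
        hΩo.measurableSet]
    have h3 := tendsto_nhds_unique (h1.congr' h2) hv.initial
    exact enorm_eq_zero.1 h3
  rw [← hW3, hWa]
  simp

/-- The pointwise inequality that turns the energy identity into the energy estimate. -/
lemma structure_inequality (hp : 2 < p) {δ : Fin n → ℝ} (hδ : ∀ i, 0 ≤ δ i) {ε : ℝ} (hε : 0 < ε)
    (ξ η : Space n) :
    ∑ i, |H p (δ i) (ξ i) - H p (δ i) (η i)| ^ 2 + ε * ‖ξ‖ ^ p
      ≤ p ^ 2 * inner ℝ ((gradF0 p δ ξ + ε • gradG p ξ) - gradF0 p δ η) (ξ - η)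
        + p ^ 2 * 5 ^ p * ε * (1 + ‖η‖ ^ p) := by
  have h1 := sum_sq_H_sub_le hp hδ ξ η
  have h2 := half_norm_rpow_le hp ξ η
  have e : inner ℝ ((gradF0 p δ ξ + ε • gradG p ξ) - gradF0 p δ η) (ξ - η)
      = inner ℝ (gradF0 p δ ξ - gradF0 p δ η) (ξ - η) + ε * inner ℝ (gradG p ξ) (ξ - η) := by
    rw [add_sub_right_comm, inner_add_left, real_inner_smul_left]
  -- The bracket is at least `‖ξ‖ ^ p / 2 ≥ 0`, and `p² ≥ 4` absorbs the factor `1 / 2`.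
  have h3 : ‖ξ‖ ^ p ≤ p ^ 2 * (inner ℝ (gradG p ξ) (ξ - η) + 5 ^ p * (1 + ‖η‖ ^ p)) := by
    have h4 : (0 : ℝ) ≤ ‖ξ‖ ^ p := by positivity
    have h5 : (4 : ℝ) ≤ p ^ 2 := by nlinarith
    nlinarith
  have h6 := mul_le_mul_of_nonneg_left h3 hε.le
  rw [e]
  linarith

/-- The integrated form of the structure inequality. -/
lemma integral_structure_inequality {X : Type*} [MeasurableSpace X] {μ : Measure X}
    [IsFiniteMeasure μ] (hp : 2 < p) (hpq : p.HolderConjugate q) {δ : Fin n → ℝ}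
    (hδ : ∀ i, 0 ≤ δ i) {ε : ℝ} (hε : 0 < ε) {f g : X → Space n}
    (hf : MemLp f (ENNReal.ofReal p) μ) (hg : MemLp g (ENNReal.ofReal p) μ) :
    (∑ i, ∫ z, |H p (δ i) (f z i) - H p (δ i) (g z i)| ^ 2 ∂μ) + ε * (∫ z, ‖f z‖ ^ p ∂μ)
      ≤ p ^ 2 * (∫ z, inner ℝ ((gradF0 p δ (f z) + ε • gradG p (f z)) - gradF0 p δ (g z))
          (f z - g z) ∂μ) + p ^ 2 * 5 ^ p * ε * (μ.real univ + ∫ z, ‖g z‖ ^ p ∂μ) := by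
  have i1 : ∀ i ∈ (Finset.univ : Finset (Fin n)),
      Integrable (fun z => |H p (δ i) (f z i) - H p (δ i) (g z i)| ^ 2) μ := fun i _ => by
    have hd := ((memLp_H hp (hδ i) hf i).sub (memLp_H hp (hδ i) hg i)).integrable_sq
    exact hd.congr (Eventually.of_forall fun z => (sq_abs _).symm)
  have i2 := integrable_norm_rpow_of_memLp hpq.pos hf
  have i3 := integrable_norm_rpow_of_memLp hpq.pos hg
  have hB := ((memLp_gradF0 hp hpq hδ hf).add ((memLp_gradG hp hpq hf).const_smul ε)).sub
    (memLp_gradF0 hp hpq hδ hg)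
  have i4 : Integrable (fun z => inner ℝ ((gradF0 p δ (f z) + ε • gradG p (f z))
      - gradF0 p δ (g z)) (f z - g z)) μ := integrable_inner_of_memLp hpq hB (hf.sub hg)
  have i5 : Integrable (fun z => 1 + ‖g z‖ ^ p) μ := (integrable_const _).add i3
  rw [← integral_finsetSum _ i1, ← integral_const_mul,
    ← integral_add (integrable_finsetSum _ i1) (i2.const_mul ε)]
  have e : μ.real univ + ∫ z, ‖g z‖ ^ p ∂μ = ∫ z, (1 + ‖g z‖ ^ p) ∂μ := by
    rw [integral_add (integrable_const _) i3]
    simp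
  rw [e, ← integral_const_mul, ← integral_const_mul,
    ← integral_add (i4.const_mul _) (i5.const_mul _)]
  exact integral_mono ((integrable_finsetSum _ i1).add (i2.const_mul ε))
    ((i4.const_mul _).add (i5.const_mul _)) fun z => structure_inequality hp hδ hε (f z) (g z)

end

/-! ### The energy estimate and its consequences. -/

section

variable {n : ℕ} {p q : ℝ}

lemma integral_sq_eq_norm_sq {X : Type*} [MeasurableSpace X] {μ : Measure X} (f : Lp ℝ 2 μ) :
    ∫ x, |f x| ^ 2 ∂μ = ‖f‖ ^ 2 := by
  rw [← real_inner_self_eq_norm_sq, L2.inner_def]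
  refine integral_congr_ae (Eventually.of_forall fun x => ?_)
  simp [pow_two]

/-- The representative of `v` is built as that of `u` plus the restriction of `W`, so at time `b`
their difference is exactly the restriction of `W b`. -/
lemma exists_isContRep_add {O : Set (Space n)} {a b : ℝ} {u v : Space n × ℝ → ℝ}
    {U : ℝ → Lp ℝ 2 (volume.restrict O)} (hU : IsContRep O a b u U) (hO : MeasurableSet O)
    {W : ℝ → Lp ℝ 2 (volume : Measure (Space n))} (hW : ContinuousOn W (Icc a b))
    (hWe : ∀ᵐ t ∂(volume.restrict (Ioo a b)),
      ⇑(W t) =ᵐ[volume] O.indicator fun x => v (x, t) - u (x, t)) :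
    ∃ V, IsContRep O a b v V ∧ ∫ x in O, |V b x - U b x| ^ 2 ≤ ‖W b‖ ^ 2 := by
  have hR : IsContRep O a b (fun z => v z - u z) _ := IsContRep.of_ae_eq hW (by
    filter_upwards [hWe] with t ht
    rw [EventuallyEq, ae_restrict_iff' hO]
    filter_upwards [ht] with x hx hxm
    rw [hx, indicator_of_mem hxm])
  refine ⟨_, by simpa only [add_sub_cancel] using hU.add hR, ?_⟩
  set R := LpToLpRestrictCLM (Space n) ℝ ℝ volume 2 O (W b) with hRdef
  have h1 : ∫ x in O, |(U b + R) x - U b x| ^ 2 = ∫ x in O, |R x| ^ 2 := by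
    refine integral_congr_ae ?_
    filter_upwards [Lp.coeFn_add (U b) R] with x hx
    rw [hx, Pi.add_apply, add_sub_cancel_left]
  rw [h1, integral_sq_eq_norm_sq]
  gcongr
  exact norm_Lp_toLp_restrict_le O (W b)

/-- The energy estimate for the difference of the two solutions. -/
lemma IsCauchyDirichletSol.exists_energy_estimate (hp : 2 < p) {δ : Fin n → ℝ}
    (hδ : ∀ i, 0 ≤ δ i) {Ω Ω' : Set (Space n)} (hΩ : IsOpen Ω) (hΩo : IsOpen Ω')
    (hΩ' : IsCompact (closure Ω')) (hsub : closure Ω' ⊆ Ω) {T₀ T₁ a b : ℝ} (ha : T₀ < a)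
    (hab : a < b) (hb : b < T₁) {u : Space n × ℝ → ℝ} {Du : Space n × ℝ → Space n}
    (hu : IsLocalWeakSol p δ Ω (Ioo T₀ T₁) u Du) {ε : ℝ} (hε : 0 < ε) {v : Space n × ℝ → ℝ}
    {Dv : Space n × ℝ → Space n} (hv : IsCauchyDirichletSol p δ ε Ω' a b u Du v Dv) :
    ∃ U V : ℝ → Lp ℝ 2 (volume.restrict Ω'), IsContRep Ω' a b u U ∧ IsContRep Ω' a b v V ∧
      (∫ x in Ω', |V b x - U b x| ^ 2)
        + (∑ i, ∫ z in Ω' ×ˢ Ioo a b, |H p (δ i) (Dv z i) - H p (δ i) (Du z i)| ^ 2)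
        + ε * (∫ z in Ω' ×ˢ Ioo a b, ‖Dv z‖ ^ p)
        ≤ p ^ 2 * 5 ^ p * ε * (volume.real (Ω' ×ˢ Ioo a b)
            + ∫ z in Ω' ×ˢ Ioo a b, ‖Du z‖ ^ p) := by
  have hpq := Real.HolderConjugate.conjExponent (p := p) (by linarith)
  obtain ⟨U, hU⟩ := hu.exists_isContRep hp hpq hδ hΩ hΩ' hsub ha hab hb
  obtain ⟨W, hW, hWe, hWb⟩ := hv.exists_energy_identity hp hpq hδ hΩ hΩo hΩ' hsub ha hab hb hu
  obtain ⟨V, hV, hUV⟩ := exists_isContRep_add hU hΩo.measurableSet hW hWe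
  refine ⟨U, V, hU, hV, ?_⟩
  have hmem := hu.memLoc Ω' hΩo hΩ' hsub a b hab (Icc_subset_Ioo ha hb)
  have hfinO : IsFiniteMeasure ((volume : Measure (Space n)).restrict Ω') :=
    ⟨by simpa using (measure_mono subset_closure).trans_lt hΩ'.measure_lt_top⟩
  have hfin : IsFiniteMeasure ((volume : Measure (Space n × ℝ)).restrict (Ω' ×ˢ Ioo a b)) := by
    rw [volume_restrict_prod]
    infer_instance
  have h := integral_structure_inequality hp hpq hδ hε hv.mem.memLp_grad hmem.memLp_grad
  rw [measureReal_restrict_apply_univ] at h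
  -- By the energy identity, `p²` times the integral of the inner product equals `-(p² / 2) ‖W b‖²`.
  -- Since `p² / 2 ≥ 1`, this term absorbs the integral of `|V b - U b|²`.
  have hp4 : 4 ≤ p ^ 2 := by nlinarith
  nlinarith [sq_nonneg ‖W b‖]

/-- `L²` convergence from bounds on the integral of the square. -/
lemma tendsto_eLpNorm_two_of_integral_sq_le {X ι : Type*} [MeasurableSpace X] {μ : Measure X}
    {l : Filter ι} {f : ι → X → ℝ} {B : ι → ℝ} (hf : ∀ᶠ k in l, MemLp (f k) 2 μ)
    (hB : ∀ᶠ k in l, ∫ x, |f k x| ^ 2 ∂μ ≤ B k) (hB0 : Tendsto B l (𝓝 0)) :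
    Tendsto (fun k => eLpNorm (f k) 2 μ) l (𝓝 0) := by
  have h1 : Tendsto (fun k => ENNReal.ofReal (B k ^ (2⁻¹ : ℝ))) l (𝓝 0) := by
    have := (hB0.rpow_const (p := (2⁻¹ : ℝ)) (Or.inr (by norm_num)))
    rw [Real.zero_rpow (by norm_num)] at this
    simpa using ENNReal.tendsto_ofReal this
  refine tendsto_of_tendsto_of_tendsto_of_le_of_le' tendsto_const_nhds h1
    (Eventually.of_forall fun _ => zero_le) ?_
  filter_upwards [hf, hB] with k hk1 hk2
  rw [hk1.eLpNorm_eq_integral_rpow_norm (by norm_num) (by norm_num)]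
  refine ENNReal.ofReal_le_ofReal ?_
  simp only [ENNReal.toReal_ofNat, Real.rpow_two, Real.norm_eq_abs]
  exact Real.rpow_le_rpow (integral_nonneg fun x => by positivity) hk2 (by norm_num)

/-- There are only finitely many indices, so the infimum of the positive `δᵢ` is positive. -/
lemma eventually_admissible (δ : Fin n → ℝ) : ∀ᶠ ε in 𝓝[>] (0 : ℝ), Admissible δ ε := by
  have h : ∀ r : ℝ, 0 < r → ∀ᶠ ε in 𝓝[>] (0 : ℝ), ε < r := fun r hr =>
    nhdsWithin_le_nhds (Iio_mem_nhds hr)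
  refine eventually_mem_nhdsWithin.and ((h 1 one_pos).and (eventually_all.2 fun i => ?_))
  by_cases hi : 0 < δ i
  · filter_upwards [h _ hi] with ε h1 _ using h1
  · exact Eventually.of_forall fun _ h1 => absurd h1 hi

end

end Orthotropic

end

/-! ### The comparison estimate and the limit `ε → 0`. -/

theorem proposition5p1 (p : ℝ) (hp : 2 < p) :
    ∃ c : ℝ, 0 < c ∧
      ∀ (n : ℕ) (_ : 2 ≤ n) (δ : Fin n → ℝ) (_ : ∀ i, 0 ≤ δ i)
        (Ω : Set (Space n)) (_ : IsOpen Ω) (_ : Bornology.IsBounded Ω)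
        (T₀ T₁ : ℝ) (_ : T₀ < T₁)
        (Ω' : Set (Space n)) (_ : IsOpen Ω') (_ : closure Ω' ⊆ Ω)
        (τ₀ τ₁ : ℝ) (_ : T₀ < τ₀) (_ : τ₀ < τ₁) (_ : τ₁ < T₁)
        (u : Space n × ℝ → ℝ) (Du : Space n × ℝ → Space n)
        (_ : Orthotropic.IsLocalWeakSol p δ Ω (Ioo T₀ T₁) u Du),
        (∀ (ε : ℝ) (_ : Orthotropic.Admissible δ ε)
            (v : Space n × ℝ → ℝ) (Dv : Space n × ℝ → Space n)
            (_ : Orthotropic.IsCauchyDirichletSol p δ ε Ω' τ₀ τ₁ u Du v Dv),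
            (∀ i, MemLp (fun z => Orthotropic.H p (δ i) (Du z i)) 2
                (volume.restrict (Ω' ×ˢ Ioo τ₀ τ₁))) ∧
            (∀ i, MemLp (fun z => Orthotropic.H p (δ i) (Dv z i)) 2
                (volume.restrict (Ω' ×ˢ Ioo τ₀ τ₁))) ∧
            (∃ U V : ℝ → Lp ℝ 2 (volume.restrict Ω'),
              Orthotropic.IsContRep Ω' τ₀ τ₁ u U ∧ Orthotropic.IsContRep Ω' τ₀ τ₁ v V ∧
              (∫ x in Ω', |V τ₁ x - U τ₁ x| ^ 2)
                + (∑ i, ∫ z in Ω' ×ˢ Ioo τ₀ τ₁,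
                    |Orthotropic.H p (δ i) (Dv z i) - Orthotropic.H p (δ i) (Du z i)| ^ 2)
                + ε * (∫ z in Ω' ×ˢ Ioo τ₀ τ₁, ‖Dv z‖ ^ p)
                ≤ c * ε * (volume.real (Ω' ×ˢ Ioo τ₀ τ₁)
                    + ∫ z in Ω' ×ˢ Ioo τ₀ τ₁, ‖Du z‖ ^ p)) ∧
            (∫ z in Ω' ×ˢ Ioo τ₀ τ₁, ‖Dv z‖ ^ p)
              ≤ c * (volume.real (Ω' ×ˢ Ioo τ₀ τ₁)
                  + ∫ z in Ω' ×ˢ Ioo τ₀ τ₁, ‖Du z‖ ^ p)) ∧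
        (∀ (v : ℝ → Space n × ℝ → ℝ) (Dv : ℝ → Space n × ℝ → Space n)
            (_ : ∀ ε, Orthotropic.Admissible δ ε →
              Orthotropic.IsCauchyDirichletSol p δ ε Ω' τ₀ τ₁ u Du (v ε) (Dv ε))
            (j : Fin n),
            Tendsto (fun ε => eLpNorm
                (fun z => Orthotropic.H p (δ j) (Dv ε z j) - Orthotropic.H p (δ j) (Du z j)) 2
                (volume.restrict (Ω' ×ˢ Ioo τ₀ τ₁)))
              (𝓝[>] 0) (𝓝 0)) := by
  -- The factor `p²` comes from the monotonicity of `D F₀` and `5 ^ p` from the coercivity of `D G`.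
  -- Neither depends on the dimension.
  refine ⟨p ^ 2 * 5 ^ p, by positivity, ?_⟩
  intro n _ δ hδ Ω hΩ hΩb T₀ T₁ _ Ω' hΩo hsub τ₀ τ₁ h0 h01 h1 u Du hu
  have hΩ' : IsCompact (closure Ω') :=
    Metric.isCompact_of_isClosed_isBounded isClosed_closure (hΩb.subset hsub)
  have hmem := hu.memLoc Ω' hΩo hΩ' hsub τ₀ τ₁ h01 (Icc_subset_Ioo h0 h1)
  have hDu := fun i => Orthotropic.memLp_H hp (hδ i) hmem.memLp_grad i
  refine ⟨fun ε hε v Dv hv => ?_, fun v Dv hv j => ?_⟩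
  · obtain ⟨U, V, hU, hV, h⟩ :=
      hv.exists_energy_estimate hp hδ hΩ hΩo hΩ' hsub h0 h01 h1 hu hε.1
    refine ⟨hDu, fun i => Orthotropic.memLp_H hp (hδ i) hv.mem.memLp_grad i,
      ⟨U, V, hU, hV, h⟩, ?_⟩
    have e1 : 0 ≤ ∫ x in Ω', |V τ₁ x - U τ₁ x| ^ 2 := integral_nonneg fun x => by positivity
    have e2 : 0 ≤ ∑ i, ∫ z in Ω' ×ˢ Ioo τ₀ τ₁,
        |Orthotropic.H p (δ i) (Dv z i) - Orthotropic.H p (δ i) (Du z i)| ^ 2 :=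
      Finset.sum_nonneg fun i _ => integral_nonneg fun z => by positivity
    -- The first two terms of the estimate are nonnegative and are dropped. Then `ε` cancels.
    refine le_of_mul_le_mul_left ?_ hε.1
    linarith
  · set K := p ^ 2 * 5 ^ p * (volume.real (Ω' ×ˢ Ioo τ₀ τ₁)
      + ∫ z in Ω' ×ˢ Ioo τ₀ τ₁, ‖Du z‖ ^ p)
    -- The squared `L²` distance is at most `ε K`, with `K` independent of `ε`.
    refine Orthotropic.tendsto_eLpNorm_two_of_integral_sq_le (B := fun ε => ε * K) ?_ ?_ ?_
    · filter_upwards [Orthotropic.eventually_admissible δ] with ε hε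
      exact (Orthotropic.memLp_H hp (hδ j) (hv ε hε).mem.memLp_grad j).sub (hDu j)
    · filter_upwards [Orthotropic.eventually_admissible δ] with ε hε
      obtain ⟨U, V, -, -, h⟩ :=
        (hv ε hε).exists_energy_estimate hp hδ hΩ hΩo hΩ' hsub h0 h01 h1 hu hε.1
      have e1 : 0 ≤ ∫ x in Ω', |V τ₁ x - U τ₁ x| ^ 2 := integral_nonneg fun x => by positivity
      have e2 := Finset.single_le_sum (f := fun i => ∫ z in Ω' ×ˢ Ioo τ₀ τ₁,
        |Orthotropic.H p (δ i) (Dv ε z i) - Orthotropic.H p (δ i) (Du z i)| ^ 2)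
        (fun i _ => integral_nonneg fun z => by positivity) (Finset.mem_univ j)
      have e3 : 0 ≤ ε * ∫ z in Ω' ×ˢ Ioo τ₀ τ₁, ‖Dv ε z‖ ^ p :=
        mul_nonneg hε.1.le (integral_nonneg fun z => by positivity)
      have e4 : p ^ 2 * 5 ^ p * ε * (volume.real (Ω' ×ˢ Ioo τ₀ τ₁)
          + ∫ z in Ω' ×ˢ Ioo τ₀ τ₁, ‖Du z‖ ^ p) = ε * K := by ring
      linarith
    · have h : Tendsto (fun ε : ℝ => ε * K) (𝓝 0) (𝓝 (0 * K)) := tendsto_id.mul_const K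
      rw [zero_mul] at h
      exact h.mono_left nhdsWithin_le_nhds
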